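/- Let $n\ge 1$, let $X$ be a smooth manifold of dimension $2n$ and let $\pi$ be a log-Poisson structure on $X$, i.e. a Poisson bivector for which the section $\wedge^n\pi$ of $\det(TX)$ is transverse to the zero section. Its zero set $\iota\colon Z\hookrightarrow X$ is a smooth hypersurface. Let $\mathcal{A}_Z\to X$ be the log-tangent bundle, the Lie algebroid whose sections are the vector fields on $X$ tangent to $Z$, and let $\omega\in\Omega^2(\mathcal{A}_Z)$ be the $\mathcal{A}_Z$-symplectic form dual to $\pi$, i.e. a closed nondegenerate $\mathcal{A}_Z$-form which is the inverse of an $\mathcal{A}_Z$-bivector lifting $\pi$. Let $\mathrm{Res}_Z\colon\Omega^{\bullet}(\mathcal{A}_Z)\to\Omega^{\bullet-1}(Z)$ be the residue map, which contracts a form with the canonical section of the kernel of the anchor of $\mathcal{A}_Z|_Z$ (locally $z\partial_z$, for $z$ a local defining function of $Z$) and restricts the result to $Z$, so that locally $\mathrm{Res}_Z(d\log z\wedge\widetilde\alpha+\widetilde\beta)=\iota^*\widetilde\alpha$. Put $$\rho:=\mathrm{Res}_Z(e^\omega)=\mathrm{Res}_Z\Big(\sum_{k=1}^n\tfrac1{k!}\omega^k\Big)\in\Omega^\bullet(Z),\qquad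 \alpha:=\mathrm{Res}_Z(\omega)\in\Omega^1(Z).$$ Then the following hold. 1. $\rho$ is well defined and closed, and its component of degree $2n-1=\dim Z$ vanishes nowhere. 2. $\rho$ is a $1$-cosymplectic global pure spinor, and so defines a $1$-cosymplectic structure (the line $\langle\rho\rangle$): there is a closed two-form $\beta$ on $Z$ of constant rank $2(n-1)$ such that $\alpha$ is closed, $\alpha\wedge\beta^{n-1}$ vanishes nowhere, and $\rho=\alpha\wedge e^\beta$. 3. Consequently, $Z$ inherits a unimodular symplectic foliation of corank $1$: the kernel of the nowhere vanishing closed one-form $\alpha$ is an involutive distribution, on which $\beta$ restricts to a leafwise symplectic form. -/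

import Mathlib

open scoped Manifold ContDiff Nat

noncomputable section

namespace LogPoisson

/-! ### Forms on a Lie algebroid

A Lie algebroid is handled through its Lie-Rinehart algebra of sections: `R` is the algebra of
smooth functions of the base, `L` is the `R`-module of sections with its Lie bracket, and
`⁅v, f⁆` is the derivative of the function `f` along the anchor of the section `v`. -/

section Multilinear

variable {R M : Type*} [CommRing R] [AddCommGroup M] [Module R M]

/-- The exterior product of alternating forms (sum over shuffles, so that
`(a ∧ b) (u, v) = a u * b v - a v * b u` for one-forms). -/
def wedge {k l : ℕ} (a : M [⋀^Fin k]→ₗ[R] R) (b : M [⋀^Fin l]→ₗ[R] R) :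
    M [⋀^Fin (k + l)]→ₗ[R] R :=
  ((LinearMap.mul' R R).compAlternatingMap (a.domCoprod b)).domDomCongr finSumFinEquiv

/-- The `j`-th exterior power `b ∧ ... ∧ b` of a form of degree two. -/
def wedgePow (b : M [⋀^Fin 2]→ₗ[R] R) : (j : ℕ) → M [⋀^Fin (2 * j)]→ₗ[R] R
  | 0 => AlternatingMap.constOfIsEmpty R M (Fin 0) 1
  | j + 1 => wedge (wedgePow b j) b

variable (R M) in
/-- Inhomogeneous forms, given by their components in all degrees. -/
abbrev InhForm := (k : ℕ) → M [⋀^Fin k]→ₗ[R] R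

/-- The exponential `e^b = ∑ j, b^j / j!` of a two-form: its component of degree `2 * j` is
`b^j / j!` and its components of odd degree vanish. -/
def expForm [Algebra ℝ R] (b : M [⋀^Fin 2]→ₗ[R] R) : InhForm R M := fun k =>
  if h : Even k then
    (((k / 2)! : ℝ)⁻¹) •
      (wedgePow b (k / 2)).domDomCongr (finCongr (Nat.two_mul_div_two_of_even h))
  else 0

/-- The inhomogeneous form `e^b ∧ a` for a one-form `a` and a two-form `b`
(which equals `a ∧ e^b`, because `e^b` has only components of even degree). -/
def spinor [Algebra ℝ R] (a : M [⋀^Fin 1]→ₗ[R] R) (b : M [⋀^Fin 2]→ₗ[R] R) : InhForm R M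
  | 0 => 0
  | k + 1 => wedge (expForm b k) a

/-- The (sections of the) line `⟨ρ⟩` spanned by an inhomogeneous form. -/
def spinorLine (ρ : InhForm R M) : Set (InhForm R M) := {Ψ | ∃ f : R, ∀ k, Ψ k = f • ρ k}

end Multilinear

section Algebroid

variable (R L : Type*) [CommRing R] [LieRing L] [Module R L] [LieRingModule L R]

/-- The forms of degree `k` on a Lie algebroid with functions `R` and sections `L`. -/
abbrev Form (k : ℕ) := L [⋀^Fin k]→ₗ[R] R

/-- The bivectors on a Lie algebroid: alternating bilinear maps on its one-forms. -/
abbrev Bivector := Form R L 1 [⋀^Fin 2]→ₗ[R] R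

variable {R L}

/-- The value on sections of the Lie algebroid differential of a form:
`dη(v₀, ..., vₖ) = ∑ i, (-1)^i vᵢ(η(..., v̂ᵢ, ...))
  + ∑ i < j, (-1)^(i + j) η([vᵢ, vⱼ], ..., v̂ᵢ, ..., v̂ⱼ, ...)`.
The pair `(i, j)` of the code stands for the pair `(i, j + 1)` of this formula, hence the minus
sign in front of the double sum. -/
def extDer : {k : ℕ} → Form R L k → (Fin (k + 1) → L) → R
  | 0, η, v => ⁅v 0, η ![]⁆
  | k + 1, η, v =>
      (∑ i : Fin (k + 2), (-1) ^ (i : ℕ) * ⁅v i, η (i.removeNth v)⁆) -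
        ∑ i : Fin (k + 1), ∑ j ≥ i, (-1) ^ (i + j : ℕ) *
          η (Matrix.vecCons ⁅v i.castSucc, v j.succ⁆ (j.removeNth (i.castSucc.removeNth v)))

/-- A form `η` on a Lie algebroid is closed if `dη = 0`. -/
def FormClosed {k : ℕ} (η : Form R L k) : Prop := ∀ v, extDer η v = 0

/-- A symplectic form on a Lie algebroid: a closed two-form `ωL` that is nondegenerate, i.e. for
which `v ↦ ι_v ωL = ωL(v, ·)` is an isomorphism from sections to one-forms. -/
structure IsSymplectic (ωL : Form R L 2) : Prop where
  closed : FormClosed ωL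
  nondegenerate : Function.Bijective fun v : L => (ωL.curryLeft v : Form R L 1)

/-- The differential `df` of a function, as a one-form on the Lie algebroid. -/
def dFun [LieRinehartRing R L] (f : R) : Form R L 1 :=
  AlternatingMap.ofSubsingleton R L R (0 : Fin 1)
    { toFun := fun v => ⁅v, f⁆
      map_add' := fun v w => add_lie v w f
      map_smul' := fun a v => LieRinehartRing.lie_smul_eq_mul a f v }

/-- The restriction of a form to a Lie subalgebroid over the same base, i.e. its pullback along
the inclusion. -/
def restrict (A : LieRinehartSubalgebra R L) {k : ℕ} (η : Form R L k) : Form R A k :=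
  η.compLinearMap (SMulMemClass.subtype A)

/-- `ωA` is dual to the bivector `π`, with respect to the Lie algebroid `A` with inclusion
`φ : A → L` of sections: there is an `A`-bivector `πA` with `φ(πA) = π`, whose map
`ξ ↦ πA(ξ, ·)` is inverse to `v ↦ ωA(v, ·)`. -/
def IsDual {A : LieRinehartSubalgebra R L} (π : Bivector R L) (ωA : Form R A 2) : Prop :=
  ∃ πA : Bivector R A,
    (∀ ξ η : Form R L 1, πA ![restrict A ξ, restrict A η] = π ![ξ, η]) ∧
    ∀ (v : A) (ξ : Form R A 1), πA ![ωA.curryLeft v, ξ] = ξ ![v]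

end Algebroid

/-! ### Log-Poisson structures and the log-tangent bundle -/

section Manifold

variable (E : Type*) [NormedAddCommGroup E] [NormedSpace ℝ E]
  (X : Type*) [TopologicalSpace X] [ChartedSpace E X]

/-- Smooth real functions on `X`. -/
abbrev Fun := C^∞⟮𝓘(ℝ, E), X; ℝ⟯

/-- Smooth vector fields on `X`, as derivations of the algebra of smooth functions. -/
abbrev VF := Derivation ℝ (Fun E X) (Fun E X)

variable {E X}

/-- The vanishing ideal `I_Z` of a subset. -/
def vanishingIdeal (Z : Set X) : Ideal (Fun E X) where
  carrier := {f | ∀ x ∈ Z, f x = 0}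
  add_mem' := fun {f g} hf hg x hx => by simp [hf x hx, hg x hx]
  zero_mem' := fun _ _ => rfl
  smul_mem' := fun f g hg x hx => by simp [hg x hx]

variable (E) in
/-- The log-tangent bundle `A_Z`, through its sections: the vector fields tangent to `Z`, i.e. the
derivations that preserve the vanishing ideal `I_Z`. -/
def logTangent (Z : Set X) : LieRinehartSubalgebra (Fun E X) (VF E X) where
  carrier := {D | ∀ f ∈ vanishingIdeal (E := E) Z, D f ∈ vanishingIdeal (E := E) Z}
  add_mem' := fun {D D'} hD hD' f hf => add_mem (hD f hf) (hD' f hf)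
  zero_mem' := fun f _ => zero_mem (vanishingIdeal Z)
  smul_mem' := fun a D hD f hf => (vanishingIdeal Z).mul_mem_left a (hD f hf)
  lie_mem' := fun {D D'} hD hD' f hf => by
    rw [Derivation.commutator_apply]
    exact sub_mem (hD _ (hD' f hf)) (hD' _ (hD f hf))

/-- The Poisson bracket `{f, g} = π(df, dg)`. -/
def bracket (π : Bivector (Fun E X) (VF E X)) (f g : Fun E X) : Fun E X :=
  π ![dFun f, dFun g]

/-- The degeneracy locus of a bivector on a `2n`-dimensional manifold: the zero set of the
section `π^n` of the determinant of the tangent bundle. -/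
def degeneracyLocus (n : ℕ) (π : Bivector (Fun E X) (VF E X)) : Set X :=
  {x | ∀ ξ : Fin (2 * n) → Form (Fun E X) (VF E X) 1, wedgePow π n ξ x = 0}

/-- A log-Poisson structure on a `2n`-dimensional manifold: a Poisson bivector `π` for which the
section `π^n` of the determinant line bundle of the tangent bundle is transverse to the zero
section. Since the intrinsic derivative of `π^n` at a zero takes values in a line, transversality
says that this derivative is not zero. -/
structure IsLogPoisson (n : ℕ) (π : Bivector (Fun E X) (VF E X)) : Prop where
  jacobi : ∀ f g h : Fun E X,
    bracket π f (bracket π g h) + bracket π g (bracket π h f) + bracket π h (bracket π f g) = 0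
  transverse : ∀ x ∈ degeneracyLocus n π,
    ∃ (D : VF E X) (ξ : Fin (2 * n) → Form (Fun E X) (VF E X) 1), D (wedgePow π n ξ) x ≠ 0

/-! ### The residue map -/

variable {F : Type*} [NormedAddCommGroup F] [NormedSpace ℝ F]
  {Y : Type*} [TopologicalSpace Y] [ChartedSpace F Y]

/-- The section `e` of the log-tangent bundle restricts along `Z` to the canonical section of the
kernel of the anchor (locally `z ∂_z` for any local defining function `z` of `Z`): as a vector
field `e` vanishes along `Z`, and its linearization along `Z` is the identity on conormal
vectors. -/
def IsEuler (Z : Set X) (e : VF E X) : Prop :=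
  (∀ f : Fun E X, e f ∈ vanishingIdeal Z) ∧
    ∀ g ∈ vanishingIdeal (E := E) Z, ∀ D : VF E X, D (e g - g) ∈ vanishingIdeal Z

/-- The vector field `W` on `X` is tangent to the submanifold `ι : Y → X` and restricts to the
vector field `V` there. -/
def Related (ι : C^∞⟮𝓘(ℝ, F), Y; 𝓘(ℝ, E), X⟯) (W : VF E X) (V : VF F Y) : Prop :=
  ∀ (f : Fun E X) (y : Y), W f (ι y) = V (f.comp ι) y

/-- The form `ξ` on `Y` is the residue along `ι : Y → X` of the log form `η`: it is the restriction
to `Y` of the contraction of `η` with the canonical section of the kernel of the anchor. Locally,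
`dz/z ∧ α + β` has the residue `ι^* α`. -/
def IsResidue (ι : C^∞⟮𝓘(ℝ, F), Y; 𝓘(ℝ, E), X⟯) {k : ℕ}
    (η : Form (Fun E X) (logTangent E (Set.range ι)) (k + 1))
    (ξ : Form (Fun F Y) (VF F Y) k) : Prop :=
  ∀ e : logTangent E (Set.range ι), IsEuler (Set.range ι) (e : VF E X) →
    ∀ (W : Fin k → logTangent E (Set.range ι)) (V : Fin k → VF F Y),
      (∀ i, Related ι (W i : VF E X) (V i)) →
        ∀ y : Y, η (Matrix.vecCons e W) (ι y) = ξ V y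

open Classical in
/-- The residue map `Res_Z : Ω^(k+1)(A_Z) → Ω^k(Z)`. -/
def residue (ι : C^∞⟮𝓘(ℝ, F), Y; 𝓘(ℝ, E), X⟯) {k : ℕ}
    (η : Form (Fun E X) (logTangent E (Set.range ι)) (k + 1)) : Form (Fun F Y) (VF F Y) k :=
  if h : ∃ ξ, IsResidue ι η ξ then h.choose else 0

/-- The residue map on inhomogeneous forms. -/
def totalResidue (ι : C^∞⟮𝓘(ℝ, F), Y; 𝓘(ℝ, E), X⟯)
    (Ψ : InhForm (Fun E X) (logTangent E (Set.range ι))) : InhForm (Fun F Y) (VF F Y) :=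
  fun k => residue ι (Ψ (k + 1))

/-! ### Cosymplectic structures and symplectic foliations -/

/-- A form that vanishes at no point. -/
def NowhereZero {k : ℕ} (η : Form (Fun F Y) (VF F Y) k) : Prop :=
  ∀ y : Y, ∃ V : Fin k → VF F Y, η V y ≠ 0

/-- The rank at a point of a two-form `β`: the dimension of the image of `v ↦ β(v, ·)`. -/
def rankAt (β : Form (Fun F Y) (VF F Y) 2) (y : Y) : ℕ :=
  Module.finrank ℝ
    (Submodule.span ℝ (Set.range fun (V : VF F Y) => fun (W : VF F Y) => β ![V, W] y))

/-- A `1`-cosymplectic tuple on a manifold of dimension `2ℓ + 1`. -/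
structure IsCosymplecticTuple (ℓ : ℕ) (α : Form (Fun F Y) (VF F Y) 1)
    (β : Form (Fun F Y) (VF F Y) 2) : Prop where
  closed_one : FormClosed α
  closed_two : FormClosed β
  rank : ∀ y : Y, rankAt β y = 2 * ℓ
  nowhereZero : NowhereZero (wedge α (wedgePow β ℓ))

/-- A `1`-cosymplectic structure: the line spanned by the pure spinor `e^β ∧ α` of a
`1`-cosymplectic tuple. -/
def IsCosymplecticStructure (ℓ : ℕ) (K : Set (InhForm (Fun F Y) (VF F Y))) : Prop :=
  ∃ (α : Form (Fun F Y) (VF F Y) 1) (β : Form (Fun F Y) (VF F Y) 2),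
    IsCosymplecticTuple ℓ α β ∧ K = spinorLine (spinor α β)

/-- A unimodular symplectic foliation of corank one: an involutive distribution that is the kernel
of a nowhere vanishing closed one-form, with a leafwise symplectic form `σ`. -/
structure IsUnimodularSymplecticFoliation (𝓕 : LieRinehartSubalgebra (Fun F Y) (VF F Y))
    (σ : Form (Fun F Y) 𝓕 2) : Prop where
  unimodular : ∃ α : Form (Fun F Y) (VF F Y) 1, FormClosed α ∧ NowhereZero α ∧
    ∀ V : VF F Y, V ∈ 𝓕 ↔ α ![V] = 0
  symplectic : IsSymplectic σ

end Manifold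

end LogPoisson

end

set_option linter.unusedSectionVars false

open scoped Manifold ContDiff Nat

noncomputable section

namespace LogPoisson

/-! ### Exterior products and their contraction -/

section WedgeAlgebra

variable {R M : Type*} [CommRing R] [AddCommGroup M] [Module R M]

/-! Along Z the log-tangent bundle is an extension of TZ by the line spanned by the canonical
section e (locally z ∂_z), and the proof works with a splitting of it. Take a global function h that
is nonzero off Z and equals u z² near Z with u nonvanishing; a sum of squares of local defining
functions, weighted by a partition of unity, will do, whether or not Z has a global defining
function (`IsHypersurface.exists_square`). Then θ = ½ d log h is a closed log one-form with θ(e) = 1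
along Z (`IsHypersurface.exists_logDifferential`). Lifting vector fields of Z to log vector fields W
with θ(W) = 0 along Z turns every log form η into a form on Z (`IsSplitting.exists_desc`). The
residue of η is the form obtained in this way from ι_e η; it does not depend on θ
(`IsSplitting.isResidue`). Now α comes from ι_e ω and β from ω itself. Another θ would change β by a
multiple of α, which does not affect α ∧ e^β.

Since θ is closed, its kernel along Z is stable under brackets, so descent commutes with d and β is
closed. Since [e, W] vanishes in the fibres along Z, so does L_e ω on Z, and Cartan's formula makes
α closed (`IsSplitting.formClosed_desc_curryLeft`). The identity ι_e e^ω = e^ω ∧ ι_e ω gives ρ = e^β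
∧ α (`curryLeft_expForm`, `IsSplitting.totalResidue_expForm`).

The remaining claims are linear algebra in a frame (e, W_1, ..., W_{2n-1}) over a point of Z, where
ω is nondegenerate. The value of ω^n on it is n times that of β^{n-1} ∧ α on the frame of Z
(`FrameAt.spinor_ne_zero`), and the kernel of β is a line on which α is injective
(`FrameAt.rankAt_eq`). On ker α, a kernel vector D of β would make a lift minus a multiple of e a
kernel vector of ω, so β is nondegenerate there; one-forms on the leaves are inverted locally
through ω and the solutions glue by uniqueness (`IsSplitting.isSymplectic_restrict`).

Vector fields are derivations, so fibres enter algebraically: a section is zero at a point if every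
linear form kills it there (`NullAt`). Hadamard's lemma provides the link with charts. -/

/-- The exterior product with a flexible degree index. -/
def wedgeCast {k l m : ℕ} (h : k + l = m) (a : M [⋀^Fin k]→ₗ[R] R) (b : M [⋀^Fin l]→ₗ[R] R) :
    M [⋀^Fin m]→ₗ[R] R :=
  (wedge a b).domDomCongr (finCongr h)

theorem wedgeCast_rfl {k l : ℕ} (a : M [⋀^Fin k]→ₗ[R] R) (b : M [⋀^Fin l]→ₗ[R] R) :
    wedgeCast rfl a b = wedge a b := by
  ext v; simp [wedgeCast]

theorem wedge_add_left {k l : ℕ} (a a' : M [⋀^Fin k]→ₗ[R] R) (b : M [⋀^Fin l]→ₗ[R] R) :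
    wedge (a + a') b = wedge a b + wedge a' b := by
  unfold wedge
  rw [← AlternatingMap.domCoprod'_apply, TensorProduct.add_tmul, map_add]
  ext v; simp

theorem wedge_smul_left {k l : ℕ} (c : R) (a : M [⋀^Fin k]→ₗ[R] R) (b : M [⋀^Fin l]→ₗ[R] R) :
    wedge (c • a) b = c • wedge a b := by
  unfold wedge
  rw [← AlternatingMap.domCoprod'_apply, ← TensorProduct.smul_tmul', map_smul]
  ext v; simp

theorem wedge_add_right {k l : ℕ} (a : M [⋀^Fin k]→ₗ[R] R) (b b' : M [⋀^Fin l]→ₗ[R] R) :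
    wedge a (b + b') = wedge a b + wedge a b' := by
  unfold wedge
  rw [← AlternatingMap.domCoprod'_apply, TensorProduct.tmul_add, map_add]
  ext v; simp

theorem wedge_smul_right {k l : ℕ} (c : R) (a : M [⋀^Fin k]→ₗ[R] R) (b : M [⋀^Fin l]→ₗ[R] R) :
    wedge a (c • b) = c • wedge a b := by
  unfold wedge
  rw [← AlternatingMap.domCoprod'_apply, TensorProduct.tmul_smul, map_smul]
  ext v; simp

/-- The exterior product as a bilinear map. -/
def wedgeLin {k l m : ℕ} (h : k + l = m) :
    (M [⋀^Fin k]→ₗ[R] R) →ₗ[R] (M [⋀^Fin l]→ₗ[R] R) →ₗ[R] (M [⋀^Fin m]→ₗ[R] R) :=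
  LinearMap.mk₂ R (wedgeCast h)
    (fun a a' b => by ext v; simp [wedgeCast, wedge_add_left])
    (fun c a b => by ext v; simp [wedgeCast, wedge_smul_left])
    (fun a b b' => by ext v; simp [wedgeCast, wedge_add_right])
    (fun c a b => by ext v; simp [wedgeCast, wedge_smul_right])

theorem wedgeLin_rfl {k l : ℕ} (a : M [⋀^Fin k]→ₗ[R] R) (b : M [⋀^Fin l]→ₗ[R] R) :
    wedgeLin rfl a b = wedge a b := wedgeCast_rfl a b

/-- Multiplying by k! l! replaces the sum over shuffles by a sum over all permutations, since every
coset of the block permutations then contributes each of its members. Pointwise computations with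
products start from this formula. -/
theorem factorial_smul_wedgeLin {k l m : ℕ} (h : k + l = m) (a : M [⋀^Fin k]→ₗ[R] R)
    (b : M [⋀^Fin l]→ₗ[R] R) (v : Fin m → M) :
    (k ! * l !) • wedgeLin h a b v = ∑ σ : Equiv.Perm (Fin m), (Equiv.Perm.sign σ : ℤ) •
      (a (fun i => v (σ (Fin.cast h (Fin.castAdd l i)))) *
        b (fun j => v (σ (Fin.cast h (Fin.natAdd k j))))) := by
  subst h
  have key := congrArg (fun f : M [⋀^Fin k ⊕ Fin l]→ₗ[R] (TensorProduct R R R) =>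
    LinearMap.mul' R R (f (v ∘ finSumFinEquiv))) (MultilinearMap.domCoprod_alternization_eq a b)
  simp only [Fintype.card_fin, AlternatingMap.smul_apply, map_nsmul,
    MultilinearMap.alternatization_apply, map_sum] at key
  rw [wedgeLin_rfl]
  have h1 : wedge a b v = LinearMap.mul' R R ((a.domCoprod b) (v ∘ finSumFinEquiv)) := rfl
  rw [h1, ← key]
  refine Fintype.sum_equiv (Equiv.permCongr finSumFinEquiv) _ _ fun σ => ?_
  rw [Units.smul_def, map_zsmul, Equiv.Perm.sign_permCongr]
  simp [MultilinearMap.domDomCongr_apply, Function.comp_def, Equiv.permCongr_apply]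

/-- A permutation is determined by the position p that it sends to 0 and by what it does to the
others: `p.cycleRange` moves p to the front, and a permutation fixing 0 follows. -/
theorem sum_perm_fin_succ {N : Type*} [AddCommMonoid N] {m : ℕ} (f : Equiv.Perm (Fin (m + 1)) → N) :
    ∑ σ, f σ = ∑ p : Fin (m + 1), ∑ τ : Equiv.Perm (Fin m),
      f (Equiv.Perm.decomposeFin.symm (0, τ) * p.cycleRange) := by
  rw [← Fintype.sum_prod_type']
  symm
  refine Fintype.sum_bijective
    (fun x : Fin (m + 1) × Equiv.Perm (Fin m) =>
      Equiv.Perm.decomposeFin.symm (0, x.2) * x.1.cycleRange) ?_ _ _ fun _ => rfl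
  rw [Fintype.bijective_iff_injective_and_card]
  constructor
  · rintro ⟨p, τ⟩ ⟨q, τ'⟩ h
    simp only at h
    have h0 : ∀ (p : Fin (m + 1)) (τ : Equiv.Perm (Fin m)),
        (Equiv.Perm.decomposeFin.symm (0, τ) * p.cycleRange) p = 0 := by
      intro p τ
      simp [Equiv.Perm.mul_apply, Fin.cycleRange_self]
    have hpq : p = q := by
      have h1 := h0 p τ
      rw [h] at h1
      exact Equiv.injective _ (h1.trans (h0 q τ').symm)
    subst hpq
    have := mul_right_cancel h
    have := Equiv.injective _ this
    simpa using this
  · simp [Fintype.card_perm, Nat.factorial_succ]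

/-- The permutations are sorted by the slot p in which the distinguished argument x lands; moving x
there costs the sign (-1)^p. -/
theorem factorial_smul_wedgeLin_vecCons {k l m : ℕ} (h : k + l = m + 1) (a : M [⋀^Fin k]→ₗ[R] R)
    (b : M [⋀^Fin l]→ₗ[R] R) (x : M) (w : Fin m → M) :
    (k ! * l !) • wedgeLin h a b (Matrix.vecCons x w) =
      ∑ p : Fin (m + 1), ∑ τ : Equiv.Perm (Fin m), (-1 : ℤ) ^ (p : ℕ) • (Equiv.Perm.sign τ : ℤ) •
      (a (fun i => (p.insertNth x (w ∘ τ) : Fin (m + 1) → M) (Fin.cast h (Fin.castAdd l i))) *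
        b (fun j => (p.insertNth x (w ∘ τ) : Fin (m + 1) → M) (Fin.cast h (Fin.natAdd k j)))) := by
  rw [factorial_smul_wedgeLin, sum_perm_fin_succ]
  refine Finset.sum_congr rfl fun p _ => Finset.sum_congr rfl fun τ _ => ?_
  have hv : ∀ i, Matrix.vecCons x w ((Equiv.Perm.decomposeFin.symm (0, τ) * p.cycleRange) i) =
      (p.insertNth x (w ∘ τ) : Fin (m + 1) → M) i := by
    intro i
    rw [← Fin.cons_apply_cycleRange, Equiv.Perm.mul_apply]
    refine Fin.cases ?_ (fun j => ?_) (p.cycleRange i)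
    · simp
    · simp
  simp only [hv]
  rw [Equiv.Perm.sign_mul, Fin.sign_cycleRange, Equiv.Perm.decomposeFin.symm_sign]
  simp only [Units.val_mul, Units.val_pow_eq_pow_val, Units.val_neg, Units.val_one, mul_smul,
    if_true, one_smul]
  rw [smul_comm]

/-- This and the next three lemmas are index bookkeeping: if x is inserted in one block of
arguments, that block acquires x and the other one is unchanged. -/
theorem insertNth_comp_castAdd {N : Type*} {k l m : ℕ} (h : k + 1 + l = m + 1) (h1 : k + l = m)
    (i : Fin (k + 1)) (x : N) (u : Fin m → N) :
    (fun i' : Fin (k + 1) => ((Fin.cast h (Fin.castAdd l i)).insertNth x u : Fin (m + 1) → N)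
      (Fin.cast h (Fin.castAdd l i'))) =
      (i.insertNth x (fun i' => u (Fin.cast h1 (Fin.castAdd l i'))) : Fin (k + 1) → N) := by
  ext i'
  refine Fin.succAboveCases i ?_ (fun i'' => ?_) i'
  · simp
  · have : Fin.cast h (Fin.castAdd l (i.succAbove i'')) =
        (Fin.cast h (Fin.castAdd l i)).succAbove (Fin.cast h1 (Fin.castAdd l i'')) := by
      ext; simp [Fin.succAbove, Fin.lt_def]; split <;> simp
    rw [this]; simp

theorem insertNth_castAdd_comp_natAdd {N : Type*} {k l m : ℕ} (h : k + 1 + l = m + 1)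
    (h1 : k + l = m) (i : Fin (k + 1)) (x : N) (u : Fin m → N) :
    (fun j : Fin l => ((Fin.cast h (Fin.castAdd l i)).insertNth x u : Fin (m + 1) → N)
      (Fin.cast h (Fin.natAdd (k + 1) j))) = fun j => u (Fin.cast h1 (Fin.natAdd k j)) := by
  ext j
  have : Fin.cast h (Fin.natAdd (k + 1) j) =
      (Fin.cast h (Fin.castAdd l i)).succAbove (Fin.cast h1 (Fin.natAdd k j)) := by
    ext; simp [Fin.succAbove, Fin.lt_def]; split <;> simp <;> omega
  rw [this]; simp

theorem insertNth_comp_natAdd {N : Type*} {k l m : ℕ} (h : k + (l + 1) = m + 1) (h1 : k + l = m)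
    (i : Fin (l + 1)) (x : N) (u : Fin m → N) :
    (fun i' : Fin (l + 1) => ((Fin.cast h (Fin.natAdd k i)).insertNth x u : Fin (m + 1) → N)
      (Fin.cast h (Fin.natAdd k i'))) =
      (i.insertNth x (fun i' => u (Fin.cast h1 (Fin.natAdd k i'))) : Fin (l + 1) → N) := by
  ext i'
  refine Fin.succAboveCases i ?_ (fun i'' => ?_) i'
  · simp
  · have : Fin.cast h (Fin.natAdd k (i.succAbove i'')) =
        (Fin.cast h (Fin.natAdd k i)).succAbove (Fin.cast h1 (Fin.natAdd k i'')) := by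
      ext; simp [Fin.succAbove, Fin.lt_def]; split <;> (simp; try omega)
    rw [this]; simp

theorem insertNth_natAdd_comp_castAdd {N : Type*} {k l m : ℕ} (h : k + (l + 1) = m + 1)
    (h1 : k + l = m) (i : Fin (l + 1)) (x : N) (u : Fin m → N) :
    (fun j : Fin k => ((Fin.cast h (Fin.natAdd k i)).insertNth x u : Fin (m + 1) → N)
      (Fin.cast h (Fin.castAdd (l + 1) j))) = fun j => u (Fin.cast h1 (Fin.castAdd l j)) := by
  ext j
  have : Fin.cast h (Fin.castAdd (l + 1) j) =
      (Fin.cast h (Fin.natAdd k i)).succAbove (Fin.cast h1 (Fin.castAdd l j)) := by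
    have hlt : (j : ℕ) < k + i := by omega
    ext; simp [Fin.succAbove, Fin.lt_def, hlt]
  rw [this]; simp

/-- If x falls into the first block, moving it to the front of `a` cancels the sign (-1)^p, so all
slots of this block contribute equally. -/
theorem sum_perm_left {k l m : ℕ} (h : k + 1 + l = m + 1) (h1 : k + l = m)
    (a : M [⋀^Fin (k + 1)]→ₗ[R] R) (b : M [⋀^Fin l]→ₗ[R] R) (x : M) (w : Fin m → M)
    (i : Fin (k + 1)) :
    ∑ τ : Equiv.Perm (Fin m), (-1 : ℤ) ^ ((Fin.cast h (Fin.castAdd l i) : Fin (m + 1)) : ℕ) •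
      (Equiv.Perm.sign τ : ℤ) •
      (a (fun i' => ((Fin.cast h (Fin.castAdd l i)).insertNth x (w ∘ τ) : Fin (m + 1) → M)
          (Fin.cast h (Fin.castAdd l i'))) *
        b (fun j => ((Fin.cast h (Fin.castAdd l i)).insertNth x (w ∘ τ) : Fin (m + 1) → M)
          (Fin.cast h (Fin.natAdd (k + 1) j)))) =
      (k ! * l !) • wedgeLin h1 (a.curryLeft x) b w := by
  rw [factorial_smul_wedgeLin]
  refine Finset.sum_congr rfl fun τ _ => ?_
  rw [insertNth_comp_castAdd h h1, insertNth_castAdd_comp_natAdd h h1, AlternatingMap.map_insertNth,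
    AlternatingMap.curryLeft_apply_apply, smul_comm]
  congr 1
  rw [Fin.val_cast, Fin.val_castAdd, ← smul_mul_assoc, smul_smul, ← mul_pow]
  simp

/-- If x falls into the second block, moving it to the front of `b` cancels only the position within
the block; the sign (-1)^k of passing the first block remains. -/
theorem sum_perm_right {k l m : ℕ} (h : k + (l + 1) = m + 1) (h1 : k + l = m)
    (a : M [⋀^Fin k]→ₗ[R] R) (b : M [⋀^Fin (l + 1)]→ₗ[R] R) (x : M) (w : Fin m → M)
    (i : Fin (l + 1)) :
    ∑ τ : Equiv.Perm (Fin m), (-1 : ℤ) ^ ((Fin.cast h (Fin.natAdd k i) : Fin (m + 1)) : ℕ) •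
      (Equiv.Perm.sign τ : ℤ) •
      (a (fun i' => ((Fin.cast h (Fin.natAdd k i)).insertNth x (w ∘ τ) : Fin (m + 1) → M)
          (Fin.cast h (Fin.castAdd (l + 1) i'))) *
        b (fun j => ((Fin.cast h (Fin.natAdd k i)).insertNth x (w ∘ τ) : Fin (m + 1) → M)
          (Fin.cast h (Fin.natAdd k j)))) =
      (-1 : ℤ) ^ k • (k ! * l !) • wedgeLin h1 a (b.curryLeft x) w := by
  rw [factorial_smul_wedgeLin, Finset.smul_sum]
  refine Finset.sum_congr rfl fun τ _ => ?_
  rw [insertNth_comp_natAdd h h1, insertNth_natAdd_comp_castAdd h h1, AlternatingMap.map_insertNth,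
    AlternatingMap.curryLeft_apply_apply, smul_comm, smul_comm ((-1 : ℤ) ^ k)]
  congr 1
  rw [Fin.val_cast, Fin.val_natAdd, mul_smul_comm, smul_smul, pow_add, mul_assoc, ← mul_pow]
  simp

theorem sum_fin_cast_add {N : Type*} [AddCommMonoid N] {k l m : ℕ} (h : k + l = m)
    (f : Fin m → N) : ∑ p, f p = ∑ i : Fin k, f (Fin.cast h (Fin.castAdd l i)) +
      ∑ j : Fin l, f (Fin.cast h (Fin.natAdd k j)) := by
  subst h
  simpa using Fin.sum_univ_add f

theorem form_ext {k : ℕ} {a b : M [⋀^Fin (k + 1)]→ₗ[R] R}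
    (h : ∀ x, a.curryLeft x = b.curryLeft x) : a = b := by
  ext v
  have := congrArg (fun f => f (Matrix.vecTail v)) (h (Matrix.vecHead v))
  simpa using this

theorem form_ext_zero {a b : M [⋀^Fin 0]→ₗ[R] R} (h : a ![] = b ![]) : a = b := by
  ext v
  rw [Subsingleton.elim v ![], h]

variable [Algebra ℝ R]

/-- The real algebra structure is what allows the factorials to be divided out. -/
theorem nsmul_cancel {n : ℕ} (hn : n ≠ 0) {x y : R} (h : n • x = n • y) : x = y := by
  have h' : (n : ℝ) • x = (n : ℝ) • y := by simpa [Nat.cast_smul_eq_nsmul] using h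
  exact smul_right_injective R (r := (n : ℝ)) (by exact_mod_cast hn) h'

/-- Contraction of an exterior product. -/
theorem curryLeft_wedgeLin {k l m : ℕ} (h : k + 1 + (l + 1) = m + 1) (h1 : k + (l + 1) = m)
    (h2 : k + 1 + l = m) (a : M [⋀^Fin (k + 1)]→ₗ[R] R) (b : M [⋀^Fin (l + 1)]→ₗ[R] R) (x : M) :
    (wedgeLin h a b).curryLeft x = wedgeLin h1 (a.curryLeft x) b +
      (-1 : ℤ) ^ (k + 1) • wedgeLin h2 a (b.curryLeft x) := by
  ext w
  -- The k + 1 equal contributions of the first block turn k! into (k + 1)!, and likewise l + 1 for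
  -- the second, so the common factor cancels.
  refine nsmul_cancel (n := (k + 1)! * (l + 1)!) (by positivity) ?_
  rw [AlternatingMap.curryLeft_apply_apply, factorial_smul_wedgeLin_vecCons, sum_fin_cast_add h]
  simp_rw [sum_perm_left h h1, sum_perm_right h h2]
  simp only [Finset.sum_const, Finset.card_univ, Fintype.card_fin, AlternatingMap.add_apply,
    AlternatingMap.smul_apply, Nat.factorial_succ, nsmul_eq_mul, zsmul_eq_mul]
  push_cast
  ring

theorem curryLeft_wedgeLin_right {l m : ℕ} (h : 0 + (l + 1) = m + 1)
    (h2 : 0 + l = m) (a : M [⋀^Fin 0]→ₗ[R] R) (b : M [⋀^Fin (l + 1)]→ₗ[R] R) (x : M) :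
    (wedgeLin h a b).curryLeft x = wedgeLin h2 a (b.curryLeft x) := by
  ext w
  refine nsmul_cancel (n := 0 ! * (l + 1)!) (by positivity) ?_
  rw [AlternatingMap.curryLeft_apply_apply, factorial_smul_wedgeLin_vecCons, sum_fin_cast_add h]
  simp_rw [sum_perm_right h h2]
  simp only [Finset.sum_const, Finset.card_univ, Fintype.card_fin, Nat.factorial_succ,
    nsmul_eq_mul, zsmul_eq_mul, Finset.univ_eq_empty, Finset.sum_empty]
  push_cast
  ring

theorem curryLeft_wedgeLin_left {k m : ℕ} (h : k + 1 + 0 = m + 1)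
    (h1 : k + 0 = m) (a : M [⋀^Fin (k + 1)]→ₗ[R] R) (b : M [⋀^Fin 0]→ₗ[R] R) (x : M) :
    (wedgeLin h a b).curryLeft x = wedgeLin h1 (a.curryLeft x) b := by
  ext w
  refine nsmul_cancel (n := (k + 1)! * 0 !) (by positivity) ?_
  rw [AlternatingMap.curryLeft_apply_apply, factorial_smul_wedgeLin_vecCons, sum_fin_cast_add h]
  simp_rw [sum_perm_left h h1]
  simp only [Finset.sum_const, Finset.card_univ, Fintype.card_fin, Nat.factorial_succ,
    nsmul_eq_mul, zsmul_eq_mul, Finset.univ_eq_empty, Finset.sum_empty]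
  push_cast
  ring

theorem wedgeLin_zero_zero (a b : M [⋀^Fin 0]→ₗ[R] R) (v : Fin 0 → M) :
    wedgeLin (rfl : 0 + 0 = 0) a b v = a ![] * b ![] := by
  refine nsmul_cancel (n := 0 ! * 0 !) (by positivity) ?_
  rw [factorial_smul_wedgeLin]
  simp
  congr <;> exact Subsingleton.elim _ _

end WedgeAlgebra

/-! ### Lie derivatives and Cartan's formula -/

section Cartan

variable {R L : Type*} [CommRing R] [LieRing L] [Module R L] [LieRingModule L R]
  [LieRinehartRing R L]

/-- The Lie derivative of a form along a section. -/
def lieForm (v : L) {k : ℕ} (η : Form R L k) : Form R L k where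
  toFun w := ⁅v, η w⁆ - ∑ i, η (Function.update w i ⁅v, w i⁆)
  map_update_add' {inst} m i₀ x y := by
    obtain rfl := Subsingleton.elim inst (instDecidableEqFin k)
    have : ∀ i, η (Function.update (Function.update m i₀ (x + y)) i
        ⁅v, Function.update m i₀ (x + y) i⁆) =
        η (Function.update (Function.update m i₀ x) i ⁅v, Function.update m i₀ x i⁆) +
        η (Function.update (Function.update m i₀ y) i ⁅v, Function.update m i₀ y i⁆) := by
      intro i
      rcases eq_or_ne i i₀ with rfl | hi
      · simp
      · simp only [Function.update_of_ne hi, Function.update_comm hi.symm, η.map_update_add]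
    simp only [η.map_update_add, lie_add]
    rw [Finset.sum_congr rfl fun i _ => this i, Finset.sum_add_distrib]
    ring
  map_update_smul' {inst} m i₀ c x := by
    obtain rfl := Subsingleton.elim inst (instDecidableEqFin k)
    have : ∀ i, η (Function.update (Function.update m i₀ (c • x)) i
        ⁅v, Function.update m i₀ (c • x) i⁆) =
        c * η (Function.update (Function.update m i₀ x) i ⁅v, Function.update m i₀ x i⁆) +
        (if i = i₀ then ⁅v, c⁆ * η (Function.update m i₀ x) else 0) := by
      intro i
      rcases eq_or_ne i i₀ with rfl | hi
      · simp [LieRinehartRing.leibniz_smul_right, η.map_update_add, η.map_update_smul]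
      · simp only [Function.update_of_ne hi, Function.update_comm hi.symm, η.map_update_smul,
          if_neg hi, add_zero, smul_eq_mul]
    simp only [η.map_update_smul, smul_eq_mul, LieRinehartRing.leibniz_mul_right]
    rw [Finset.sum_congr rfl fun i _ => this i, Finset.sum_add_distrib, ← Finset.mul_sum,
      Finset.sum_ite_eq', if_pos (Finset.mem_univ _)]
    ring
  map_eq_zero_of_eq' w i j hw hij := by
    have h0 : η w = 0 := η.map_eq_zero_of_eq w hw hij
    have h1 : ∑ l, η (Function.update w l ⁅v, w l⁆) =
        η (Function.update w i ⁅v, w i⁆) + η (Function.update w j ⁅v, w j⁆) := by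
      refine Fintype.sum_eq_add i j hij fun l hl => ?_
      refine η.map_eq_zero_of_eq _ ?_ hij
      rw [Function.update_of_ne hl.1.symm, Function.update_of_ne hl.2.symm, hw]
    have h2 : Function.update w j ⁅v, w j⁆ = (Function.update w i ⁅v, w i⁆) ∘ Equiv.swap i j := by
      ext l
      rcases eq_or_ne l i with rfl | hli
      · simp [Function.update_of_ne hij, hij.symm, hw]
      rcases eq_or_ne l j with rfl | hlj
      · simp [hw]
      · simp [Equiv.swap_apply_of_ne_of_ne hli hlj, hli, hlj]
    rw [h1, h2, η.map_swap _ hij, h0]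
    simp

theorem lieForm_apply (v : L) {k : ℕ} (η : Form R L k) (w : Fin k → L) :
    lieForm v η w = ⁅v, η w⁆ - ∑ i, η (Function.update w i ⁅v, w i⁆) := rfl

theorem lieForm_zero_apply (v : L) (η : Form R L 0) (w : Fin 0 → L) :
    lieForm v η w = ⁅v, η w⁆ := by
  simp [lieForm_apply]

theorem lieForm_add (v : L) {k : ℕ} (η η' : Form R L k) :
    lieForm v (η + η') = lieForm v η + lieForm v η' := by
  ext w
  simp only [lieForm_apply, AlternatingMap.add_apply, lie_add, Finset.sum_add_distrib]
  ring

theorem lieForm_zsmul (v : L) {k : ℕ} (c : ℤ) (η : Form R L k) :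
    lieForm v (c • η) = c • lieForm v η := by
  ext w
  simp only [lieForm_apply, AlternatingMap.smul_apply, lie_zsmul, smul_sub, Finset.smul_sum]

/-- The commutation rule [L_v, ι_x] = ι_[v,x], solved for ι_x L_v. It drives the inductions on
degree that follow. -/
theorem curryLeft_lieForm (v x : L) {k : ℕ} (η : Form R L (k + 1)) :
    (lieForm v η).curryLeft x = lieForm v (η.curryLeft x) - η.curryLeft ⁅v, x⁆ := by
  ext w
  have : ∀ i : Fin k, Function.update (Matrix.vecCons x w) i.succ ⁅v, w i⁆ =
      Matrix.vecCons x (Function.update w i ⁅v, w i⁆) := fun i => by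
    rw [Matrix.vecCons, Matrix.vecCons, Fin.cons_update]
  have h0 : Function.update (Matrix.vecCons x w) 0 ⁅v, x⁆ = Matrix.vecCons ⁅v, x⁆ w := by
    rw [Matrix.vecCons, Matrix.vecCons, Fin.update_cons_zero]
  simp only [AlternatingMap.curryLeft_apply_apply, lieForm_apply, AlternatingMap.sub_apply,
    Fin.sum_univ_succ, Matrix.cons_val_zero, Matrix.cons_val_succ, this, h0]
  ring

omit [LieRinehartRing R L] in
theorem extDer_zero_apply (η : Form R L 0) (v : Fin 1 → L) : extDer η v = ⁅v 0, η ![]⁆ := rfl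

omit [LieRinehartRing R L] in
theorem extDer_succ_apply {k : ℕ} (η : Form R L (k + 1)) (v : Fin (k + 2) → L) : extDer η v =
    (∑ i : Fin (k + 2), (-1) ^ (i : ℕ) * ⁅v i, η (i.removeNth v)⁆) -
        ∑ i : Fin (k + 1), ∑ j ≥ i, (-1) ^ (i + j : ℕ) *
          η (Matrix.vecCons ⁅v i.castSucc, v j.succ⁆ (j.removeNth (i.castSucc.removeNth v))) := rfl

omit [LieRinehartRing R L] in
theorem extDer_one_apply (η : Form R L 1) (x y : L) :
    extDer η ![x, y] = ⁅x, η ![y]⁆ - ⁅y, η ![x]⁆ - η ![⁅x, y⁆] := by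
  rw [extDer_succ_apply]
  have h0 : Fin.removeNth 0 ![x, y] = ![y] := by ext i; fin_cases i; rfl
  have h1 : Fin.removeNth 1 ![x, y] = ![x] := by ext i; fin_cases i; rfl
  have h2 : ∀ z : L, (Matrix.vecCons z (Fin.removeNth 0 ![y])) = ![z] := by
    intro z; ext i; fin_cases i; rfl
  simp [Fin.sum_univ_succ, h0, h1, ← sub_eq_add_neg]

theorem vecCons_removeNth_eq {k : ℕ} (η : Form R L (k + 1)) (w : Fin (k + 1) → L) (j : Fin (k + 1))
    (a : L) : (-1) ^ (j : ℕ) * η (Matrix.vecCons a (j.removeNth w)) =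
      η (Function.update w j a) := by
  have := η.neg_one_pow_smul_map_insertNth j a (j.removeNth w)
  rw [← this]
  simp [← mul_assoc, ← mul_pow]

/-- Cartan's formula ι_x d = L_x - d ι_x. The terms of dη in which x differentiates or enters a
bracket make up L_x η; in the others x is a passive argument, and they make up -d(ι_x η). -/
theorem extDer_vecCons {k : ℕ} (η : Form R L (k + 1)) (x : L) (w : Fin (k + 1) → L) :
    extDer η (Matrix.vecCons x w) = lieForm x η w - extDer (η.curryLeft x) w := by
  cases k with
  | zero =>
    obtain ⟨y, rfl⟩ : ∃ y, w = ![y] := ⟨w 0, by ext i; fin_cases i; rfl⟩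
    rw [extDer_one_apply, extDer_zero_apply, lieForm_apply]
    have : Function.update ![y] 0 ⁅x, y⁆ = ![⁅x, y⁆] := by ext i; fin_cases i; rfl
    simp [this]
    ring
  | succ k =>
    rw [extDer_succ_apply, extDer_succ_apply, lieForm_apply]
    rw [Fin.sum_univ_succ,
      Fin.sum_univ_succ (n := k + 1) (f := fun i => ∑ j ≥ i, _ * η _)]
    have hr : ∀ i : Fin (k + 2), i.succ.removeNth (Matrix.vecCons x w) =
        Matrix.vecCons x (i.removeNth w) := fun i => by
      ext j; refine Fin.cases ?_ (fun j => ?_) j <;> simp [Fin.removeNth, Matrix.vecCons]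
    have hr' : ∀ (i : Fin (k + 1)) (u : Fin (k + 1) → L), i.succ.removeNth (Matrix.vecCons x u) =
        Matrix.vecCons x (i.removeNth u) := fun i u => by
      ext j; refine Fin.cases ?_ (fun j => ?_) j <;> simp [Fin.removeNth, Matrix.vecCons]
    have hr0 : Fin.removeNth 0 (Matrix.vecCons x w) = w := by
      ext j; simp [Fin.removeNth, Matrix.vecCons]
    have hsw : ∀ (a b : L) (u : Fin k → L), η (Matrix.vecCons a (Matrix.vecCons b u)) =
        - η (Matrix.vecCons b (Matrix.vecCons a u)) := fun a b u => by
      have := η.map_swap (Matrix.vecCons b (Matrix.vecCons a u)) (i := 0) (j := 1) (by simp)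
      rw [← this]
      congr 1
      ext j
      refine Fin.cases ?_ (fun j => ?_) j
      · simp
      · refine Fin.cases ?_ (fun j => ?_) j
        · simp
        · rw [Function.comp_apply, Equiv.swap_apply_of_ne_of_ne] <;> simp [Fin.ext_iff]
    have e1 : ∑ i : Fin (k + 2), (-1 : R) ^ ((i.succ : Fin (k + 3)) : ℕ) *
        ⁅Matrix.vecCons x w i.succ, η (i.succ.removeNth (Matrix.vecCons x w))⁆ =
        - ∑ i : Fin (k + 2), (-1 : R) ^ (i : ℕ) * ⁅w i, (η.curryLeft x) (i.removeNth w)⁆ := by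
      rw [← Finset.sum_neg_distrib]
      refine Finset.sum_congr rfl fun i _ => ?_
      rw [hr, AlternatingMap.curryLeft_apply_apply, Fin.val_succ, Matrix.cons_val_succ, pow_succ]
      ring
    have e2 : ∑ j ≥ (0 : Fin (k + 2)), (-1 : R) ^ (((0 : Fin (k + 2)) : ℕ) + (j : ℕ)) *
        η (Matrix.vecCons ⁅Matrix.vecCons x w (Fin.castSucc 0), Matrix.vecCons x w j.succ⁆
          (j.removeNth ((Fin.castSucc (0 : Fin (k + 2))).removeNth (Matrix.vecCons x w)))) =
        ∑ i, η (Function.update w i ⁅x, w i⁆) := by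
      have : (Finset.univ.filter fun j : Fin (k + 2) => j ≥ 0) = Finset.univ := by
        ext; simp
      rw [show Finset.Ici (0 : Fin (k + 2)) = Finset.univ by ext; simp]
      refine Finset.sum_congr rfl fun j _ => ?_
      rw [Fin.castSucc_zero, hr0, Matrix.cons_val_zero, Matrix.cons_val_succ,
        ← vecCons_removeNth_eq]
      simp
    -- Here both bracketed arguments come after x. The two index shifts cancel in the sign, and
    -- exchanging x with the bracket at the front of η gives the minus sign.
    have e3 : ∑ i : Fin (k + 1), ∑ j ≥ i.succ,
          (-1 : R) ^ (((i.succ : Fin (k + 2)) : ℕ) + (j : ℕ)) *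
        η (Matrix.vecCons ⁅Matrix.vecCons x w i.succ.castSucc, Matrix.vecCons x w j.succ⁆
          (j.removeNth (i.succ.castSucc.removeNth (Matrix.vecCons x w)))) =
        - ∑ i : Fin (k + 1), ∑ j ≥ i, (-1 : R) ^ (i + j : ℕ) * (η.curryLeft x)
          (Matrix.vecCons ⁅w i.castSucc, w j.succ⁆ (j.removeNth (i.castSucc.removeNth w))) := by
      rw [← Finset.sum_neg_distrib]
      refine Finset.sum_congr rfl fun i _ => ?_
      rw [← Finset.sum_neg_distrib, ← Fin.map_succEmb_Ici, Finset.sum_map]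
      refine Finset.sum_congr rfl fun j _ => ?_
      rw [Fin.castSucc_succ, hr, Fin.coe_succEmb, hr', AlternatingMap.curryLeft_apply_apply, hsw,
        Matrix.cons_val_succ, Matrix.cons_val_succ, Fin.val_succ, Fin.val_succ]
      ring
    rw [e1, e2, e3, hr0]
    simp only [Fin.val_zero, pow_zero, one_mul, Matrix.cons_val_zero]
    ring

end Cartan

/-! ### The differential is a graded derivation; closed forms -/

section Leibniz

variable {R L : Type*} [CommRing R] [LieRing L] [Module R L] [LieRingModule L R]
  [LieRinehartRing R L] [Algebra ℝ R]

theorem curryLeft_zsmul_apply {M : Type*} [AddCommGroup M] [Module R M] {k : ℕ} (c : ℤ)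
    (a : M [⋀^Fin (k + 1)]→ₗ[R] R) (x : M) : (c • a).curryLeft x = c • a.curryLeft x := rfl

/-- Induction on the total degree: forms are compared after contraction, and contraction commutes
with both sides up to the same bracket terms. -/
theorem lieForm_wedgeLin (v : L) {m : ℕ} : ∀ {k l : ℕ} (h : k + l = m) (a : Form R L k)
    (b : Form R L l), lieForm v (wedgeLin h a b) =
      wedgeLin h (lieForm v a) b + wedgeLin h a (lieForm v b) := by
  induction m with
  | zero =>
    intro k l h a b
    obtain rfl : k = 0 := by omega
    obtain rfl : l = 0 := by omega
    refine form_ext_zero ?_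
    rw [lieForm_zero_apply, AlternatingMap.add_apply, wedgeLin_zero_zero, wedgeLin_zero_zero,
      wedgeLin_zero_zero, lieForm_zero_apply, lieForm_zero_apply,
      LieRinehartRing.leibniz_mul_right, smul_eq_mul]
    ring
  | succ m ih =>
    intro k l h a b
    refine form_ext fun x => ?_
    rw [curryLeft_lieForm, AlternatingMap.curryLeft_add, LinearMap.add_apply]
    match k, l with
    | 0, 0 => omega
    | 0, l + 1 =>
      have h2 : 0 + l = m := by omega
      simp only [curryLeft_wedgeLin_right h h2, ih, curryLeft_lieForm, map_sub]
      abel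
    | k + 1, 0 =>
      have h1 : k + 0 = m := by omega
      simp only [curryLeft_wedgeLin_left h h1, ih, curryLeft_lieForm, map_sub, LinearMap.sub_apply]
      abel
    | k + 1, l + 1 =>
      have h1 : k + (l + 1) = m := by omega
      have h2 : k + 1 + l = m := by omega
      simp only [curryLeft_wedgeLin h h1 h2, ih, curryLeft_lieForm, map_sub, LinearMap.sub_apply,
        lieForm_add, lieForm_zsmul]
      module

/-- The form `ζ` is the differential of `η`. -/
def IsExtDer {k : ℕ} (η : Form R L k) (ζ : Form R L (k + 1)) : Prop := ∀ v, extDer η v = ζ v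

/-- Cartan's formula as a recursion on the degree. As `extDer` yields a mere function of the
arguments, the relation with an alternating form ζ is used, so that ζ can itself be contracted. -/
theorem isExtDer_succ_iff {k : ℕ} {η : Form R L (k + 1)} {ζ : Form R L (k + 2)} :
    IsExtDer η ζ ↔ ∀ x, IsExtDer (η.curryLeft x) (lieForm x η - ζ.curryLeft x) := by
  constructor
  · intro h x w
    have := h (Matrix.vecCons x w)
    rw [extDer_vecCons] at this
    rw [AlternatingMap.sub_apply, AlternatingMap.curryLeft_apply_apply, ← this]
    ring
  · intro h v
    obtain ⟨x, w, rfl⟩ : ∃ x w, v = Matrix.vecCons x w :=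
      ⟨_, _, (Matrix.cons_head_tail v).symm⟩
    rw [extDer_vecCons, h x w, AlternatingMap.sub_apply, AlternatingMap.curryLeft_apply_apply]
    ring

theorem IsExtDer.curryLeft_eq {η : Form R L 0} {ζ : Form R L 1} (h : IsExtDer η ζ) (x : L) :
    ζ.curryLeft x = lieForm x η := by
  refine form_ext_zero ?_
  rw [lieForm_zero_apply, AlternatingMap.curryLeft_apply_apply, ← h ![x], extDer_zero_apply]
  rfl

theorem IsExtDer.add {k : ℕ} : ∀ {η η' : Form R L k} {ζ ζ' : Form R L (k + 1)},
    IsExtDer η ζ → IsExtDer η' ζ' → IsExtDer (η + η') (ζ + ζ') := by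
  intro η η' ζ ζ' h h' v
  rw [AlternatingMap.add_apply, ← h, ← h']
  cases k with
  | zero => simp [extDer_zero_apply]
  | succ k =>
    simp only [extDer_succ_apply, AlternatingMap.add_apply, lie_add, mul_add,
      Finset.sum_add_distrib]
    ring

theorem IsExtDer.zsmul {k : ℕ} {η : Form R L k} {ζ : Form R L (k + 1)} (c : ℤ)
    (h : IsExtDer η ζ) : IsExtDer (c • η) (c • ζ) := by
  intro v
  rw [AlternatingMap.smul_apply, ← h]
  cases k with
  | zero => rw [extDer_zero_apply, extDer_zero_apply, AlternatingMap.smul_apply, lie_zsmul]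
  | succ k =>
    simp only [extDer_succ_apply, AlternatingMap.smul_apply, lie_zsmul, mul_smul_comm,
      ← Finset.smul_sum, ← smul_sub]

/-- The graded Leibniz rule, by induction on the total degree: contracting with x reduces it,
through Cartan's formula, to products of smaller degree and to the Leibniz rule for L_x. Degree zero
factors are separate cases because they cannot be contracted. -/
theorem IsExtDer.wedgeLin {m : ℕ} : ∀ {k l : ℕ} (h : k + l = m) (h1 : k + 1 + l = m + 1)
    (h2 : k + (l + 1) = m + 1) {a : Form R L k} {a' : Form R L (k + 1)} {b : Form R L l}
    {b' : Form R L (l + 1)}, IsExtDer a a' → IsExtDer b b' →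
      IsExtDer (wedgeLin h a b) (wedgeLin h1 a' b + (-1 : ℤ) ^ k • wedgeLin h2 a b') := by
  induction m with
  | zero =>
    intro k l h h1 h2 a a' b b' ha hb v
    obtain rfl : k = 0 := by omega
    obtain rfl : l = 0 := by omega
    obtain ⟨x, rfl⟩ : ∃ x, v = Matrix.vecCons x ![] := ⟨v 0, by ext i; fin_cases i; rfl⟩
    rw [← AlternatingMap.curryLeft_apply_apply, AlternatingMap.curryLeft_add,
      LinearMap.add_apply, curryLeft_zsmul_apply,
      curryLeft_wedgeLin_left h1 rfl, curryLeft_wedgeLin_right h2 rfl, ha.curryLeft_eq,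
      hb.curryLeft_eq, extDer_zero_apply, AlternatingMap.add_apply, AlternatingMap.smul_apply,
      wedgeLin_zero_zero, wedgeLin_zero_zero, wedgeLin_zero_zero, lieForm_zero_apply,
      lieForm_zero_apply, LieRinehartRing.leibniz_mul_right, Matrix.cons_val_zero, smul_eq_mul]
    simp
    ring
  | succ m ih =>
    intro k l h h1 h2 a a' b b' ha hb
    rw [isExtDer_succ_iff]
    intro x
    rw [AlternatingMap.curryLeft_add, LinearMap.add_apply, curryLeft_zsmul_apply,
      lieForm_wedgeLin]
    match k, l with
    | 0, 0 => omega
    | 0, l + 1 =>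
      have e := ih (k := 0) (l := l) (by omega) (by omega) (by omega) ha (isExtDer_succ_iff.1 hb x)
      rw [curryLeft_wedgeLin_right h (by omega)]
      convert e using 1
      rw [curryLeft_wedgeLin h1 (by omega) (by omega), curryLeft_wedgeLin_right h2 (by omega),
        ha.curryLeft_eq]
      simp only [map_sub]
      module
    | k + 1, 0 =>
      have e := ih (k := k) (l := 0) (by omega) (by omega) (by omega) (isExtDer_succ_iff.1 ha x) hb
      rw [curryLeft_wedgeLin_left h (by omega)]
      convert e using 1
      rw [curryLeft_wedgeLin_left h1 (by omega), curryLeft_wedgeLin h2 (by omega) (by omega),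
        hb.curryLeft_eq]
      simp only [map_sub, LinearMap.sub_apply]
      rcases neg_one_pow_eq_or ℤ k with hk | hk <;> rw [pow_succ, hk] <;> module
    | k + 1, l + 1 =>
      have e1 := ih (k := k) (l := l + 1) (by omega) (by omega) (by omega)
        (isExtDer_succ_iff.1 ha x) hb
      have e2 := ih (k := k + 1) (l := l) (by omega) (by omega) (by omega) ha
        (isExtDer_succ_iff.1 hb x)
      rw [curryLeft_wedgeLin h (by omega) (by omega)]
      convert e1.add (e2.zsmul ((-1) ^ (k + 1))) using 1
      rw [curryLeft_wedgeLin h1 (by omega) (by omega), curryLeft_wedgeLin h2 (by omega) (by omega)]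
      simp only [map_sub, LinearMap.sub_apply]
      rcases neg_one_pow_eq_or ℤ k with hk | hk <;> rw [pow_succ, pow_succ, hk] <;> module

theorem formClosed_iff {k : ℕ} {η : Form R L k} : FormClosed η ↔ IsExtDer η 0 := Iff.rfl

theorem FormClosed.wedge {k l : ℕ} {a : Form R L k} {b : Form R L l} (ha : FormClosed a)
    (hb : FormClosed b) : FormClosed (wedge a b) := by
  have := IsExtDer.wedgeLin (rfl : k + l = k + l) (by omega) (by omega)
    (formClosed_iff.1 ha) (formClosed_iff.1 hb)
  rw [wedgeLin_rfl] at this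
  intro v
  rw [this v]
  simp

theorem FormClosed.wedgePow {b : Form R L 2} (hb : FormClosed b) (j : ℕ) :
    FormClosed (wedgePow b j) := by
  induction j with
  | zero =>
    intro v
    change ⁅v 0, (1 : R)⁆ = 0
    have := LieRinehartRing.leibniz_mul_right (v 0) (1 : R) 1
    simpa using this
  | succ j ih => exact ih.wedge hb

theorem FormClosed.of_nsmul {k : ℕ} {η : Form R L k} {n : ℕ} (hn : n ≠ 0)
    (h : FormClosed (n • η)) : FormClosed η := by
  intro v
  refine nsmul_cancel hn ?_
  rw [smul_zero, ← h v]
  cases k with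
  | zero => rw [extDer_zero_apply, extDer_zero_apply, AlternatingMap.smul_apply, lie_nsmul]
  | succ k =>
    simp only [extDer_succ_apply, AlternatingMap.smul_apply, lie_nsmul, mul_smul_comm,
      ← Finset.smul_sum, ← smul_sub]

theorem FormClosed.domDomCongr {k l : ℕ} {η : Form R L k} (h : FormClosed η) (e : k = l) :
    FormClosed (η.domDomCongr (finCongr e)) := by
  subst e
  exact h

theorem formClosed_zero {k : ℕ} : FormClosed (0 : Form R L k) := by
  intro v
  cases k with
  | zero => simp [extDer_zero_apply]
  | succ k => simp [extDer_succ_apply]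

theorem FormClosed.expForm {b : Form R L 2} (hb : FormClosed b) (k : ℕ) :
    FormClosed (expForm b k) := by
  unfold LogPoisson.expForm
  split
  · refine FormClosed.of_nsmul (n := (k / 2)!) (by positivity) ?_
    rw [← Nat.cast_smul_eq_nsmul ℝ, smul_inv_smul₀ (by positivity)]
    exact (hb.wedgePow _).domDomCongr _
  · exact formClosed_zero

theorem FormClosed.spinor {a : Form R L 1} {b : Form R L 2} (ha : FormClosed a)
    (hb : FormClosed b) (k : ℕ) : FormClosed (spinor a b k) := by
  cases k with
  | zero => exact formClosed_zero
  | succ k => exact (hb.expForm k).wedge ha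

end Leibniz

/-! ### Powers of a two-form and their contraction -/

section WedgePow

variable {R M : Type*} [CommRing R] [AddCommGroup M] [Module R M] [Algebra ℝ R]

theorem wedgeLin_zero_right {k : ℕ} (c : M [⋀^Fin k]→ₗ[R] R) (f : M [⋀^Fin 0]→ₗ[R] R) :
    wedgeLin (Nat.add_zero k) c f = f ![] • c := by
  induction k with
  | zero => exact form_ext_zero (by rw [wedgeLin_zero_zero]; simp [mul_comm])
  | succ k ih =>
    refine form_ext fun x => ?_
    rw [curryLeft_wedgeLin_left _ (Nat.add_zero k), ih, AlternatingMap.curryLeft_smul,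
      LinearMap.smul_apply]

theorem wedgeLin_zero_left {k : ℕ} (f : M [⋀^Fin 0]→ₗ[R] R) (c : M [⋀^Fin k]→ₗ[R] R) :
    wedgeLin (Nat.zero_add k) f c = f ![] • c := by
  induction k with
  | zero => exact form_ext_zero (by rw [wedgeLin_zero_zero]; simp)
  | succ k ih =>
    refine form_ext fun x => ?_
    rw [curryLeft_wedgeLin_right _ (Nat.zero_add k), ih, AlternatingMap.curryLeft_smul,
      LinearMap.smul_apply]

theorem curryLeft_wedgeLin_one_zero (c : M [⋀^Fin 0]→ₗ[R] R) (ξ : M [⋀^Fin 1]→ₗ[R] R)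
    (h : 0 + 1 = 0 + 1) (x : M) : (wedgeLin h c ξ).curryLeft x = ξ ![x] • c := by
  rw [curryLeft_wedgeLin_right h (Nat.add_zero 0), wedgeLin_zero_right]
  rfl

theorem curryLeft_wedgeLin_one {k : ℕ} (c : M [⋀^Fin (k + 1)]→ₗ[R] R) (ξ : M [⋀^Fin 1]→ₗ[R] R)
    (h : k + 1 + 1 = k + 1 + 1) (x : M) : (wedgeLin h c ξ).curryLeft x =
      wedgeLin (rfl : k + 1 = k + 1) (c.curryLeft x) ξ + (-1 : ℤ) ^ (k + 1) • ξ ![x] • c := by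
  rw [curryLeft_wedgeLin h rfl (Nat.add_zero (k + 1)), wedgeLin_zero_right]
  rfl

/-- Anticommutation of one-forms, proved behind an arbitrary factor c so that the induction on the
degree of c closes under contraction. -/
theorem wedge_one_one_comm {k : ℕ} (c : M [⋀^Fin k]→ₗ[R] R) (ξ ζ : M [⋀^Fin 1]→ₗ[R] R)
    (h : k + 1 = k + 1) (h' : k + 1 + 1 = k + 1 + 1) :
    wedgeLin h' (wedgeLin h c ξ) ζ = - wedgeLin h' (wedgeLin h c ζ) ξ := by
  induction k with
  | zero =>
    refine form_ext fun x => ?_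
    rw [← neg_one_smul ℤ, curryLeft_zsmul_apply, curryLeft_wedgeLin_one, curryLeft_wedgeLin_one,
      curryLeft_wedgeLin_one_zero, curryLeft_wedgeLin_one_zero]
    simp only [map_smul, LinearMap.smul_apply]
    module
  | succ k ih =>
    refine form_ext fun x => ?_
    rw [← neg_one_smul ℤ, curryLeft_zsmul_apply, curryLeft_wedgeLin_one, curryLeft_wedgeLin_one,
      curryLeft_wedgeLin_one, curryLeft_wedgeLin_one]
    simp only [map_smul, map_add, map_zsmul, LinearMap.smul_apply, LinearMap.add_apply]
    rw [ih (c.curryLeft x)]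
    rw [pow_succ]
    module

theorem wedge_one_two_comm {k : ℕ} (c : M [⋀^Fin k]→ₗ[R] R) (ξ : M [⋀^Fin 1]→ₗ[R] R)
    (b : M [⋀^Fin 2]→ₗ[R] R) (h : k + 1 + 2 = k + 1 + 1 + 1) (h' : k + 2 = k + 1 + 1) :
    wedgeLin h (wedgeLin (rfl : k + 1 = k + 1) c ξ) b =
      wedgeLin (rfl : k + 1 + 1 + 1 = k + 1 + 1 + 1) (wedgeLin h' c b) ξ := by
  induction k with
  | zero =>
    refine form_ext fun x => ?_
    rw [curryLeft_wedgeLin h (rfl : 0 + (1 + 1) = 0 + 1 + 1) rfl, curryLeft_wedgeLin_one,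
      curryLeft_wedgeLin_right h' rfl, curryLeft_wedgeLin_one_zero, wedge_one_one_comm]
    simp only [map_smul, LinearMap.smul_apply]
    module
  | succ k ih =>
    refine form_ext fun x => ?_
    rw [curryLeft_wedgeLin h (by omega) rfl, curryLeft_wedgeLin_one, curryLeft_wedgeLin_one,
      curryLeft_wedgeLin h' (by omega) rfl, wedge_one_one_comm]
    simp only [map_smul, map_add, map_zsmul, LinearMap.smul_apply, LinearMap.add_apply]
    rw [ih (c.curryLeft x) _ (by omega)]
    rw [pow_succ, pow_succ]
    module

theorem curryLeft_wedgePow_succ (b : M [⋀^Fin 2]→ₗ[R] R) (x : M) (j : ℕ) :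
    (wedgePow b (j + 1)).curryLeft x = (j + 1) • wedge (wedgePow b j) (b.curryLeft x) := by
  induction j with
  | zero =>
    have e := curryLeft_wedgeLin_right (l := 1) (m := 1) rfl rfl (wedgePow b 0) b x
    rw [wedgeLin_rfl] at e
    refine e.trans ?_
    rw [← wedgeLin_rfl]
    simp
  | succ j ih =>
    have e := curryLeft_wedgeLin (k := 2 * j + 1) (l := 1) (m := 2 * (j + 1) + 1) rfl (by omega) rfl
      (wedgePow b (j + 1)) b x
    have e2 := wedge_one_two_comm (wedgePow b j) (b.curryLeft x) b (by omega) rfl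
    refine (congrArg (fun f => f.curryLeft x) (wedgeLin_rfl (wedgePow b (j + 1)) b)).symm.trans ?_
    refine e.trans ?_
    have ih' : (wedgePow b (j + 1)).curryLeft x =
      (j + 1) • wedgeLin rfl (wedgePow b j) (b.curryLeft x) := by rw [ih, wedgeLin_rfl]
    have e3 : wedgeLin (rfl : 2 * j + 1 + 1 + 1 = 2 * j + 1 + 1 + 1)
        (wedgeLin (rfl : 2 * j + 2 = 2 * j + 1 + 1) (wedgePow b j) b) (b.curryLeft x) =
        wedge (wedgePow b (j + 1)) (b.curryLeft x) := by
      rw [wedgeLin_rfl]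
      exact congrArg (fun f => wedge f (b.curryLeft x)) (wedgeLin_rfl (wedgePow b j) b)
    have e4 : (-1 : ℤ) ^ (2 * j + 1 + 1) = 1 := by
      rw [Even.neg_one_pow]; exact ⟨j + 1, by ring⟩
    have e5 : wedgeLin (rfl : 2 * j + 1 + 1 + 1 = 2 * (j + 1) + 1) (wedgePow b (j + 1))
        (b.curryLeft x) = wedge (wedgePow b (j + 1)) (b.curryLeft x) := wedgeLin_rfl _ _
    rw [e4, one_smul, e5, ih', map_nsmul, LinearMap.smul_apply]
    have e6 := e2.trans e3
    refine (congrArg (fun f => (j + 1) • f + wedge (wedgePow b (j + 1)) (b.curryLeft x)) e6).trans ?_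
    exact (succ_nsmul _ (j + 1)).symm

end WedgePow

/-! ### The exponential of a two-form -/

section Exponential

variable {R M : Type*} [CommRing R] [AddCommGroup M] [Module R M] [Algebra ℝ R]

theorem expForm_eq {k j : ℕ} (h : 2 * j = k) (b : M [⋀^Fin 2]→ₗ[R] R) :
    expForm b k = ((j ! : ℝ)⁻¹) • (wedgePow b j).domDomCongr (finCongr h) := by
  have hk : Even k := ⟨j, by omega⟩
  have hj : k / 2 = j := by omega
  unfold expForm
  rw [dif_pos hk]
  subst hj
  rfl

theorem expForm_two_mul (j : ℕ) (b : M [⋀^Fin 2]→ₗ[R] R) :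
    expForm b (2 * j) = ((j ! : ℝ)⁻¹) • wedgePow b j := expForm_eq rfl b

theorem expForm_odd {k : ℕ} (h : ¬ Even k) (b : M [⋀^Fin 2]→ₗ[R] R) : expForm b k = 0 :=
  dif_neg h

theorem wedge_real_smul_left {k l : ℕ} (c : ℝ) (a : M [⋀^Fin k]→ₗ[R] R)
    (b : M [⋀^Fin l]→ₗ[R] R) : wedge (c • a) b = c • wedge a b := by
  have h : ∀ {j : ℕ} (d : M [⋀^Fin j]→ₗ[R] R), c • d = algebraMap ℝ R c • d := fun d => by
    ext v; simp [Algebra.smul_def]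
  rw [h, h, wedge_smul_left]

/-- The identity ι_x e^b = e^b ∧ ι_x b: the factor j + 1 from differentiating b^(j+1) turns 1/(j+1)!
into 1/j!. For x = e it makes the residue of e^ω a spinor. -/
theorem curryLeft_expForm (b : M [⋀^Fin 2]→ₗ[R] R) (x : M) (k : ℕ) :
    (expForm b (k + 2)).curryLeft x = wedge (expForm b k) (b.curryLeft x) := by
  by_cases hk : Even k
  · obtain ⟨j, rfl⟩ := hk
    obtain ⟨i, hi⟩ : ∃ i, j + j = i := ⟨_, rfl⟩
    rw [hi]
    obtain rfl : 2 * j = i := by omega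
    have h1 : expForm b (2 * j + 2) = (((j + 1)! : ℝ)⁻¹) • wedgePow b (j + 1) :=
      expForm_two_mul (j + 1) b
    rw [h1, expForm_two_mul, wedge_real_smul_left]
    have h2 : ((((j + 1)! : ℝ)⁻¹) • wedgePow b (j + 1)).curryLeft x =
        (((j + 1)! : ℝ)⁻¹) • (wedgePow b (j + 1)).curryLeft x := rfl
    refine h2.trans ?_
    rw [curryLeft_wedgePow_succ, ← Nat.cast_smul_eq_nsmul ℝ, smul_smul]
    congr 1
    rw [Nat.factorial_succ]
    push_cast
    field_simp
  · have hk2 : ¬ Even (k + 2) := by rwa [Nat.even_add, iff_true_right even_two]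
    rw [expForm_odd hk, expForm_odd hk2, ← zero_smul R (0 : M [⋀^Fin k]→ₗ[R] R), wedge_smul_left,
      zero_smul]
    rfl

end Exponential

/-! ### Comparing forms over different algebras at a point -/

section Naturality

variable {R M S N : Type*} [CommRing R] [AddCommGroup M] [Module R M] [Algebra ℝ R]
  [CommRing S] [AddCommGroup N] [Module S N] [Algebra ℝ S]

/-- The forms `a` and `a'` take the same values, after evaluating functions by `p` and `q`, on the
tuples formed from the families `W` and `V`. -/
def AgreeOn (p : R →ₐ[ℝ] ℝ) (q : S →ₐ[ℝ] ℝ) {J : Type*} (W : J → M) (V : J → N) {k : ℕ}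
    (a : M [⋀^Fin k]→ₗ[R] R) (a' : N [⋀^Fin k]→ₗ[S] S) : Prop :=
  ∀ s : Fin k → J, p (a (W ∘ s)) = q (a' (V ∘ s))

variable {p : R →ₐ[ℝ] ℝ} {q : S →ₐ[ℝ] ℝ} {J : Type*} {W : J → M} {V : J → N}

/-- A product at a point is a polynomial in values of its factors on subfamilies of the arguments,
so agreement on all subfamilies passes to products, even between forms over X and forms over Z. -/
theorem AgreeOn.wedge {k l : ℕ} {a : M [⋀^Fin k]→ₗ[R] R} {a' : N [⋀^Fin k]→ₗ[S] S}
    {b : M [⋀^Fin l]→ₗ[R] R} {b' : N [⋀^Fin l]→ₗ[S] S} (ha : AgreeOn p q W V a a')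
    (hb : AgreeOn p q W V b b') : AgreeOn p q W V (wedge a b) (wedge a' b') := by
  intro s
  refine nsmul_cancel (R := ℝ) (n := k ! * l !) (by positivity) ?_
  rw [← wedgeLin_rfl, ← wedgeLin_rfl, ← map_nsmul p, ← map_nsmul q, factorial_smul_wedgeLin,
    factorial_smul_wedgeLin, map_sum, map_sum]
  refine Finset.sum_congr rfl fun σ _ => ?_
  rw [map_zsmul, map_zsmul, map_mul, map_mul]
  have h1 := ha (fun i => s (σ (Fin.cast rfl (Fin.castAdd l i))))
  have h2 := hb (fun i => s (σ (Fin.cast rfl (Fin.natAdd k i))))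
  simp only [Function.comp_def] at h1 h2 ⊢
  rw [h1, h2]

theorem AgreeOn.wedgePow {b : M [⋀^Fin 2]→ₗ[R] R} {b' : N [⋀^Fin 2]→ₗ[S] S}
    (hb : AgreeOn p q W V b b') (j : ℕ) :
    AgreeOn p q W V (wedgePow b j) (wedgePow b' j) := by
  induction j with
  | zero => intro s; exact (map_one p).trans (map_one q).symm
  | succ j ih => exact ih.wedge hb

theorem AgreeOn.expForm {b : M [⋀^Fin 2]→ₗ[R] R} {b' : N [⋀^Fin 2]→ₗ[S] S}
    (hb : AgreeOn p q W V b b') (k : ℕ) :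
    AgreeOn p q W V (expForm b k) (expForm b' k) := by
  intro s
  by_cases hk : Even k
  · obtain ⟨j, hj⟩ := hk
    have h : 2 * j = k := by omega
    subst h
    rw [expForm_two_mul, expForm_two_mul, AlternatingMap.smul_apply, AlternatingMap.smul_apply,
      map_smul, map_smul, hb.wedgePow j s]
  · simp [expForm_odd hk]

theorem wedge_one_eq_zero {k : ℕ} (c : M [⋀^Fin k]→ₗ[R] R) (ξ : M [⋀^Fin 1]→ₗ[R] R)
    (u : Fin (k + 1) → M) (hu : ∀ i, ξ ![u i] = 0) : wedge c ξ u = 0 := by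
  refine nsmul_cancel (R := R) (n := k ! * 1 !) (by positivity) ?_
  rw [← wedgeLin_rfl, factorial_smul_wedgeLin, smul_zero]
  refine Finset.sum_eq_zero fun σ _ => ?_
  have : (fun j : Fin 1 => u (σ (Fin.cast rfl (Fin.natAdd k j)))) =
      ![u (σ (Fin.cast rfl (Fin.natAdd k 0)))] := by
    ext j; fin_cases j; rfl
  rw [this, hu, mul_zero, smul_zero]

/-- Only the terms that feed u₀ to ξ survive; u₀ then passes the k arguments of c. -/
theorem wedge_one_vecCons {k : ℕ} (c : M [⋀^Fin k]→ₗ[R] R) (ξ : M [⋀^Fin 1]→ₗ[R] R)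
    (u₀ : M) (u : Fin k → M) (hu : ∀ i, ξ ![u i] = 0) :
    wedge c ξ (Matrix.vecCons u₀ u) = (-1 : ℤ) ^ k • (ξ ![u₀] * c u) := by
  cases k with
  | zero =>
    rw [← AlternatingMap.curryLeft_apply_apply, ← wedgeLin_rfl, curryLeft_wedgeLin_one_zero]
    simp
  | succ k =>
    rw [← AlternatingMap.curryLeft_apply_apply, ← wedgeLin_rfl, curryLeft_wedgeLin_one,
      AlternatingMap.add_apply, wedgeLin_rfl, wedge_one_eq_zero _ _ _ hu, zero_add]
    rfl

end Naturality

/-! ### Nondegenerate two-forms on a vector space -/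

section LinearAlgebra

variable {V : Type*} [AddCommGroup V] [Module ℝ V] [FiniteDimensional ℝ V]

theorem exists_curryLeft_eq (b : V [⋀^Fin 2]→ₗ[ℝ] ℝ) (hb : ∀ v, (∀ w, b ![v, w] = 0) → v = 0)
    (f : Module.Dual ℝ V) : ∃ v, ∀ w, b ![v, w] = f w := by
  let T : V →ₗ[ℝ] Module.Dual ℝ V :=
    { toFun := fun v =>
        { toFun := fun w => b ![v, w]
          map_add' := fun w w' => (b.curryLeft v).map_vecCons_add ![] w w'
          map_smul' := fun c w => (b.curryLeft v).map_vecCons_smul ![] c w }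
      map_add' := fun v v' => by
        ext w; exact b.map_vecCons_add ![w] v v'
      map_smul' := fun c v => by
        ext w; exact b.map_vecCons_smul ![w] c v }
  have hT : Function.Injective T := by
    rw [← LinearMap.ker_eq_bot, LinearMap.ker_eq_bot']
    intro v hv
    exact hb v fun w => LinearMap.congr_fun hv w
  have hs : Function.Surjective T :=
    (LinearMap.injective_iff_surjective_of_finrank_eq_finrank
      (Subspace.dual_finrank_eq).symm).1 hT
  obtain ⟨v, hv⟩ := hs f
  exact ⟨v, fun w => LinearMap.congr_fun hv w⟩

/-- Induction without a symplectic basis. If b^r is nonzero on u, the 2r vectors u span a proper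
subspace, so some nonzero functional f kills them; nondegeneracy gives f = ι_v b. Then ι_v b^(r+1) =
(r+1) b^r ∧ f is nonzero on (u₀, u) whenever f(u₀) ≠ 0. -/
theorem wedgePow_ne_zero (b : V [⋀^Fin 2]→ₗ[ℝ] ℝ) (hb : ∀ v, (∀ w, b ![v, w] = 0) → v = 0)
    (r : ℕ) (hr : 2 * r ≤ Module.finrank ℝ V) : wedgePow b r ≠ 0 := by
  induction r with
  | zero =>
    intro h
    have := congrArg (fun f => f ![]) h
    exact one_ne_zero this
  | succ r ih =>
    intro h
    have ih := ih (by omega)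
    obtain ⟨u, hu⟩ : ∃ u, wedgePow b r u ≠ 0 := by
      by_contra! hc
      exact ih (AlternatingMap.ext hc)
    have hlt : Submodule.span ℝ (Set.range u) < ⊤ := by
      refine Submodule.lt_top_of_finrank_lt_finrank ?_
      have := finrank_range_le_card (R := ℝ) u
      rw [Fintype.card_fin, Set.finrank] at this
      omega
    obtain ⟨f, hf0, hf⟩ := Submodule.exists_le_ker_of_lt_top _ hlt
    obtain ⟨v, hv⟩ := exists_curryLeft_eq b hb f
    obtain ⟨u₀, hu₀⟩ : ∃ u₀, f u₀ ≠ 0 := by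
      by_contra! hc
      exact hf0 (LinearMap.ext hc)
    have h1 := curryLeft_wedgePow_succ b v r
    rw [h] at h1
    have h2 : wedge (wedgePow b r) (b.curryLeft v) = 0 := by
      refine AlternatingMap.ext fun w => nsmul_cancel (R := ℝ) (n := r + 1) (by omega) ?_
      have := congrArg (fun g => g w) h1
      simpa using this.symm
    have h3 := wedge_one_vecCons (wedgePow b r) (b.curryLeft v) u₀ u fun i =>
      (hv (u i)).trans (hf (Submodule.subset_span ⟨i, rfl⟩))
    rw [h2] at h3
    have h4 : (b.curryLeft v) ![u₀] = f u₀ := hv u₀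
    rw [h4, AlternatingMap.zero_apply] at h3
    have h5 := mul_ne_zero hu₀ hu
    rcases neg_one_pow_eq_or ℤ (2 * r) with hk | hk <;> rw [hk] at h3
    · exact h5 (by simpa using h3.symm)
    · exact h5 (by simpa using h3.symm)

end LinearAlgebra

/-! ### Hadamard's lemma -/

section Hadamard

open MeasureTheory

/-- The integral is the value at 0 of the convolution of the indicator of (0, 1] with t ↦ χ(t) H(x,
-t), where the bump χ is 1 on [-1, 1]; smooth dependence on parameters of such convolutions applies.
-/
theorem contDiff_parametric_integral {P G : Type*} [NormedAddCommGroup P] [NormedSpace ℝ P]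
    [NormedAddCommGroup G] [NormedSpace ℝ G] (H : P × ℝ → G) (hH : ContDiff ℝ ∞ H) :
    ContDiff ℝ ∞ fun x => ∫ s in (0 : ℝ)..1, H (x, s) := by
  let χ : ContDiffBump (0 : ℝ) := ⟨1, 2, one_pos, one_lt_two⟩
  let ind : ℝ → ℝ := Set.indicator (Set.Ioc 0 1) 1
  let g : P → ℝ → G := fun x t => χ t • H (x, -t)
  have hind : LocallyIntegrable ind volume :=
    (IntegrableOn.integrable_indicator (by simp [Pi.one_def]) measurableSet_Ioc).locallyIntegrable
  have hg : ContDiffOn ℝ ((⊤ : ℕ∞) : ℕ∞ω) (Function.uncurry g) (Set.univ ×ˢ Set.univ) := by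
    refine ContDiff.contDiffOn ?_
    refine (χ.contDiff.comp contDiff_snd).smul (hH.comp (contDiff_fst.prodMk contDiff_snd.neg))
  have := contDiffOn_convolution_right_with_param_comp (n := (⊤ : ℕ∞)) (μ := volume)
    (ContinuousLinearMap.lsmul ℝ ℝ) (s := Set.univ) (v := fun _ : P => (0 : ℝ)) contDiffOn_const
    (f := ind) (g := g) isOpen_univ (isCompact_closedBall (0 : ℝ) 2)
    (fun x t _ ht => by
      have : χ t = 0 := χ.zero_of_le_dist (by
        rw [Metric.mem_closedBall, not_le] at ht; exact ht.le)
      simp [g, this]) hind hg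
  rw [contDiffOn_univ] at this
  convert this using 1
  ext x
  symm
  rw [convolution_def, intervalIntegral.integral_of_le zero_le_one, ← integral_indicator
    measurableSet_Ioc]
  refine integral_congr_ae (Filter.Eventually.of_forall fun t => ?_)
  by_cases ht : t ∈ Set.Ioc (0 : ℝ) 1
  · have h1 : χ (-t) = 1 := χ.one_of_mem_closedBall (by
      rw [Metric.mem_closedBall, dist_zero_right, norm_neg, Real.norm_of_nonneg ht.1.le]
      exact ht.2)
    simp [ind, g, ht, h1]
  · simp [ind, ht]

/-- Integrate the derivative of f along the segment from g(x) to x. A constant g gives first order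
Taylor expansion at a point; a projection g gives division by the equation of a hyperplane. -/
theorem exists_hadamard {E : Type*} [NormedAddCommGroup E] [NormedSpace ℝ E] (f : E → ℝ)
    (hf : ContDiff ℝ ∞ f) (g : E → E) (hg : ContDiff ℝ ∞ g) :
    ∃ G : E → E →L[ℝ] ℝ, ContDiff ℝ ∞ G ∧ (∀ x, f x - f (g x) = G x (x - g x)) ∧
      ∀ x, g x = x → G x = fderiv ℝ f x := by
  refine ⟨fun x => ∫ s in (0 : ℝ)..1, fderiv ℝ f (g x + s • (x - g x)), ?_, fun x => ?_,
    fun x hx => by simp [hx]⟩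
  · refine contDiff_parametric_integral (fun q : E × ℝ => fderiv ℝ f (g q.1 + q.2 • (q.1 - g q.1)))
      ?_
    refine (hf.fderiv_right (m := ∞) (by simp)).comp ?_
    have := hg.comp (contDiff_fst (E := E) (F := ℝ) (𝕜 := ℝ))
    exact this.add (contDiff_snd.smul (contDiff_fst.sub this))
  · have hd : ∀ s : ℝ, HasDerivAt (fun s : ℝ => f (g x + s • (x - g x)))
        (fderiv ℝ f (g x + s • (x - g x)) (x - g x)) s := fun s => by
      have h1 : HasDerivAt (fun s : ℝ => g x + s • (x - g x)) (x - g x) s := by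
        simpa using ((hasDerivAt_id s).smul_const (x - g x)).const_add (g x)
      exact ((hf.differentiable (by simp)).differentiableAt.hasFDerivAt).comp_hasDerivAt s h1
    have hc : Continuous fun s : ℝ => fderiv ℝ f (g x + s • (x - g x)) :=
      (hf.continuous_fderiv (by simp)).comp (by fun_prop)
    have := intervalIntegral.integral_eq_sub_of_hasDerivAt (a := 0) (b := 1)
      (fun s _ => hd s) ((hc.clm_apply continuous_const).intervalIntegrable _ _)
    rw [ContinuousLinearMap.intervalIntegral_apply (hc.intervalIntegrable _ _), this]
    simp

end Hadamard

/-! ### Fibres of a module of sections at a point -/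

section NullAt

variable {R M : Type*} [CommRing R] [AddCommGroup M] [Module R M] [Algebra ℝ R]

/-- The section `D` vanishes at the point of evaluation `p`, as an element of the fibre: every
linear form does. -/
def NullAt (p : R →ₐ[ℝ] ℝ) (D : M) : Prop := ∀ ξ : M →ₗ[R] R, p (ξ D) = 0

variable {p : R →ₐ[ℝ] ℝ}

theorem NullAt.add {D D' : M} (h : NullAt p D) (h' : NullAt p D') : NullAt p (D + D') :=
  fun ξ => by rw [map_add, map_add, h ξ, h' ξ, add_zero]

theorem NullAt.smul {D : M} (h : NullAt p D) (a : R) : NullAt p (a • D) :=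
  fun ξ => by rw [map_smul, smul_eq_mul, map_mul, h ξ, mul_zero]

theorem nullAt_smul_of_eq_zero {a : R} (h : p a = 0) (D : M) : NullAt p (a • D) :=
  fun ξ => by rw [map_smul, smul_eq_mul, map_mul, h, zero_mul]

theorem NullAt.sum {J : Type*} (s : Finset J) {D : J → M} (h : ∀ i ∈ s, NullAt p (D i)) :
    NullAt p (∑ i ∈ s, D i) :=
  fun ξ => by rw [map_sum, map_sum]; exact Finset.sum_eq_zero fun i hi => h i hi ξ

theorem NullAt.of_smul {a : R} {D : M} (ha : p a = 1) (h : NullAt p (a • D)) : NullAt p D :=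
  fun ξ => by
    have := h ξ
    rwa [map_smul, smul_eq_mul, map_mul, ha, one_mul] at this

/-- The value of a form at a point depends on the values of its arguments at this point only. -/
theorem apply_eq_of_nullAt {k : ℕ} (η : M [⋀^Fin k]→ₗ[R] R) {W W' : Fin k → M}
    (h : ∀ i, NullAt p (W i - W' i)) : p (η W) = p (η W') := by
  have key : ∀ s : Finset (Fin k), p (η (s.piecewise W' W)) = p (η W) := by
    intro s
    induction s using Finset.induction with
    | empty => simp
    | insert i s hi ih =>
      rw [← ih, Finset.piecewise_insert]
      have h1 : s.piecewise W' W = Function.update (s.piecewise W' W) i (W i) := by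
        rw [eq_comm, Function.update_eq_self_iff, Finset.piecewise_eq_of_notMem _ _ _ hi]
      conv_rhs => rw [h1]
      have := h i (η.toMultilinearMap.toLinearMap (s.piecewise W' W) i)
      rw [map_sub, map_sub, sub_eq_zero] at this
      exact this.symm
  rw [← key Finset.univ, Finset.piecewise_univ]

end NullAt

/-! ### Derivations of smooth functions in charts -/

section Manifold

open scoped Topology
open Filter

variable {E : Type*} [NormedAddCommGroup E] [NormedSpace ℝ E] [FiniteDimensional ℝ E]
  {X : Type*} [TopologicalSpace X] [ChartedSpace E X] [IsManifold 𝓘(ℝ, E) ∞ X] [T2Space X]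

/-- Evaluation of smooth functions at a point. -/
def evalAt (x : X) : Fun E X →ₐ[ℝ] ℝ where
  toFun f := f x
  map_one' := rfl
  map_mul' _ _ := rfl
  map_zero' := rfl
  map_add' _ _ := rfl
  commutes' _ := rfl

@[simp]
theorem evalAt_apply (x : X) (f : Fun E X) : evalAt x f = f x := rfl

theorem exists_bump {x : X} {U : Set X} (hU : U ∈ 𝓝 x) :
    ∃ χ : Fun E X, (∀ᶠ y in 𝓝 x, χ y = 1) ∧ tsupport χ ⊆ U := by
  obtain ⟨f, -, hf⟩ := (SmoothBumpFunction.nhds_basis_tsupport (I := 𝓘(ℝ, E)) x).mem_iff.1 hU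
  exact ⟨⟨f, f.contMDiff⟩, f.eventuallyEq_one, hf⟩

theorem contMDiff_bump_smul {G : Type*} [NormedAddCommGroup G] [NormedSpace ℝ G] (χ : Fun E X)
    {g : X → G} (hg : ∀ x ∈ tsupport χ, ContMDiffAt 𝓘(ℝ, E) 𝓘(ℝ, G) ∞ g x) :
    ContMDiff 𝓘(ℝ, E) 𝓘(ℝ, G) ∞ fun x => χ x • g x :=
  contMDiff_of_tsupport fun x hx =>
    (χ.contMDiff.contMDiffAt).smul (hg x (tsupport_smul_subset_left _ _ hx))

/-- A germ of a smooth function extends to a global function. -/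
theorem exists_extension {G : Type*} [NormedAddCommGroup G] [NormedSpace ℝ G] {x : X} {g : X → G}
    (hg : ∀ᶠ y in 𝓝 x, ContMDiffAt 𝓘(ℝ, E) 𝓘(ℝ, G) ∞ g y) :
    ∃ f : C^∞⟮𝓘(ℝ, E), X; 𝓘(ℝ, G), G⟯, ∀ᶠ y in 𝓝 x, f y = g y := by
  obtain ⟨χ, h1, h2⟩ := exists_bump (E := E) hg
  refine ⟨⟨_, contMDiff_bump_smul χ fun y hy => h2 hy⟩, ?_⟩
  filter_upwards [h1] with y hy
  change χ y • g y = g y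
  rw [hy, one_smul]

/-- Derivations are local: a bump function χ supported where f = g gives χ (f - g) = 0, and the
Leibniz rule at x, where χ = 1, leaves D f = D g. -/
theorem derivation_congr (D : VF E X) {f g : Fun E X} {x : X} (h : ∀ᶠ y in 𝓝 x, f y = g y) :
    D f x = D g x := by
  obtain ⟨χ, h1, h2⟩ := exists_bump (E := E) h
  have h0 : χ * (f - g) = 0 := by
    ext y
    by_cases hy : y ∈ tsupport χ
    · have : f y = g y := h2 hy
      change χ y * (f y - g y) = 0
      rw [this, sub_self, mul_zero]
    · change χ y * (f y - g y) = 0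
      rw [image_eq_zero_of_notMem_tsupport hy, zero_mul]
  have h3 : D (χ * (f - g)) x = 0 := by rw [h0, map_zero]; rfl
  rw [Derivation.leibniz] at h3
  have h4 : χ x * (D f x - D g x) + (f x - g x) * D χ x = 0 := by
    rw [map_sub] at h3; exact h3
  rw [h1.self_of_nhds, h.self_of_nhds] at h4
  linarith

theorem derivation_mul_apply (D : VF E X) (f g : Fun E X) (x : X) :
    D (f * g) x = f x * D g x + g x * D f x := by
  rw [Derivation.leibniz]; rfl

theorem derivation_sum_apply (D : VF E X) {J : Type*} (s : Finset J) (f : J → Fun E X) (x : X) :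
    D (∑ j ∈ s, f j) x = ∑ j ∈ s, D (f j) x := by
  rw [map_sum]
  exact map_sum (evalAt x) _ _

theorem derivation_const (D : VF E X) (r : ℝ) : D (algebraMap ℝ (Fun E X) r) = 0 :=
  D.map_algebraMap r

theorem sum_apply {J : Type*} (s : Finset J) (f : J → Fun E X) (x : X) :
    (∑ j ∈ s, f j) x = ∑ j ∈ s, f j x := map_sum (evalAt x) _ _

theorem derivation_sum_smul_apply {J : Type*} (s : Finset J) (a : J → Fun E X) (D : J → VF E X)
    (f : Fun E X) (x : X) : (∑ j ∈ s, a j • D j) f x = ∑ j ∈ s, a j x * D j f x := by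
  have h : (∑ j ∈ s, a j • D j) f = ∑ j ∈ s, (a j • D j) f := by
    have := congrArg (fun g => g f) (map_sum (Derivation.coeFnAddMonoidHom (R := ℝ) (A := Fun E X)
      (M := Fun E X)) (fun j => a j • D j) s)
    refine this.trans ?_
    rw [Finset.sum_apply]
    rfl
  rw [h, sum_apply]
  rfl

/-- Turns equality near x into an identity in the module, at the price of a factor that is 1 at x
and hence harmless in the fibre. -/
theorem exists_smul_eq_of_eventually_eq {D D' : VF E X} {x : X}
    (h : ∀ᶠ y in 𝓝 x, ∀ f, D f y = D' f y) : ∃ χ : Fun E X, χ x = 1 ∧ χ • D = χ • D' := by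
  obtain ⟨χ, h1, h2⟩ := exists_bump (E := E) h
  refine ⟨χ, h1.self_of_nhds, ?_⟩
  ext f y
  change χ y * D f y = χ y * D' f y
  by_cases hy : y ∈ tsupport χ
  · rw [h2 hy f]
  · rw [image_eq_zero_of_notMem_tsupport hy, zero_mul, zero_mul]

section Chart

variable {c : OpenPartialHomeomorph X E} (hc : c ∈ IsManifold.maximalAtlas 𝓘(ℝ, E) ∞ X)

include hc in
theorem contDiffAt_comp_symm (f : Fun E X) {e : E} (he : e ∈ c.target) :
    ContDiffAt ℝ ∞ (f ∘ c.symm) e := by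
  rw [← contMDiffAt_iff_contDiffAt]
  exact (f.contMDiff.contMDiffAt).comp e (contMDiffAt_symm_of_mem_maximalAtlas hc he)

include hc in
theorem contMDiffAt_chart {x : X} (hx : x ∈ c.source) : ContMDiffAt 𝓘(ℝ, E) 𝓘(ℝ, E) ∞ c x :=
  contMDiffAt_of_mem_maximalAtlas hc hx

include hc in
theorem contMDiffAt_fderiv_comp_symm (f : Fun E X)
    {u : X → E} {x : X} (hu : ContMDiffAt 𝓘(ℝ, E) 𝓘(ℝ, E) ∞ u x) (hx : x ∈ c.source) :
    ContMDiffAt 𝓘(ℝ, E) 𝓘(ℝ, ℝ) ∞ (fun x => fderiv ℝ (f ∘ c.symm) (c x) (u x)) x := by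
  have h1 : ContDiffAt ℝ ∞ (fderiv ℝ (f ∘ c.symm)) (c x) :=
    (contDiffAt_comp_symm hc f (c.map_source hx)).fderiv_right (m := ∞) (by simp)
  have h2 : ContMDiffAt 𝓘(ℝ, E) 𝓘(ℝ, E →L[ℝ] ℝ) ∞ (fun x => fderiv ℝ (f ∘ c.symm) (c x)) x :=
    h1.contMDiffAt.comp x (contMDiffAt_chart hc hx)
  exact h2.clm_apply hu

/-- The vector field with the chart expression `u`, cut off by a function supported in the
domain of the chart. -/
def chartDer (χ : Fun E X) (hχ : tsupport χ ⊆ c.source) (u : C^∞⟮𝓘(ℝ, E), X; 𝓘(ℝ, E), E⟯) :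
    VF E X :=
  Derivation.mk'
    { toFun := fun f => ⟨fun x => χ x • fderiv ℝ (f ∘ c.symm) (c x) (u x),
        contMDiff_bump_smul χ fun x hx =>
          contMDiffAt_fderiv_comp_symm hc f u.contMDiff.contMDiffAt (hχ hx)⟩
      map_add' := fun f g => by
        ext x
        change χ x * fderiv ℝ ((f ∘ c.symm) + (g ∘ c.symm)) (c x) (u x) =
          χ x * fderiv ℝ (f ∘ c.symm) (c x) (u x) + χ x * fderiv ℝ (g ∘ c.symm) (c x) (u x)
        by_cases hx : x ∈ tsupport χ
        · have hx := c.map_source (hχ hx)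
          rw [fderiv_add ((contDiffAt_comp_symm hc f hx).differentiableAt (by simp))
            ((contDiffAt_comp_symm hc g hx).differentiableAt (by simp))]
          simp only [add_apply]; ring
        · rw [image_eq_zero_of_notMem_tsupport hx]; ring
      map_smul' := fun r f => by
        ext x
        change χ x * fderiv ℝ (r • (f ∘ c.symm)) (c x) (u x) =
          r * (χ x * fderiv ℝ (f ∘ c.symm) (c x) (u x))
        rw [fderiv_const_smul_field]
        change χ x * (r * fderiv ℝ (f ∘ c.symm) (c x) (u x)) = _
        ring }
    fun f g => by
      ext x
      change χ x * fderiv ℝ ((f ∘ c.symm) * (g ∘ c.symm)) (c x) (u x) =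
          f x * (χ x * fderiv ℝ (g ∘ c.symm) (c x) (u x)) +
          g x * (χ x * fderiv ℝ (f ∘ c.symm) (c x) (u x))
      by_cases hx : x ∈ tsupport χ
      · have hs := hχ hx
        have hx := c.map_source hs
        rw [fderiv_mul ((contDiffAt_comp_symm hc f hx).differentiableAt (by simp))
            ((contDiffAt_comp_symm hc g hx).differentiableAt (by simp))]
        simp only [add_apply, smul_apply, smul_eq_mul,
          Function.comp_apply, c.left_inv hs]
        ring
      · rw [image_eq_zero_of_notMem_tsupport hx]; ring

theorem chartDer_apply (χ : Fun E X) (hχ : tsupport χ ⊆ c.source)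
    (u : C^∞⟮𝓘(ℝ, E), X; 𝓘(ℝ, E), E⟯) (f : Fun E X) (x : X) :
    chartDer hc χ hχ u f x = χ x * fderiv ℝ (f ∘ c.symm) (c x) (u x) := rfl

/-- A constant vector valued function. -/
def constMap (v : E) : C^∞⟮𝓘(ℝ, E), X; 𝓘(ℝ, E), E⟯ := ⟨fun _ => v, contMDiff_const⟩

-- A derivation is a first order differential operator. Hadamard's lemma writes f near x as f(x)
-- plus a sum of products (t_j - t_j(x)) g_j with g_j(x) the partial derivatives; D kills the
-- constant, and the Leibniz rule leaves D(t_j) g_j at x.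
include hc in
theorem chart_formula {J : Type*} [Fintype J] (b : Module.Basis J ℝ E) {x : X} (hx : x ∈ c.source)
    (t : J → Fun E X) (ht : ∀ j, ∀ᶠ y in 𝓝 x, t j y = b.coord j (c y)) (D : VF E X)
    (f : Fun E X) :
    D f x = fderiv ℝ (f ∘ c.symm) (c x) (∑ j, D (t j) x • b j) := by
  have hx' := c.map_source hx
  obtain ⟨F, hF⟩ := exists_extension (E := E) (X := E) (x := c x) (g := f ∘ c.symm) <| by
    filter_upwards [c.open_target.mem_nhds hx'] with e he
    exact (contDiffAt_comp_symm hc f he).contMDiffAt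
  obtain ⟨G, hG, hG1, hG2⟩ := exists_hadamard F F.contMDiff.contDiff (fun _ => c x) contDiff_const
  have hd : fderiv ℝ (f ∘ c.symm) (c x) = G (c x) := by
    rw [hG2 _ rfl]
    refine Filter.EventuallyEq.fderiv_eq ?_
    filter_upwards [hF] with e he using he.symm
  have hext : ∀ j, ∃ g : Fun E X, ∀ᶠ y in 𝓝 x, g y = G (c y) (b j) := fun j => by
    refine exists_extension ?_
    filter_upwards [c.open_source.mem_nhds hx] with y hy
    have h2 : ContMDiffAt 𝓘(ℝ, E) 𝓘(ℝ, E →L[ℝ] ℝ) ∞ (fun x => G (c x)) y :=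
      hG.contMDiff.contMDiffAt.comp y (contMDiffAt_chart hc hy)
    exact h2.clm_apply contMDiffAt_const
  choose g hg using hext
  have key : ∀ᶠ y in 𝓝 x, f y = (algebraMap ℝ (Fun E X) (f x) +
      ∑ j, (t j - algebraMap ℝ (Fun E X) (b.coord j (c x))) * g j) y := by
    have hFc : ∀ᶠ y in 𝓝 x, F (c y) = (f ∘ c.symm) (c y) :=
      (c.continuousAt hx).eventually hF
    filter_upwards [hFc, c.open_source.mem_nhds hx, eventually_all.2 ht, eventually_all.2 hg]
      with y h1 h2 h3 h4
    have h5 := hG1 (c y)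
    rw [h1, hF.self_of_nhds, Function.comp_apply, Function.comp_apply, c.left_inv h2,
      c.left_inv hx] at h5
    have h6 : c y - c x = ∑ j, (b.coord j (c y) - b.coord j (c x)) • b j := by
      simp only [← map_sub]
      exact (b.sum_repr (c y - c x)).symm
    change f y = f x + (∑ j, (t j - algebraMap ℝ (Fun E X) (b.coord j (c x))) * g j) y
    rw [sum_apply]
    change f y = f x + ∑ j, (t j y - b.coord j (c x)) * g j y
    have h7 : G (c y) (c y - c x) = ∑ j, (t j y - b.coord j (c x)) * g j y := by
      conv_lhs => rw [h6, map_sum]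
      refine Finset.sum_congr rfl fun j _ => ?_
      rw [map_smul, h3 j, h4 j, smul_eq_mul]
    linarith
  rw [derivation_congr D key, map_add, derivation_const, zero_add, derivation_sum_apply, hd,
    map_sum]
  refine Finset.sum_congr rfl fun j _ => ?_
  rw [derivation_mul_apply, map_sub, derivation_const, sub_zero, map_smul, (hg j).self_of_nhds,
    smul_eq_mul]
  change (t j x - b.coord j (c x)) * _ + _ = _
  rw [(ht j).self_of_nhds]
  ring

include hc in
theorem exists_chart_coordinates {J : Type*} [Finite J] (b : Module.Basis J ℝ E) {x : X}
    (hx : x ∈ c.source) :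
    ∃ t : J → Fun E X, ∀ᶠ y in 𝓝 x, ∀ j, t j y = b.coord j (c y) := by
  have : ∀ j, ∃ g : Fun E X, ∀ᶠ y in 𝓝 x, g y = b.coord j (c y) := fun j => by
    refine exists_extension ?_
    filter_upwards [c.open_source.mem_nhds hx] with y hy
    exact ((b.coord j).toContinuousLinearMap.contMDiff.contMDiffAt).comp y (contMDiffAt_chart hc hy)
  choose t ht using this
  exact ⟨t, eventually_all.2 ht⟩

include hc in
/-- Near a point of a chart, a derivation is given by a smooth vector valued function. -/
theorem exists_chart_expression (D : VF E X) {x : X} (hx : x ∈ c.source) :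
    ∃ u : C^∞⟮𝓘(ℝ, E), X; 𝓘(ℝ, E), E⟯, ∀ᶠ y in 𝓝 x, ∀ f : Fun E X,
      D f y = fderiv ℝ (f ∘ c.symm) (c y) (u y) := by
  let b := Module.finBasis ℝ E
  obtain ⟨t, ht⟩ := exists_chart_coordinates hc b hx
  refine ⟨⟨fun y => ∑ j, D (t j) y • b j, ?_⟩, ?_⟩
  · exact contMDiff_finsetSum fun j _ => (D (t j)).contMDiff.smul contMDiff_const
  · filter_upwards [ht.eventually_nhds, c.open_source.mem_nhds hx] with y hy hs f
    exact chart_formula hc b hs t (fun j => hy.mono fun z hz => hz j) D f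

end Chart

end Manifold

/-! ### Local coordinate frames -/

section Frames

open scoped Topology
open Filter

variable {E : Type*} [NormedAddCommGroup E] [NormedSpace ℝ E] [FiniteDimensional ℝ E]
  {X : Type*} [TopologicalSpace X] [ChartedSpace E X] [IsManifold 𝓘(ℝ, E) ∞ X] [T2Space X]

/-- Around every point there are coordinate functions with the dual coordinate vector fields. -/
theorem exists_local_frame {d : ℕ} (hd : Module.finrank ℝ E = d) (x : X) :
    ∃ (V : Fin d → VF E X) (t : Fin d → Fun E X),
      (∀ᶠ y in 𝓝 x, ∀ i j, V i (t j) y = if i = j then 1 else 0) ∧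
      ∀ᶠ y in 𝓝 x, ∀ (D : VF E X) (f : Fun E X), D f y = ∑ i, D (t i) y * V i f y := by
  let c := chartAt E x
  have hc : c ∈ IsManifold.maximalAtlas 𝓘(ℝ, E) ∞ X := IsManifold.chart_mem_maximalAtlas x
  have hx : x ∈ c.source := mem_chart_source E x
  let b := Module.finBasisOfFinrankEq ℝ E hd
  obtain ⟨t, ht⟩ := exists_chart_coordinates hc b hx
  obtain ⟨χ, h1, h2⟩ := exists_bump (E := E) (c.open_source.mem_nhds hx)
  refine ⟨fun i => chartDer hc χ h2 (constMap (b i)), t, ?_, ?_⟩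
  · filter_upwards [h1, ht.eventually_nhds, c.open_source.mem_nhds hx] with y hy hty hys i j
    rw [chartDer_apply, hy, one_mul]
    have h3 : (t j ∘ c.symm) =ᶠ[𝓝 (c y)] (b.coord j).toContinuousLinearMap := by
      have h4 : Tendsto c.symm (𝓝 (c y)) (𝓝 y) := by
        have := (c.continuousAt_symm (c.map_source hys)).tendsto
        rwa [c.left_inv hys] at this
      filter_upwards [h4.eventually hty, c.open_target.mem_nhds (c.map_source hys)] with e he he'
      rw [Function.comp_apply, he j, c.right_inv he']
      rfl
    rw [h3.fderiv_eq, ContinuousLinearMap.fderiv]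
    change b.coord j (b i) = _
    rw [Module.Basis.coord_apply, Module.Basis.repr_self, Finsupp.single_apply]
  · filter_upwards [h1, ht.eventually_nhds, c.open_source.mem_nhds hx] with y hy hty hys D f
    rw [chart_formula hc b hys t (fun j => hty.mono fun z hz => hz j) D f, map_sum]
    refine Finset.sum_congr rfl fun j _ => ?_
    rw [chartDer_apply, hy, one_mul, map_smul, smul_eq_mul]
    rfl

/-- A derivation that vanishes at a point is zero in the fibre. -/
theorem nullAt_of_vanish {D : VF E X} {x : X} (h : ∀ f, D f x = 0) : NullAt (evalAt (E := E) x) D := by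
  obtain ⟨V, t, -, hV⟩ := exists_local_frame (E := E) rfl x
  obtain ⟨χ, h1, h2⟩ := exists_smul_eq_of_eventually_eq (D := D) (D' := ∑ i, D (t i) • V i) (by
    filter_upwards [hV] with y hy f
    rw [hy D f, derivation_sum_smul_apply])
  refine NullAt.of_smul (a := χ) h1 ?_
  rw [h2]
  exact (NullAt.sum _ fun i _ => nullAt_smul_of_eq_zero (h _) _).smul _

theorem nullAt_of_eq {D D' : VF E X} {x : X} (h : ∀ f, D f x = D' f x) :
    NullAt (evalAt (E := E) x) (D - D') :=
  nullAt_of_vanish fun f => by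
    change D f x - D' f x = 0
    rw [h, sub_self]

end Frames

/-! ### Slice charts of a hypersurface -/

section Slice

open scoped Topology
open Filter

variable {E : Type*} [NormedAddCommGroup E] [NormedSpace ℝ E] [FiniteDimensional ℝ E]
  {X : Type*} [TopologicalSpace X] [ChartedSpace E X] [IsManifold 𝓘(ℝ, E) ∞ X] [T2Space X]
  {F : Type*} [NormedAddCommGroup F] [NormedSpace ℝ F] [FiniteDimensional ℝ F]
  {Z : Type*} [TopologicalSpace Z] [ChartedSpace F Z] [IsManifold 𝓘(ℝ, F) ∞ Z] [T2Space Z]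

/-- Charts around a point of a hypersurface in which the hypersurface is a hyperplane. -/
structure SliceChart (ι : Z → X) (y : Z) where
  c : OpenPartialHomeomorph X E
  d : OpenPartialHomeomorph Z F
  hc : c ∈ IsManifold.maximalAtlas 𝓘(ℝ, E) ∞ X
  hd : d ∈ IsManifold.maximalAtlas 𝓘(ℝ, F) ∞ Z
  J : F →L[ℝ] E
  P : E →L[ℝ] F
  ℓ : E →L[ℝ] ℝ
  v : E
  P_J : ∀ w, P (J w) = w
  ℓ_J : ∀ w, ℓ (J w) = 0
  ℓ_v : ℓ v = 1
  decomp : ∀ e, e = J (P e) + ℓ e • v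
  O : Set X
  isOpen_O : IsOpen O
  mem_O : ι y ∈ O
  O_subset : O ⊆ c.source
  mem_source : ∀ z, ι z ∈ O → z ∈ d.source
  chart_eq : ∀ z ∈ d.source, c (ι z) = J (d z)
  mem_range : ∀ x ∈ O, ℓ (c x) = 0 → x ∈ Set.range ι

/-- The normal form of an immersion; its complement is a line by the dimension count. The set O is
shrunk so that near the given point nothing else of the hypersurface enters and every solution of ℓ
= 0 is hit. -/
theorem exists_sliceChart {ι : Z → X} (hι : Manifold.IsSmoothEmbedding 𝓘(ℝ, F) 𝓘(ℝ, E) ∞ ι)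
    (hdim : Module.finrank ℝ F + 1 = Module.finrank ℝ E) (y : Z) :
    Nonempty (SliceChart (E := E) (F := F) ι y) := by
  have h := hι.isImmersion.isImmersionAt y
  have hfin : FiniteDimensional ℝ h.complement := by
    have : FiniteDimensional ℝ (F × h.complement) :=
      Module.Finite.equiv h.equiv.symm.toLinearEquiv
    exact Module.Finite.of_surjective (LinearMap.snd ℝ F h.complement) LinearMap.snd_surjective
  have hrank : Module.finrank ℝ h.complement = 1 := by
    have h1 := h.equiv.toLinearEquiv.finrank_eq
    rw [Module.finrank_prod] at h1
    omega
  obtain ⟨b⟩ : Nonempty (h.complement ≃L[ℝ] ℝ) :=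
    FiniteDimensional.nonempty_continuousLinearEquiv_of_finrank_eq (by simpa using hrank)
  let T : (F × ℝ) ≃L[ℝ] E := ((ContinuousLinearEquiv.refl ℝ F).prodCongr b.symm).trans h.equiv
  have hw : ∀ z ∈ h.domChart.source, h.codChart (ι z) = T (h.domChart z, 0) := by
    intro z hz
    have h0 : h.domChart z ∈ (h.domChart.extend 𝓘(ℝ, F)).target := by
      simpa only [OpenPartialHomeomorph.extend, mfld_simps] using h.domChart.map_source hz
    have h1 := h.writtenInCharts h0
    have h2 : (h.domChart.extend 𝓘(ℝ, F)).symm (h.domChart z) = z := by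
      simpa only [OpenPartialHomeomorph.extend, mfld_simps] using h.domChart.left_inv hz
    simp only [Function.comp_apply] at h1
    rw [h2] at h1
    have h3 : T (h.domChart z, 0) = h.equiv (h.domChart z, 0) := by
      simp [T]
    rw [h3, ← h1]
    rfl
  -- This is where ι being an embedding matters: the chart domain in Z is the preimage of an open
  -- subset of X, so no other sheet of Z meets O.
  obtain ⟨O₁, hO₁, hO₁'⟩ := hι.isEmbedding.isInducing.isOpen_iff.1 h.domChart.open_source
  let P : E →L[ℝ] F := (ContinuousLinearMap.fst ℝ F ℝ).comp T.symm.toContinuousLinearMap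
  let l : E →L[ℝ] ℝ := (ContinuousLinearMap.snd ℝ F ℝ).comp T.symm.toContinuousLinearMap
  let J : F →L[ℝ] E := T.toContinuousLinearMap.comp (ContinuousLinearMap.inl ℝ F ℝ)
  have hPJ : ∀ w, P (J w) = w := fun w => by simp [P, J]
  have hlJ : ∀ w, l (J w) = 0 := fun w => by simp [l, J]
  have hdec : ∀ e, e = J (P e) + l e • T (0, 1) := fun e => by
    apply T.symm.injective
    rw [map_add, map_smul, T.symm_apply_apply]
    simp [J, P, l]
  refine ⟨{
    c := h.codChart
    d := h.domChart
    hc := h.codChart_mem_maximalAtlas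
    hd := h.domChart_mem_maximalAtlas
    J := J
    P := P
    ℓ := l
    v := T (0, 1)
    P_J := hPJ
    ℓ_J := hlJ
    ℓ_v := by simp [l]
    decomp := hdec
    O := O₁ ∩ (h.codChart.source ∩ h.codChart ⁻¹' (P ⁻¹' h.domChart.target))
    isOpen_O := hO₁.inter (h.codChart.isOpen_inter_preimage
      (h.domChart.open_target.preimage P.continuous))
    mem_O := ⟨?_, h.mem_codChart_source, ?_⟩
    O_subset := fun x hx => hx.2.1
    mem_source := fun z hz => by rw [← hO₁']; exact hz.1
    chart_eq := fun z hz => hw z hz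
    mem_range := fun x hx hl => ?_ }⟩
  · have := h.mem_domChart_source
    rw [← hO₁'] at this
    exact this
  · have h1 := hw y h.mem_domChart_source
    change P (h.codChart (ι y)) ∈ h.domChart.target
    have h2 : T (h.domChart y, 0) = J (h.domChart y) := rfl
    rw [h1, h2, hPJ]
    exact h.domChart.map_source h.mem_domChart_source
  · have h1 := hdec (h.codChart x)
    rw [hl, zero_smul, add_zero] at h1
    have h2 : h.domChart.symm (P (h.codChart x)) ∈ h.domChart.source :=
      h.domChart.map_target hx.2.2
    refine ⟨h.domChart.symm (P (h.codChart x)), ?_⟩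
    refine h.codChart.injOn (h.source_subset_preimage_source h2) hx.2.1 ?_
    rw [hw _ h2, h.domChart.right_inv hx.2.2]
    exact h1.symm

end Slice

/-! ### Division, lifting and restriction near a hypersurface -/

section Slice

open scoped Topology
open Filter

variable {E : Type*} [NormedAddCommGroup E] [NormedSpace ℝ E] [FiniteDimensional ℝ E]
  {X : Type*} [TopologicalSpace X] [ChartedSpace E X] [IsManifold 𝓘(ℝ, E) ∞ X] [T2Space X]
  {F : Type*} [NormedAddCommGroup F] [NormedSpace ℝ F] [FiniteDimensional ℝ F]
  {Z : Type*} [TopologicalSpace Z] [ChartedSpace F Z] [IsManifold 𝓘(ℝ, F) ∞ Z] [T2Space Z]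

/-- Composition of a vector valued function with a linear map. -/
def linComp {G H : Type*} [NormedAddCommGroup G] [NormedSpace ℝ G] [NormedAddCommGroup H]
    [NormedSpace ℝ H] (l : G →L[ℝ] H) (u : C^∞⟮𝓘(ℝ, E), X; 𝓘(ℝ, G), G⟯) :
    C^∞⟮𝓘(ℝ, E), X; 𝓘(ℝ, H), H⟯ := ⟨fun x => l (u x), l.contMDiff.comp u.contMDiff⟩

theorem derivation_congr_eventually (D : VF E X) {f g : Fun E X} {x : X}
    (h : ∀ᶠ y in 𝓝 x, f y = g y) : ∀ᶠ y in 𝓝 x, D f y = D g y := by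
  filter_upwards [h.eventually_nhds] with y hy using derivation_congr D hy

theorem mem_ideal_range {ι : C^∞⟮𝓘(ℝ, F), Z; 𝓘(ℝ, E), X⟯} {f : Fun E X} :
    f ∈ vanishingIdeal (E := E) (Set.range ι) ↔ ∀ y, f (ι y) = 0 :=
  ⟨fun h y => h _ ⟨y, rfl⟩, fun h _ ⟨y, hy⟩ => hy ▸ h y⟩

theorem log_apply {ι : C^∞⟮𝓘(ℝ, F), Z; 𝓘(ℝ, E), X⟯} (D : logTangent E (Set.range ι))
    {f : Fun E X} (hf : f ∈ vanishingIdeal (E := E) (Set.range ι)) :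
    (D : VF E X) f ∈ vanishingIdeal (E := E) (Set.range ι) := D.2 f hf

/-- The vector fields `W` and `V` agree at one point of the submanifold. -/
def RelAt (ι : C^∞⟮𝓘(ℝ, F), Z; 𝓘(ℝ, E), X⟯) (y : Z) (W : VF E X) (V : VF F Z) : Prop :=
  ∀ f : Fun E X, W f (ι y) = V (f.comp ι) y

theorem Related.mem {ι : C^∞⟮𝓘(ℝ, F), Z; 𝓘(ℝ, E), X⟯} {W : VF E X} {V : VF F Z}
    (h : Related ι W V) : W ∈ logTangent E (Set.range ι) := by
  intro f hf
  rw [mem_ideal_range] at hf ⊢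
  intro y
  have h0 : f.comp ι = 0 := by ext z; exact hf z
  rw [h f y, h0, map_zero]; rfl

namespace SliceChart

variable {ι : C^∞⟮𝓘(ℝ, F), Z; 𝓘(ℝ, E), X⟯} {y : Z} (s : SliceChart (E := E) (F := F) ι y)

theorem isOpen_preimage : IsOpen (ι ⁻¹' s.O) := s.isOpen_O.preimage ι.contMDiff.continuous

theorem O_mem : s.O ∈ 𝓝 (ι y) := s.isOpen_O.mem_nhds s.mem_O

theorem mem_c : ι y ∈ s.c.source := s.O_subset s.mem_O

theorem eventually_mem : ∀ᶠ z in 𝓝 y, ι z ∈ s.O := s.isOpen_preimage.mem_nhds s.mem_O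

theorem fderiv_comp_slice (f : Fun E X) {z : Z} (hz : ι z ∈ s.O) (w : F) :
    fderiv ℝ (f ∘ s.c.symm) (s.c (ι z)) (s.J w) =
      fderiv ℝ (f.comp ι ∘ s.d.symm) (s.d z) w := by
  have hz' := s.mem_source z hz
  have h1 : (f.comp ι ∘ s.d.symm) =ᶠ[𝓝 (s.d z)] (f ∘ s.c.symm) ∘ s.J := by
    have h2 : Tendsto s.d.symm (𝓝 (s.d z)) (𝓝 z) := by
      have := (s.d.continuousAt_symm (s.d.map_source hz')).tendsto
      rwa [s.d.left_inv hz'] at this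
    filter_upwards [h2.eventually (s.isOpen_preimage.mem_nhds hz),
      s.d.open_target.mem_nhds (s.d.map_source hz')] with e he he'
    change f (ι (s.d.symm e)) = f (s.c.symm (s.J e))
    rw [← s.d.right_inv he', ← s.chart_eq _ (s.d.map_target he'), s.c.left_inv (s.O_subset he),
      s.d.right_inv he']
  have h3 : s.c (ι z) = s.J (s.d z) := s.chart_eq z hz'
  have h4 : DifferentiableAt ℝ (f ∘ s.c.symm) (s.J (s.d z)) := by
    rw [← h3]
    exact (contDiffAt_comp_symm s.hc f (s.c.map_source (s.O_subset hz))).differentiableAt (by simp)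
  rw [h1.fderiv_eq, fderiv_comp _ h4 s.J.differentiableAt, ContinuousLinearMap.fderiv, h3]
  rfl

/-- A chart field pointing along the hyperplane is tangent to the hypersurface and restricts there
to the chart field with the same components. -/
theorem exists_related (χ : Fun E X) (hχ : tsupport χ ⊆ s.O)
    (w : C^∞⟮𝓘(ℝ, E), X; 𝓘(ℝ, F), F⟯) :
    ∃ V : VF F Z,
      Related ι (chartDer s.hc χ (hχ.trans s.O_subset) (linComp s.J w)) V ∧
      ∀ (f : Fun F Z) (z : Z), V f z = χ (ι z) * fderiv ℝ (f ∘ s.d.symm) (s.d z) (w (ι z)) := by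
  have hsupp : tsupport (χ.comp ι) ⊆ ι ⁻¹' s.O :=
    (closure_minimal (t := ι ⁻¹' tsupport χ) (fun z hz => subset_tsupport χ hz)
      ((isClosed_tsupport χ).preimage ι.contMDiff.continuous)).trans (Set.preimage_mono hχ)
  refine ⟨chartDer s.hd (χ.comp ι) (hsupp.trans fun z hz => s.mem_source z hz) (w.comp ι),
    fun f z => ?_, fun f z => rfl⟩
  change χ (ι z) * fderiv ℝ (f ∘ s.c.symm) (s.c (ι z)) (s.J (w (ι z))) =
    χ (ι z) * fderiv ℝ (f.comp ι ∘ s.d.symm) (s.d z) (w (ι z))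
  by_cases hz : ι z ∈ tsupport χ
  · rw [s.fderiv_comp_slice f (hχ hz)]
  · have h0 : χ (ι z) = 0 := image_eq_zero_of_notMem_tsupport hz
    rw [h0, zero_mul, zero_mul]

theorem eventually_mem_range : ∀ᶠ x in 𝓝 (ι y), s.ℓ (s.c x) = 0 → x ∈ Set.range ι := by
  filter_upwards [s.O_mem] with x hx using s.mem_range x hx

theorem exists_defining : ∃ z ∈ vanishingIdeal (E := E) (Set.range ι),
    ∀ᶠ x in 𝓝 (ι y), z x = s.ℓ (s.c x) := by
  obtain ⟨χ, h1, h2⟩ := exists_bump (E := E) s.O_mem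
  refine ⟨⟨_, contMDiff_bump_smul (g := fun x => s.ℓ (s.c x)) χ fun x hx =>
    (s.ℓ.contMDiff.contMDiffAt).comp x (contMDiffAt_chart s.hc (s.O_subset (h2 hx)))⟩, mem_ideal_range.2 fun z => ?_, ?_⟩
  · change χ (ι z) * s.ℓ (s.c (ι z)) = 0
    by_cases hz : ι z ∈ tsupport χ
    · rw [s.chart_eq _ (s.mem_source _ (h2 hz)), s.ℓ_J, mul_zero]
    · rw [image_eq_zero_of_notMem_tsupport hz, zero_mul]
  · filter_upwards [h1] with x hx
    change χ x • s.ℓ (s.c x) = _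
    rw [hx, one_smul]

theorem tendsto_symm : Tendsto s.c.symm (𝓝 (s.c (ι y))) (𝓝 (ι y)) := by
  have := (s.c.continuousAt_symm (s.c.map_source s.mem_c)).tendsto
  rwa [s.c.left_inv s.mem_c] at this

/-- Hadamard's lemma along the projection to the hyperplane: g vanishes at the projected point, so g
= G(x - Jpx) = ℓ G(v) with Jpx that point. -/
theorem exists_quotient {g : Fun E X} (hg : g ∈ vanishingIdeal (E := E) (Set.range ι)) :
    ∃ a : Fun E X, ∀ᶠ x in 𝓝 (ι y), g x = a x * s.ℓ (s.c x) := by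
  have hx := s.mem_c
  have hx' := s.c.map_source hx
  obtain ⟨f, hF⟩ := exists_extension (E := E) (X := E) (x := s.c (ι y)) (g := g ∘ s.c.symm) <| by
    filter_upwards [s.c.open_target.mem_nhds hx'] with e he
    exact (contDiffAt_comp_symm s.hc g he).contMDiffAt
  obtain ⟨G, hG, hG1, -⟩ := exists_hadamard f f.contMDiff.contDiff (fun e => s.J (s.P e))
    (s.J.contDiff.comp s.P.contDiff)
  obtain ⟨a, ha⟩ := exists_extension (E := E) (x := ι y) (g := fun x => G (s.c x) s.v) <| by
    filter_upwards [s.c.open_source.mem_nhds hx] with z hz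
    have h2 : ContMDiffAt 𝓘(ℝ, E) 𝓘(ℝ, E →L[ℝ] ℝ) ∞ (fun x => G (s.c x)) z :=
      hG.contMDiff.contMDiffAt.comp z (contMDiffAt_chart s.hc hz)
    exact h2.clm_apply contMDiffAt_const
  refine ⟨a, ?_⟩
  have hJP : s.J (s.P (s.c (ι y))) = s.c (ι y) := by
    rw [s.chart_eq y (s.mem_source y s.mem_O), s.P_J]
  have hcont : Tendsto (fun x => s.J (s.P (s.c x))) (𝓝 (ι y)) (𝓝 (s.c (ι y))) := by
    have := ((s.J.continuous.comp s.P.continuous).continuousAt.comp (s.c.continuousAt hx)).tendsto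
    simp only [Function.comp_apply, hJP] at this
    exact this
  filter_upwards [ha, (s.c.continuousAt hx).eventually hF, hcont.eventually hF,
    s.c.open_source.mem_nhds hx, (s.tendsto_symm.comp hcont).eventually s.O_mem,
    hcont.eventually (s.c.open_target.mem_nhds hx')] with x h1 h2 h3 h4 h5 h6
  have h7 := hG1 (s.c x)
  rw [h2, h3] at h7
  have h8 : s.c.symm (s.J (s.P (s.c x))) ∈ Set.range ι := by
    refine s.mem_range _ h5 ?_
    rw [s.c.right_inv h6, s.ℓ_J]
  rw [Function.comp_apply, Function.comp_apply, hg _ h8, s.c.left_inv h4, sub_zero] at h7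
  rw [h7, h1]
  have h10 : s.c x - s.J (s.P (s.c x)) = s.ℓ (s.c x) • s.v := by
    rw [sub_eq_iff_eq_add']
    exact s.decomp _
  rw [h10, map_smul, smul_eq_mul, mul_comm]

include s in
/-- A defining function `z` and a transverse vector field: the log vector fields are spanned by
`z ∂_z` and the vector fields that annihilate `z`. -/
theorem exists_transverse :
    ∃ (z : Fun E X) (T : VF E X), z ∈ vanishingIdeal (E := E) (Set.range ι) ∧
      (∀ᶠ x in 𝓝 (ι y), z x = 0 → x ∈ Set.range ι) ∧ (∀ᶠ x in 𝓝 (ι y), T z x = 1) ∧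
      (∀ g ∈ vanishingIdeal (E := E) (Set.range ι),
        ∃ a : Fun E X, ∀ᶠ x in 𝓝 (ι y), g x = a x * z x) ∧
      ∃ e : logTangent E (Set.range ι), (∀ f x, (e : VF E X) f x = z x * T f x) ∧
      ∀ (D : logTangent E (Set.range ι)) (a : Fun E X),
        (∀ᶠ x in 𝓝 (ι y), (D : VF E X) z x = a x * z x) → (∀ f, (D : VF E X) f (ι y) = 0) →
        NullAt (evalAt (E := E) (ι y)) (D - a • e) := by
  obtain ⟨z, hz, hz'⟩ := s.exists_defining
  obtain ⟨χ, h1, h2⟩ := exists_bump (E := E) s.O_mem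
  let T := chartDer s.hc χ (h2.trans s.O_subset) (constMap s.v)
  have hdz : ∀ᶠ x in 𝓝 (ι y), ∀ v, fderiv ℝ (z ∘ s.c.symm) (s.c x) v = s.ℓ v := by
    filter_upwards [hz'.eventually_nhds, s.c.open_source.mem_nhds s.mem_c] with x hx hs v
    have h3 : (z ∘ s.c.symm) =ᶠ[𝓝 (s.c x)] s.ℓ := by
      have h4 : Tendsto s.c.symm (𝓝 (s.c x)) (𝓝 x) := by
        have := (s.c.continuousAt_symm (s.c.map_source hs)).tendsto
        rwa [s.c.left_inv hs] at this
      filter_upwards [h4.eventually hx, s.c.open_target.mem_nhds (s.c.map_source hs)] with e he he'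
      rw [Function.comp_apply, he, s.c.right_inv he']
    rw [h3.fderiv_eq, ContinuousLinearMap.fderiv]
  have hT : ∀ᶠ x in 𝓝 (ι y), T z x = 1 := by
    filter_upwards [h1, hdz] with x hx hx'
    rw [chartDer_apply, hx, one_mul, hx']
    exact s.ℓ_v
  have he : z • T ∈ logTangent E (Set.range ι) := fun f _ x hx => by
    change z x * T f x = 0
    rw [hz x hx, zero_mul]
  refine ⟨z, T, hz, ?_, hT, fun g hg => ?_, ⟨z • T, he⟩, fun f x => rfl, fun D a hD hD' => ?_⟩
  · filter_upwards [hz', s.eventually_mem_range] with x hx hx' h using hx' (hx ▸ h)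
  · obtain ⟨a, ha⟩ := s.exists_quotient hg
    refine ⟨a, ?_⟩
    filter_upwards [ha, hz'] with x hx hx'
    rw [hx, hx']
  · obtain ⟨u, hu⟩ := exists_chart_expression s.hc (D : VF E X) s.mem_c
    let b := Module.finBasis ℝ F
    -- The field D is expanded into tangential chart fields W j with coefficients q j, and its
    -- normal part a z T; the q j vanish at the point because D does.
    have hrel : ∀ j, ∃ W : logTangent E (Set.range ι), ∀ f x, (W : VF E X) f x =
        χ x * fderiv ℝ (f ∘ s.c.symm) (s.c x) (s.J (b j)) := fun j => by
      obtain ⟨V, hV, -⟩ := s.exists_related χ h2 ⟨fun _ => b j, contMDiff_const⟩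
      exact ⟨⟨_, hV.mem⟩, fun f x => rfl⟩
    choose W hW using hrel
    let q : Fin (Module.finrank ℝ F) → Fun E X := fun j =>
      ⟨fun x => (b.coord j).toContinuousLinearMap (s.P (u x)),
        ((b.coord j).toContinuousLinearMap.contMDiff.comp s.P.contMDiff).comp u.contMDiff⟩
    have hu0 : ∀ᶠ x in 𝓝 (ι y), s.ℓ (u x) = a x * z x := by
      filter_upwards [hu, hdz, hD] with x h3 h4 h5
      rw [← h4, ← h3, h5]
    have hq : ∀ j, q j (ι y) = 0 := fun j => by
      have h3 : u (ι y) = 0 := by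
        refine (Module.forall_dual_apply_eq_zero_iff ℝ (u (ι y))).1 fun m => ?_
        obtain ⟨f, hf⟩ := exists_extension (E := E) (x := ι y)
          (g := fun x => m.toContinuousLinearMap (s.c x)) <| by
            filter_upwards [s.c.open_source.mem_nhds s.mem_c] with x hx
            exact (m.toContinuousLinearMap.contMDiff.contMDiffAt).comp x (contMDiffAt_chart s.hc hx)
        have h4 : (f ∘ s.c.symm) =ᶠ[𝓝 (s.c (ι y))] m.toContinuousLinearMap := by
          filter_upwards [s.tendsto_symm.eventually hf,
            s.c.open_target.mem_nhds (s.c.map_source s.mem_c)] with e he he'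
          rw [Function.comp_apply, he, s.c.right_inv he']
        have h5 := hu.self_of_nhds f
        rw [hD' f, h4.fderiv_eq, ContinuousLinearMap.fderiv] at h5
        exact h5.symm
      change b.coord j (s.P (u (ι y))) = 0
      rw [h3, map_zero, map_zero]
    have hloc : ∀ᶠ x in 𝓝 (ι y), ∀ f, (D : VF E X) f x =
        ((∑ j, q j • (W j : VF E X)) + a • (z • T)) f x := by
      filter_upwards [hu, hu0, h1] with x h3 h4 h5 f
      change _ = (∑ j, q j • (W j : VF E X)) f x + a x * (z x * T f x)
      rw [derivation_sum_smul_apply, h3 f, chartDer_apply, h5, one_mul]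
      conv_lhs => rw [s.decomp (u x), map_add, map_smul, h4, ← b.sum_repr (s.P (u x)), map_sum,
        map_sum]
      change _ + _ * fderiv ℝ (f ∘ s.c.symm) (s.c x) s.v = _ + _ * (_ * fderiv ℝ (f ∘ s.c.symm) (s.c x) s.v)
      congr 1
      · refine Finset.sum_congr rfl fun j _ => ?_
        rw [map_smul, map_smul, smul_eq_mul]
        rw [hW, h5, one_mul]
        rfl
      · ring
    obtain ⟨κ, k1, k2⟩ := exists_smul_eq_of_eventually_eq hloc
    refine NullAt.of_smul (a := κ) k1 ?_
    have k3 : κ • (D - a • (⟨z • T, he⟩ : logTangent E (Set.range ι))) =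
        κ • ∑ j, q j • W j := by
      apply Subtype.ext
      have k4 : ((∑ j, q j • W j : logTangent E (Set.range ι)) : VF E X) =
          ∑ j, q j • (W j : VF E X) :=
        map_sum (SMulMemClass.subtype (logTangent E (Set.range ι))) _ _
      change κ • ((D : VF E X) - a • (z • T)) = κ • ((∑ j, q j • W j : logTangent E (Set.range ι)) : VF E X)
      rw [k4, smul_sub, k2, smul_add, add_sub_cancel_right]
    rw [k3]
    exact (NullAt.sum _ fun j _ => nullAt_smul_of_eq_zero (hq j) _).smul _

include s in
/-- Vector fields on the hypersurface lift locally. -/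
theorem exists_lift (V : VF F Z) : ∃ (W : logTangent E (Set.range ι)) (V' : VF F Z),
    Related ι (W : VF E X) V' ∧ ∀ᶠ z in 𝓝 y, ∀ f, V' f z = V f z := by
  have hy := s.mem_source y s.mem_O
  obtain ⟨u, hu⟩ := exists_chart_expression s.hd V hy
  obtain ⟨χ, h1, h2⟩ := exists_bump (E := E) s.O_mem
  have hP : s.P (s.c (ι y)) = s.d y := by rw [s.chart_eq y hy, s.P_J]
  obtain ⟨w, hw⟩ := exists_extension (E := E) (x := ι y) (g := fun x => u (s.d.symm (s.P (s.c x)))) <| by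
    have : ∀ᶠ x in 𝓝 (ι y), s.P (s.c x) ∈ s.d.target := by
      refine (s.P.continuous.continuousAt.comp (s.c.continuousAt s.mem_c)).eventually
        (s.d.open_target.mem_nhds ?_)
      rw [Function.comp_apply, hP]; exact s.d.map_source hy
    filter_upwards [this, s.c.open_source.mem_nhds s.mem_c] with x hx hx'
    exact (u.contMDiff.contMDiffAt).comp x
      ((contMDiffAt_symm_of_mem_maximalAtlas s.hd hx).comp x
        ((s.P.contMDiff.contMDiffAt).comp x (contMDiffAt_chart s.hc hx')))
  obtain ⟨V', hV, hV'⟩ := s.exists_related χ h2 w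
  refine ⟨⟨_, hV.mem⟩, V', hV, ?_⟩
  have hc : Tendsto ι (𝓝 y) (𝓝 (ι y)) := ι.contMDiff.continuous.continuousAt
  filter_upwards [hu, hc.eventually hw, hc.eventually h1, s.d.open_source.mem_nhds hy]
    with z k1 k2 k3 k4 f
  rw [hV', k1, k3, one_mul, k2, s.chart_eq z k4, s.P_J, s.d.left_inv k4]

include s in
/-- Log vector fields restrict to the hypersurface. -/
theorem exists_restrict (D : logTangent E (Set.range ι)) :
    ∃ V : VF F Z, ∀ᶠ z in 𝓝 y, RelAt ι z (D : VF E X) V := by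
  have hy := s.mem_source y s.mem_O
  obtain ⟨u, hu⟩ := exists_chart_expression s.hc (D : VF E X) s.mem_c
  obtain ⟨χ, h1, h2⟩ := exists_bump (E := F) (s.d.open_source.mem_nhds hy)
  obtain ⟨z, hz, hz'⟩ := s.exists_defining
  have hc : Tendsto ι (𝓝 y) (𝓝 (ι y)) := ι.contMDiff.continuous.continuousAt
  refine ⟨chartDer s.hd χ h2 (linComp s.P (u.comp ι)), ?_⟩
  filter_upwards [hc.eventually hu, hc.eventually hz'.eventually_nhds, h1, s.eventually_mem]
    with q k1 k2 k3 k4 f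
  rw [chartDer_apply, k3, one_mul, k1 f]
  have h3 : (z ∘ s.c.symm) =ᶠ[𝓝 (s.c (ι q))] s.ℓ := by
    have hs := s.O_subset k4
    have h4 : Tendsto s.c.symm (𝓝 (s.c (ι q))) (𝓝 (ι q)) := by
      have := (s.c.continuousAt_symm (s.c.map_source hs)).tendsto
      rwa [s.c.left_inv hs] at this
    filter_upwards [h4.eventually k2, s.c.open_target.mem_nhds (s.c.map_source hs)] with e he he'
    rw [Function.comp_apply, he, s.c.right_inv he']
  -- The component of D normal to the hypersurface is the derivative of a defining function, which a
  -- log vector field makes vanish on Z.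
  have h4 : s.ℓ (u (ι q)) = 0 := by
    have := k1 z
    rw [h3.fderiv_eq, ContinuousLinearMap.fderiv, mem_ideal_range.1 (log_apply D hz)] at this
    exact this.symm
  have h5 : u (ι q) = s.J (s.P (u (ι q))) := by
    conv_lhs => rw [s.decomp (u (ι q)), h4, zero_smul, add_zero]
  conv_lhs => rw [h5]
  exact s.fderiv_comp_slice f k4 _

include s in
/-- Functions on the hypersurface extend locally. -/
theorem exists_function_extension (g : Fun F Z) :
    ∃ f : Fun E X, ∀ᶠ z in 𝓝 y, f (ι z) = g z := by
  have hy := s.mem_source y s.mem_O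
  have hP : s.P (s.c (ι y)) = s.d y := by rw [s.chart_eq y hy, s.P_J]
  obtain ⟨w, hw⟩ := exists_extension (E := E) (x := ι y) (g := fun x => g (s.d.symm (s.P (s.c x)))) <| by
    have : ∀ᶠ x in 𝓝 (ι y), s.P (s.c x) ∈ s.d.target := by
      refine (s.P.continuous.continuousAt.comp (s.c.continuousAt s.mem_c)).eventually
        (s.d.open_target.mem_nhds ?_)
      rw [Function.comp_apply, hP]; exact s.d.map_source hy
    filter_upwards [this, s.c.open_source.mem_nhds s.mem_c] with x hx hx'
    exact (g.contMDiff.contMDiffAt).comp x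
      ((contMDiffAt_symm_of_mem_maximalAtlas s.hd hx).comp x
        ((s.P.contMDiff.contMDiffAt).comp x (contMDiffAt_chart s.hc hx')))
  refine ⟨w, ?_⟩
  have hc : Tendsto ι (𝓝 y) (𝓝 (ι y)) := ι.contMDiff.continuous.continuousAt
  filter_upwards [hc.eventually hw, s.d.open_source.mem_nhds hy] with z k2 k4
  rw [k2, s.chart_eq z k4, s.P_J, s.d.left_inv k4]

end SliceChart

end Slice

/-! ### Gluing local derivations -/

section Gluing

open scoped Topology
open Filter

variable {E : Type*} [NormedAddCommGroup E] [NormedSpace ℝ E] [FiniteDimensional ℝ E]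
  {X : Type*} [TopologicalSpace X] [ChartedSpace E X] [IsManifold 𝓘(ℝ, E) ∞ X] [T2Space X]

/-- Local derivations that agree glue. -/
theorem exists_glue (T : Fun E X → X → ℝ)
    (hT : ∀ x, ∃ D : VF E X, ∀ᶠ y in 𝓝 x, ∀ f, T f y = D f y) :
    ∃ D : VF E X, ∀ f x, D f x = T f x := by
  have hs : ∀ f, ContMDiff 𝓘(ℝ, E) 𝓘(ℝ, ℝ) ∞ (T f) := fun f x => by
    obtain ⟨D, hD⟩ := hT x
    refine (D f).contMDiff.contMDiffAt.congr_of_eventuallyEq ?_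
    filter_upwards [hD] with y hy using hy f
  have hp : ∀ x, ∃ D : VF E X, ∀ f, T f x = D f x := fun x => by
    obtain ⟨D, hD⟩ := hT x
    exact ⟨D, hD.self_of_nhds⟩
  refine ⟨Derivation.mk'
    { toFun := fun f => ⟨T f, hs f⟩
      map_add' := fun f g => by
        ext x
        obtain ⟨D, hD⟩ := hp x
        change T (f + g) x = T f x + T g x
        rw [hD, hD, hD, map_add]; rfl
      map_smul' := fun r f => by
        ext x
        obtain ⟨D, hD⟩ := hp x
        change T (r • f) x = r • T f x
        rw [hD, hD, Derivation.map_smul]; rfl }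
    fun f g => by
      ext x
      obtain ⟨D, hD⟩ := hp x
      change T (f * g) x = f x * T g x + g x * T f x
      rw [hD, hD, hD, derivation_mul_apply], fun f x => rfl⟩

end Gluing

/-! ### Closed hypersurfaces: square functions and Euler vector fields -/

section Hypersurface

open scoped Topology
open Filter

variable {E : Type*} [NormedAddCommGroup E] [NormedSpace ℝ E] [FiniteDimensional ℝ E]
  {X : Type*} [TopologicalSpace X] [ChartedSpace E X] [IsManifold 𝓘(ℝ, E) ∞ X] [T2Space X]
  {F : Type*} [NormedAddCommGroup F] [NormedSpace ℝ F] [FiniteDimensional ℝ F]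
  {Z : Type*} [TopologicalSpace Z] [ChartedSpace F Z] [IsManifold 𝓘(ℝ, F) ∞ Z] [T2Space Z]
  {ι : C^∞⟮𝓘(ℝ, F), Z; 𝓘(ℝ, E), X⟯}

theorem smul_mem_log {Y : Set X} {z : Fun E X} (hz : z ∈ vanishingIdeal (E := E) Y) (T : VF E X) :
    z • T ∈ logTangent E Y := fun f _ x hx => by
  change z x * T f x = 0
  rw [hz x hx, zero_mul]

/-- A local defining function of a hypersurface, with a vector field that has derivative one on it. -/
structure IsDefiningAt (Y : Set X) (p : X) (z : Fun E X) (T : VF E X) : Prop where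
  mem : z ∈ vanishingIdeal (E := E) Y
  zero : ∀ᶠ x in 𝓝 p, z x = 0 → x ∈ Y
  one : ∀ᶠ x in 𝓝 p, T z x = 1
  quot : ∀ g ∈ vanishingIdeal (E := E) Y, ∃ a : Fun E X, ∀ᶠ x in 𝓝 p, g x = a x * z x
  null : ∀ (D : logTangent E Y) (a : Fun E X),
    (∀ᶠ x in 𝓝 p, (D : VF E X) z x = a x * z x) → (∀ f, (D : VF E X) f p = 0) →
      NullAt (evalAt (E := E) p) (D - a • (⟨z • T, smul_mem_log mem T⟩ : logTangent E Y))

theorem SliceChart.exists_isDefiningAt {y : Z} (s : SliceChart (E := E) (F := F) ι y) :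
    ∃ (z : Fun E X) (T : VF E X), IsDefiningAt (Set.range ι) (ι y) z T := by
  obtain ⟨z, T, h1, h2, h3, h4, e, h5, h6⟩ := s.exists_transverse
  have he : e = ⟨z • T, smul_mem_log h1 T⟩ := by
    ext f x
    exact h5 f x
  subst he
  exact ⟨z, T, h1, h2, h3, h4, h6⟩

variable (E) in
/-- A closed subset that is a smooth hypersurface. -/
structure IsHypersurface (Y : Set X) : Prop where
  isClosed : IsClosed Y
  exists_defining : ∀ p ∈ Y, ∃ (z : Fun E X) (T : VF E X), IsDefiningAt Y p z T

variable {Y : Set X}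

/-- The complement of Y is dense, in algebraic form: z g vanishes near p, and applying T at p, where
z = 0 and T z = 1, gives g(p) = 0. -/
theorem IsDefiningAt.eq_zero {p : X} (hp : p ∈ Y) {z : Fun E X} {T : VF E X}
    (h : IsDefiningAt Y p z T) {g : Fun E X} (hg : ∀ᶠ x in 𝓝 p, x ∉ Y → g x = 0) : g p = 0 := by
  have h1 : ∀ᶠ x in 𝓝 p, (z * g) x = (0 : Fun E X) x := by
    filter_upwards [hg] with x hx
    change z x * g x = 0
    by_cases hxY : x ∈ Y
    · rw [h.mem x hxY, zero_mul]
    · rw [hx hxY, mul_zero]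
  have h2 := derivation_congr T h1
  rw [map_zero, derivation_mul_apply, h.one.self_of_nhds, h.mem p hp, zero_mul, zero_add,
    mul_one] at h2
  exact h2

/-- The extension of a linear formula for a derivative. -/
theorem IsDefiningAt.deriv_eq {p : X} (hp : p ∈ Y) {z : Fun E X} {T : VF E X}
    (h : IsDefiningAt Y p z T) {g a : Fun E X} (hg : ∀ᶠ x in 𝓝 p, g x = a x * z x)
    (D : VF E X) : D g p = a p * D z p := by
  rw [derivation_congr D (g := a * z) hg, derivation_mul_apply, h.mem p hp, zero_mul, add_zero]

theorem IsHypersurface.ext_off (hY : IsHypersurface E Y) {f g : Fun E X}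
    (h : ∀ x, x ∉ Y → f x = g x) : f = g := by
  ext x
  by_cases hx : x ∈ Y
  · obtain ⟨z, T, hz⟩ := hY.exists_defining x hx
    have := hz.eq_zero hx (g := f - g) (Eventually.of_forall fun y hy => sub_eq_zero.2 (h y hy))
    exact sub_eq_zero.1 this
  · exact h x hx

variable [SecondCountableTopology X]

/-- A partition of unity, with defining functions. -/
theorem IsHypersurface.exists_partition (hY : IsHypersurface E Y) :
    ∃ (ρ : SmoothPartitionOfUnity X 𝓘(ℝ, E) X) (z : X → Fun E X) (T : X → VF E X),
      (∀ i, z i ∈ vanishingIdeal (E := E) Y ∨ (T i = 0 ∧ ∀ x ∈ tsupport (ρ i), x ∉ Y)) ∧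
      (∀ i, ∀ x ∈ tsupport (ρ i), x ∈ Y → T i (z i) x = 1) ∧
      ∀ i, ∀ x ∈ tsupport (ρ i), z i x = 0 → x ∈ Y := by
  have hex : ∀ i : X, ∃ (z : Fun E X) (T : VF E X) (U : Set X), IsOpen U ∧ i ∈ U ∧
      (z ∈ vanishingIdeal (E := E) Y ∨ (T = 0 ∧ ∀ x ∈ U, x ∉ Y)) ∧
      (∀ x ∈ U, x ∈ Y → T z x = 1) ∧ ∀ x ∈ U, z x = 0 → x ∈ Y := fun i => by
    by_cases hi : i ∈ Y
    · obtain ⟨z, T, h⟩ := hY.exists_defining i hi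
      obtain ⟨U, hU, hUo, hiU⟩ := _root_.mem_nhds_iff.1 (h.zero.and h.one)
      exact ⟨z, T, U, hUo, hiU, Or.inl h.mem, fun x hx _ => (hU hx).2, fun x hx => (hU hx).1⟩
    -- Away from Y the pair (1, 0) serves: the function has no zero, and the zero vector field keeps
    -- z T trivial.
    · refine ⟨1, 0, Yᶜ, hY.isClosed.isOpen_compl, hi, Or.inr ⟨rfl, fun x hx => hx⟩,
        fun x hx hx' => (hx hx').elim, fun x _ hx' => ?_⟩
      exact (one_ne_zero (α := ℝ) hx').elim
  choose z T U hU hi h1 h2 h3 using hex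
  have : LocallyCompactSpace X := ChartedSpace.locallyCompactSpace E X
  obtain ⟨ρ, hρ⟩ := SmoothPartitionOfUnity.exists_isSubordinate 𝓘(ℝ, E) isClosed_univ U hU
    (fun x _ => Set.mem_iUnion.2 ⟨x, hi x⟩)
  exact ⟨ρ, z, T, fun i => (h1 i).imp_right fun h => ⟨h.1, fun x hx => h.2 x (hρ i hx)⟩,
    fun i x hx => h2 i x (hρ i hx), fun i x hx => h3 i x (hρ i hx)⟩

/-- The neighbourhood does not depend on g, so that it serves for all functions at once when
derivations are summed. -/
theorem finsum_smul_eq_sum (ρ : SmoothPartitionOfUnity X 𝓘(ℝ, E) X) (p : X) :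
    ∀ᶠ x in 𝓝 p, ∀ g : X → X → ℝ, ∑ᶠ i, ρ i x • g i x = ∑ i ∈ ρ.fintsupport p, ρ i x * g i x := by
  filter_upwards [ρ.eventually_finsupport_subset p] with x hx g
  refine finsum_eq_sum_of_support_subset _ fun i hi => hx ?_
  rw [ρ.mem_finsupport]
  intro h0
  exact hi (by change ρ i x • g i x = 0; rw [show ρ i x = 0 from h0, zero_smul])

theorem sum_fintsupport_eq_one (ρ : SmoothPartitionOfUnity X 𝓘(ℝ, E) X) (p : X) :
    ∑ i ∈ ρ.fintsupport p, ρ i p = 1 :=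
  ρ.sum_finsupport' p (Set.mem_univ p) (ρ.finsupport_subset_fintsupport p)

/-- A function that behaves like the square of a defining function. -/
theorem IsHypersurface.exists_square (hY : IsHypersurface E Y) :
    ∃ h : Fun E X, (∀ x, x ∉ Y → h x ≠ 0) ∧ ∀ p ∈ Y, ∀ (z : Fun E X) (T : VF E X), IsDefiningAt Y p z T →
      ∃ u : Fun E X, u p ≠ 0 ∧ ∀ᶠ x in 𝓝 p, h x = u x * (z x * z x) := by
  obtain ⟨ρ, z, T, h1, h2, h3⟩ := hY.exists_partition
  -- Squares make all summands nonnegative, so local defining functions with incompatible signs do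
  -- not cancel.
  refine ⟨⟨fun x => ∑ᶠ i, ρ i x • (z i * z i) x,
    ρ.contMDiff_finsum_smul fun i x _ => (z i * z i).contMDiff.contMDiffAt⟩, ?_, ?_⟩
  · intro x hx
    change ∑ᶠ i, ρ i x • (z i * z i) x ≠ 0
    rw [(finsum_smul_eq_sum ρ x).self_of_nhds fun i x => (z i * z i) x]
    obtain ⟨i, hi⟩ := ρ.exists_pos_of_mem (Set.mem_univ x)
    refine ne_of_gt (Finset.sum_pos' (fun j _ => mul_nonneg (ρ.nonneg j x) (mul_self_nonneg _))
      ⟨i, ?_, mul_pos hi (mul_self_pos.2 fun h0 => ?_)⟩)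
    · rw [ρ.mem_fintsupport_iff]
      exact subset_tsupport _ hi.ne'
    · exact hx (h3 i x (subset_tsupport _ hi.ne') h0)
  · intro p hp w S hw
    have hex : ∀ i, ∃ a : Fun E X, (∀ᶠ x in 𝓝 p, ρ i x * (z i * z i) x =
        ρ i x * (a x * a x) * (w x * w x)) ∧ (p ∈ tsupport (ρ i) → a p ≠ 0) := fun i => by
      by_cases hpi : p ∈ tsupport (ρ i)
      · have hz : z i ∈ vanishingIdeal (E := E) Y := (h1 i).resolve_right fun h => h.2 p hpi hp
        obtain ⟨a, ha⟩ := hw.quot _ hz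
        refine ⟨a, ?_, fun _ h0 => ?_⟩
        · filter_upwards [ha] with x hx
          change ρ i x * (z i x * z i x) = _
          rw [hx]; ring
        · have := h2 i p hpi hp
          rw [hw.deriv_eq hp ha, h0, zero_mul] at this
          exact zero_ne_one this
      · refine ⟨0, ?_, fun h => (hpi h).elim⟩
        filter_upwards [(isClosed_tsupport (ρ i)).isOpen_compl.mem_nhds hpi] with x hx
        rw [image_eq_zero_of_notMem_tsupport hx]; ring
    choose a ha ha' using hex
    refine ⟨∑ i ∈ ρ.fintsupport p, (ρ i : Fun E X) * (a i * a i), ?_, ?_⟩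
    · rw [sum_apply]
      change ∑ i ∈ ρ.fintsupport p, ρ i p * (a i p * a i p) ≠ 0
      obtain ⟨i, hi⟩ := ρ.exists_pos_of_mem (Set.mem_univ p)
      have hi' : p ∈ tsupport (ρ i) := subset_tsupport _ hi.ne'
      exact ne_of_gt (Finset.sum_pos' (fun j _ => mul_nonneg (ρ.nonneg j p) (mul_self_nonneg _))
        ⟨i, (ρ.mem_fintsupport_iff p i).2 hi', mul_pos hi (mul_self_pos.2 (ha' i hi'))⟩)
    · filter_upwards [finsum_smul_eq_sum ρ p, (ρ.fintsupport p).eventually_all.2 fun i _ => ha i]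
        with x hx hx'
      change ∑ᶠ i, ρ i x • (z i * z i) x = _
      rw [hx fun i x => (z i * z i) x, sum_apply, Finset.sum_mul]
      exact Finset.sum_congr rfl fun i hi => hx' i hi

/-- There is a global Euler vector field. -/
theorem IsHypersurface.exists_euler (hY : IsHypersurface E Y) :
    ∃ e : logTangent E Y, IsEuler Y (e : VF E X) := by
  obtain ⟨ρ, z, T, h1, h2, -⟩ := hY.exists_partition
  -- The Euler field is the sum of the fields ρ_i z_i T_i. Its linearization along Y is a convex
  -- combination of identities.
  have hloc : ∀ p, ∀ᶠ x in 𝓝 p, ∀ f : Fun E X, ∑ᶠ i, ρ i x • (z i • T i) f x =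
      (∑ i ∈ ρ.fintsupport p, (ρ i : Fun E X) • (z i • T i)) f x := fun p => by
    filter_upwards [finsum_smul_eq_sum ρ p] with x hx f
    rw [hx fun i x => (z i • T i) f x, derivation_sum_smul_apply]
  obtain ⟨e, he⟩ := exists_glue (fun f x => ∑ᶠ i, ρ i x • (z i • T i) f x)
    fun p => ⟨_, hloc p⟩
  have h0 : ∀ i, ∀ f : Fun E X, ∀ p ∈ Y, (z i • T i) f p = 0 := fun i f p hp => by
    change z i p * T i f p = 0
    rcases h1 i with h | h
    · rw [h p hp, zero_mul]
    · rw [h.1]; exact mul_zero _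
  have h4 : ∀ f : Fun E X, e f ∈ vanishingIdeal Y := fun f p hp => by
    rw [he]
    simp only [h0 _ f p hp, smul_zero, finsum_zero]
  refine ⟨⟨e, fun f _ => h4 f⟩, h4, fun g hg D p hp => ?_⟩
  obtain ⟨w, S, hw⟩ := hY.exists_defining p hp
  have h5 : D (e g) p = ∑ i ∈ ρ.fintsupport p, ρ i p * D (z i * T i g) p := by
    have h6 : ∀ᶠ x in 𝓝 p, e g x =
        (∑ i ∈ ρ.fintsupport p, (ρ i : Fun E X) * (z i * T i g)) x := by
      filter_upwards [hloc p] with x hx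
      rw [he, hx, derivation_sum_smul_apply, sum_apply]; rfl
    rw [derivation_congr D h6, derivation_sum_apply]
    refine Finset.sum_congr rfl fun i _ => ?_
    rw [derivation_mul_apply]
    have : (z i * T i g) p = 0 := h0 i g p hp
    rw [this, zero_mul, add_zero]
  -- With g = b w and z_i = c w near p, both sides are multiples of D w, and the normalization
  -- T_i(z_i) = 1 at p makes them equal.
  have h7 : ∀ i ∈ ρ.fintsupport p, ρ i p * D (z i * T i g) p = ρ i p * D g p := fun i hi => by
    have hpi := (ρ.mem_fintsupport_iff p i).1 hi
    have hz : z i ∈ vanishingIdeal (E := E) Y := (h1 i).resolve_right fun h => h.2 p hpi hp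
    obtain ⟨b, hb⟩ := hw.quot _ hg
    obtain ⟨c, hc⟩ := hw.quot _ hz
    have h8 := h2 i p hpi hp
    rw [hw.deriv_eq hp hc] at h8
    rw [derivation_mul_apply, hz p hp, zero_mul, zero_add, hw.deriv_eq hp hb, hw.deriv_eq hp hb,
      hw.deriv_eq hp hc]
    linear_combination (ρ i p * b p * D w p) * h8
  rw [map_sub]
  change D (e g) p - D g p = 0
  rw [h5, Finset.sum_congr rfl h7, ← Finset.sum_mul, sum_fintsupport_eq_one, one_mul, sub_self]

end Hypersurface

/-! ### The closed log one-form θ -/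

section Hypersurface

open scoped Topology
open Filter

variable {E : Type*} [NormedAddCommGroup E] [NormedSpace ℝ E] [FiniteDimensional ℝ E]
  {X : Type*} [TopologicalSpace X] [ChartedSpace E X] [IsManifold 𝓘(ℝ, E) ∞ X] [T2Space X]
  {Y : Set X}

/-- A closed log one-form `θ` whose residue along the hypersurface is one. -/
structure IsLogDifferential (Y : Set X) (θ : logTangent E Y →ₗ[Fun E X] Fun E X) : Prop where
  closed : ∀ D D' : logTangent E Y, θ ⁅D, D'⁆ = (D : VF E X) (θ D') - (D' : VF E X) (θ D)
  null : ∀ D : logTangent E Y, ∀ p ∈ Y, (∀ f, (D : VF E X) f p = 0) → θ D p = 0 →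
    NullAt (evalAt (E := E) p) D
  euler : ∀ e : logTangent E Y, IsEuler Y (e : VF E X) → ∀ p ∈ Y, θ e p = 1

theorem exists_quotient_germ {f g : Fun E X} {p : X} (hg : g p ≠ 0) :
    ∃ q : Fun E X, ∀ᶠ x in 𝓝 p, q x = f x / g x :=
  exists_extension <| by
    filter_upwards [g.contMDiff.continuous.continuousAt.eventually_ne hg] with x hx
    exact f.contMDiff.contMDiffAt.div₀ g.contMDiff.contMDiffAt hx

variable [SecondCountableTopology X]

/-- Near Y one has D z = a z, hence D h = (2a + D u / u) h; off Y one divides by h. The condition on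
g is affine, so local solutions are combined by a partition of unity. -/
theorem IsHypersurface.exists_dlog (hY : IsHypersurface E Y) {h : Fun E X}
    (h0 : ∀ x, x ∉ Y → h x ≠ 0) (h1 : ∀ p ∈ Y, ∀ (z : Fun E X) (T : VF E X),
      IsDefiningAt Y p z T → ∃ u : Fun E X, u p ≠ 0 ∧ ∀ᶠ x in 𝓝 p, h x = u x * (z x * z x))
    (D : logTangent E Y) : ∃ g : Fun E X, (D : VF E X) h = g * h := by
  have : LocallyCompactSpace X := ChartedSpace.locallyCompactSpace E X
  have key : ∃ g : C^∞⟮𝓘(ℝ, E), X; 𝓘(ℝ, ℝ), ℝ⟯,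
      ∀ x, g x ∈ {r : ℝ | (D : VF E X) h x = r * h x} := by
    refine exists_contMDiffMap_forall_mem_convex_of_local 𝓘(ℝ, E) (fun x r hr r' hr' a b _ _ hab => ?_)
      fun p => ?_
    · change _ = r * _ at hr
      change _ = r' * _ at hr'
      change _ = (a * r + b * r') * _
      rw [add_mul, mul_assoc, mul_assoc, ← hr, ← hr', ← add_mul, hab, one_mul]
    · have : ∃ g : Fun E X, ∀ᶠ x in 𝓝 p, (D : VF E X) h x = g x * h x := by
        by_cases hp : p ∈ Y
        · obtain ⟨z, T, hz⟩ := hY.exists_defining p hp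
          obtain ⟨u, hu, hu'⟩ := h1 p hp z T hz
          obtain ⟨a, ha⟩ := hz.quot _ (D.2 z hz.mem)
          obtain ⟨q, hq⟩ := exists_quotient_germ (f := (D : VF E X) u) hu
          refine ⟨a + a + q, ?_⟩
          have h2 : ∀ᶠ x in 𝓝 p, h x = (u * (z * z)) x := hu'
          filter_upwards [derivation_congr_eventually (D : VF E X) h2, hu', ha, hq,
            u.contMDiff.continuous.continuousAt.eventually_ne hu] with x k1 k2 k3 k4 k5
          rw [k1, derivation_mul_apply, derivation_mul_apply, k3, k2]
          change u x * _ + z x * z x * _ = (a x + a x + q x) * _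
          rw [k4]
          field_simp
        · obtain ⟨q, hq⟩ := exists_quotient_germ (f := (D : VF E X) h) (h0 p hp)
          refine ⟨q, ?_⟩
          filter_upwards [hq, h.contMDiff.continuous.continuousAt.eventually_ne (h0 p hp)]
            with x k1 k2
          rw [k1, div_mul_cancel₀ _ k2]
      obtain ⟨g, hg⟩ := this
      exact ⟨_, hg, g, g.contMDiff.contMDiffOn, fun x hx => hx⟩
  obtain ⟨g, hg⟩ := key
  exact ⟨g, by ext x; exact hg x⟩

/-- Take θ = ½ d log h; the half compensates the double zero of h. As h is invertible off Y, which
is dense, identities may be checked after multiplication by h, and this yields linearity and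
closedness. -/
theorem IsHypersurface.exists_logDifferential (hY : IsHypersurface E Y) :
    ∃ θ : logTangent E Y →ₗ[Fun E X] Fun E X, IsLogDifferential Y θ := by
  obtain ⟨h, h0, h1⟩ := hY.exists_square
  have hcancel : ∀ {f g : Fun E X}, f * h = g * h → f = g := fun {f g} hfg =>
    hY.ext_off fun x hx => by
      have : f x * h x = g x * h x := congrArg (fun k : Fun E X => k x) hfg
      exact mul_right_cancel₀ (h0 x hx) this
  choose g hg using hY.exists_dlog h0 h1
  let θ : logTangent E Y →ₗ[Fun E X] Fun E X :=
    { toFun := fun D => ((2 : ℝ)⁻¹) • g D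
      map_add' := fun D D' => by
        have : g (D + D') = g D + g D' := hcancel (by
          rw [← hg, add_mul, ← hg, ← hg]; rfl)
        rw [this, smul_add]
      map_smul' := fun a D => by
        have : g (a • D) = a * g D := hcancel (by
          rw [← hg, mul_assoc, ← hg]; rfl)
        rw [this, RingHom.id_apply, smul_eq_mul, mul_smul_comm] }
  have hθ : ∀ D, g D = (2 : ℝ) • θ D := fun D => by
    change _ = (2 : ℝ) • ((2 : ℝ)⁻¹) • g D
    rw [smul_smul, mul_inv_cancel₀ (by norm_num), one_smul]
  have hlocal : ∀ D : logTangent E Y, ∀ p ∈ Y, (∀ f, (D : VF E X) f p = 0) →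
      ∀ (z : Fun E X) (T : VF E X), IsDefiningAt Y p z T → ∀ a : Fun E X,
      (∀ᶠ x in 𝓝 p, (D : VF E X) z x = a x * z x) → θ D p = a p := by
    intro D p hp hD z T hz a ha
    obtain ⟨u, hu, hu'⟩ := h1 p hp z T hz
    have h2 : ∀ᶠ x in 𝓝 p, h x = (u * (z * z)) x := hu'
    -- Applying D to h = u z² and cancelling z² gives this identity off Y; density extends it to p,
    -- where D u = 0 leaves g(D) = 2a.
    have h3 : ((D : VF E X) u + (a + a - g D) * u) p = 0 := by
      refine hz.eq_zero hp ?_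
      filter_upwards [derivation_congr_eventually (D : VF E X) h2, hu', ha] with x k1 k2 k3 hx
      have k4 : (D : VF E X) h x = g D x * h x := congrArg (fun k : Fun E X => k x) (hg D)
      rw [k1, k2, derivation_mul_apply, derivation_mul_apply, k3] at k4
      have k5 : z x ≠ 0 := fun hzx => h0 x hx (by rw [k2, hzx]; ring)
      change (D : VF E X) u x + (a x + a x - g D x) * u x = 0
      change u x * _ + z x * z x * _ = _ at k4
      have k6 : z x * z x * ((D : VF E X) u x + (a x + a x - g D x) * u x) = 0 := by
        linear_combination k4
      exact (mul_eq_zero.1 k6).resolve_left (mul_ne_zero k5 k5)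
    change (D : VF E X) u p + (a p + a p - g D p) * u p = 0 at h3
    rw [hD, zero_add] at h3
    have h4 := (mul_eq_zero.1 h3).resolve_right hu
    change (2 : ℝ)⁻¹ * g D p = a p
    linarith
  refine ⟨θ, fun D D' => ?_, fun D p hp hD hθD => ?_, fun e he p hp => ?_⟩
  · have h2 : g ⁅D, D'⁆ = (D : VF E X) (g D') - (D' : VF E X) (g D) := hcancel (by
      rw [← hg, sub_mul]
      have e1 : ((⁅D, D'⁆ : logTangent E Y) : VF E X) h =
          (D : VF E X) ((D' : VF E X) h) - (D' : VF E X) ((D : VF E X) h) :=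
        Derivation.commutator_apply h
      rw [e1, hg D, hg D', Derivation.leibniz, Derivation.leibniz, hg D, hg D']
      simp only [smul_eq_mul]
      ring)
    change (2 : ℝ)⁻¹ • g ⁅D, D'⁆ = (D : VF E X) ((2 : ℝ)⁻¹ • g D') - (D' : VF E X) ((2 : ℝ)⁻¹ • g D)
    rw [h2, smul_sub, Derivation.map_smul, Derivation.map_smul]
  · obtain ⟨z, T, hz⟩ := hY.exists_defining p hp
    obtain ⟨a, ha⟩ := hz.quot _ (D.2 z hz.mem)
    have h2 : a p = 0 := by rw [← hlocal D p hp hD z T hz a ha, hθD]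
    have h3 := hz.null D a ha hD
    have h4 := h3.add (nullAt_smul_of_eq_zero (p := evalAt (E := E) p) (a := a) h2
      (⟨z • T, smul_mem_log hz.mem T⟩ : logTangent E Y))
    rwa [sub_add_cancel] at h4
  · obtain ⟨z, T, hz⟩ := hY.exists_defining p hp
    obtain ⟨a, ha⟩ := hz.quot _ (e.2 z hz.mem)
    rw [hlocal e p hp (fun f => he.1 f p hp) z T hz a ha]
    have h2 := he.2 z hz.mem T p hp
    have h3 : ∀ᶠ x in 𝓝 p, ((e : VF E X) z - z) x = (a - 1 : Fun E X) x * z x := by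
      filter_upwards [ha] with x hx
      change (e : VF E X) z x - z x = (a x - 1) * z x
      rw [hx]; ring
    rw [hz.deriv_eq hp h3, hz.one.self_of_nhds, mul_one] at h2
    exact sub_eq_zero.1 h2

end Hypersurface

/-! ### Changing the arguments of a form -/

section Multilinear

variable {R M : Type*} [CommRing R] [AddCommGroup M] [Module R M] [Algebra ℝ R] {p : R →ₐ[ℝ] ℝ}

/-- Arguments of a form may be changed one by one, if each change is in the kernel of the form. -/
theorem apply_eq_of_update {k : ℕ} (η : M [⋀^Fin k]→ₗ[R] R) {W W' : Fin k → M}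
    (h : ∀ i U, p (η (Function.update U i (W i - W' i))) = 0) : p (η W) = p (η W') := by
  have key : ∀ s : Finset (Fin k), p (η (s.piecewise W' W)) = p (η W) := by
    intro s
    induction s using Finset.induction with
    | empty => simp
    | insert i s hi ih =>
      rw [← ih, Finset.piecewise_insert]
      have h1 : s.piecewise W' W = Function.update (s.piecewise W' W) i (W i) := by
        rw [eq_comm, Function.update_eq_self_iff, Finset.piecewise_eq_of_notMem _ _ _ hi]
      conv_rhs => rw [h1]
      have := h i (s.piecewise W' W)
      rw [η.map_update_sub, map_sub, sub_eq_zero] at this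
      exact this.symm
  rw [← key Finset.univ, Finset.piecewise_univ]

end Multilinear

section Instances

variable {E : Type*} [NormedAddCommGroup E] [NormedSpace ℝ E]
  {X : Type*} [TopologicalSpace X] [ChartedSpace E X]

/-- The module of log vector fields, as a shortcut for instance search. -/
abbrev logModule (Y : Set X) : Module (Fun E X) (logTangent E Y) := inferInstance

/-- The scalar multiplication of log vector fields, as a shortcut for instance search. -/
abbrev logSMul (Y : Set X) : SMul (Fun E X) (logTangent E Y) := (logModule Y).toSMul

end Instances

/-! ### Splitting the log-tangent bundle along Z; residues -/

section Descent

open scoped Topology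
open Filter

attribute [local instance] logModule logSMul

variable {E : Type*} [NormedAddCommGroup E] [NormedSpace ℝ E] [FiniteDimensional ℝ E]
  {X : Type*} [TopologicalSpace X] [ChartedSpace E X] [IsManifold 𝓘(ℝ, E) ∞ X] [T2Space X]
  {F : Type*} [NormedAddCommGroup F] [NormedSpace ℝ F] [FiniteDimensional ℝ F]
  {Z : Type*} [TopologicalSpace Z] [ChartedSpace F Z] [IsManifold 𝓘(ℝ, F) ∞ Z] [T2Space Z]
  {ι : C^∞⟮𝓘(ℝ, F), Z; 𝓘(ℝ, E), X⟯}
  {θ : logTangent E (Set.range ι) →ₗ[Fun E X] Fun E X}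

/-- The bracket differentiates, so the fields must be related at all nearby points of Z for their
brackets to be related at y. -/
theorem RelAt.lie {y : Z} {W W' : logTangent E (Set.range ι)} {V V' : VF F Z}
    (h : ∀ᶠ z in 𝓝 y, RelAt ι z (W : VF E X) V) (h' : ∀ᶠ z in 𝓝 y, RelAt ι z (W' : VF E X) V') :
    RelAt ι y ((⁅W, W'⁆ : logTangent E (Set.range ι)) : VF E X) ⁅V, V'⁆ := by
  intro f
  have e1 : ((⁅W, W'⁆ : logTangent E (Set.range ι)) : VF E X) f =
      (W : VF E X) ((W' : VF E X) f) - (W' : VF E X) ((W : VF E X) f) :=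
    Derivation.commutator_apply f
  rw [e1, Derivation.commutator_apply]
  change (W : VF E X) ((W' : VF E X) f) (ι y) - (W' : VF E X) ((W : VF E X) f) (ι y) =
    V (V' (f.comp ι)) y - V' (V (f.comp ι)) y
  rw [h.self_of_nhds, h'.self_of_nhds, derivation_congr V (g := V' (f.comp ι)),
    derivation_congr V' (g := V (f.comp ι))]
  · filter_upwards [h] with z hz using hz f
  · filter_upwards [h'] with z hz using hz f

/-- The splitting of the log-tangent bundle along the hypersurface, given by a closed log one-form
`θ` and an Euler vector field, with the lifts of vector fields. -/
structure IsSplitting (ι : C^∞⟮𝓘(ℝ, F), Z; 𝓘(ℝ, E), X⟯)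
    (θ : logTangent E (Set.range ι) →ₗ[Fun E X] Fun E X)
    (e : logTangent E (Set.range ι)) : Prop where
  log : IsLogDifferential (Set.range ι) θ
  euler : IsEuler (Set.range ι) (e : VF E X)
  lift : ∀ (V : VF F Z) (y : Z), ∃ (W : logTangent E (Set.range ι)) (V' : VF F Z),
    Related ι (W : VF E X) V' ∧ (∀ z, θ W (ι z) = 0) ∧ ∀ᶠ z in 𝓝 y, ∀ f, V' f z = V f z
  restrict : ∀ (D : logTangent E (Set.range ι)) (y : Z),
    ∃ V : VF F Z, ∀ᶠ z in 𝓝 y, RelAt ι z (D : VF E X) V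
  extend : ∀ (g : Fun F Z) (y : Z), ∃ f : Fun E X, ∀ᶠ z in 𝓝 y, f (ι z) = g z

/-- The form `ξ` on the hypersurface corresponds to the log form `η` with respect to the splitting
defined by `θ`. -/
def IsDesc (θ : logTangent E (Set.range ι) →ₗ[Fun E X] Fun E X) {k : ℕ}
    (η : Form (Fun E X) (logTangent E (Set.range ι)) k) (ξ : Form (Fun F Z) (VF F Z) k) : Prop :=
  ∀ (y : Z) (W : Fin k → logTangent E (Set.range ι)) (V : Fin k → VF F Z),
    (∀ i, RelAt ι y (W i : VF E X) (V i)) → (∀ i, θ (W i) (ι y) = 0) → η W (ι y) = ξ V y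

variable {e : logTangent E (Set.range ι)}

theorem exists_isSplitting [SecondCountableTopology X]
    (hι : Manifold.IsSmoothEmbedding 𝓘(ℝ, F) 𝓘(ℝ, E) ∞ ι)
    (hdim : Module.finrank ℝ F + 1 = Module.finrank ℝ E) (hcl : IsClosed (Set.range ι)) :
    ∃ (θ : logTangent E (Set.range ι) →ₗ[Fun E X] Fun E X) (e : logTangent E (Set.range ι)),
      IsSplitting ι θ e := by
  have hs := fun y => (exists_sliceChart hι hdim y).some
  have hY : IsHypersurface E (Set.range ι) := ⟨hcl, by
    rintro _ ⟨y, rfl⟩; exact (hs y).exists_isDefiningAt⟩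
  obtain ⟨θ, hθ⟩ := hY.exists_logDifferential
  obtain ⟨e, he⟩ := hY.exists_euler
  refine ⟨θ, e, hθ, he, fun V y => ?_, fun D y => (hs y).exists_restrict D,
    fun g y => (hs y).exists_function_extension g⟩
  obtain ⟨W, V', h1, h2⟩ := (hs y).exists_lift V
  -- Subtracting the Euler component normalizes θ; since e vanishes along Z as a vector field, the
  -- restriction to Z is unchanged.
  refine ⟨W - θ W • e, V', fun f z => ?_, fun z => ?_, h2⟩
  · change (W : VF E X) f (ι z) - θ W (ι z) * (e : VF E X) f (ι z) = _
    rw [he.1 f _ ⟨z, rfl⟩, mul_zero, sub_zero, h1]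
  · rw [map_sub, map_smul]
    change θ W (ι z) - θ W (ι z) * θ e (ι z) = 0
    rw [hθ.euler e he _ ⟨z, rfl⟩, mul_one, sub_self]

namespace IsSplitting

variable (h : IsSplitting ι θ e)

include h

/-- In the fibre over a point of Z a log vector field is determined by its restriction to Z and its
value under θ. -/
theorem nullAt {y : Z} {W W' : logTangent E (Set.range ι)} {V : VF F Z}
    (hW : RelAt ι y (W : VF E X) V) (hW' : RelAt ι y (W' : VF E X) V)
    (hθ : θ W (ι y) = θ W' (ι y)) : NullAt (evalAt (E := E) (ι y)) (W - W') := by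
  refine h.log.null _ _ ⟨y, rfl⟩ (fun f => ?_) ?_
  · change (W : VF E X) f (ι y) - (W' : VF E X) f (ι y) = 0
    rw [hW, hW', sub_self]
  · rw [map_sub]
    exact sub_eq_zero.2 hθ

theorem exists_lift_at (V : VF F Z) (y : Z) : ∃ W : logTangent E (Set.range ι),
    (∀ᶠ z in 𝓝 y, RelAt ι z (W : VF E X) V) ∧ ∀ z, θ W (ι z) = 0 := by
  obtain ⟨W, V', h1, h2, h3⟩ := h.lift V y
  refine ⟨W, ?_, h2⟩
  filter_upwards [h3] with z hz f
  rw [h1 f z, hz]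

/-- Evaluate η on lifts in the kernel of θ. The value at a point does not depend on the lift, so
smoothness and multilinearity can be checked with convenient lifts near each point. -/
theorem exists_desc {k : ℕ} (η : Form (Fun E X) (logTangent E (Set.range ι)) k) :
    ∃ ξ : Form (Fun F Z) (VF F Z) k, IsDesc θ η ξ := by
  choose L hL hL0 using h.exists_lift_at
  have hwd : ∀ (y : Z) (W W' : Fin k → logTangent E (Set.range ι)) (V : Fin k → VF F Z),
      (∀ i, RelAt ι y (W i : VF E X) (V i)) → (∀ i, θ (W i) (ι y) = 0) →
      (∀ i, RelAt ι y (W' i : VF E X) (V i)) → (∀ i, θ (W' i) (ι y) = 0) →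
      η W (ι y) = η W' (ι y) := fun y W W' V h1 h2 h3 h4 =>
    apply_eq_of_nullAt (p := evalAt (E := E) (ι y)) η fun i =>
      h.nullAt (h1 i) (h3 i) (by rw [h2, h4])
  have hLy : ∀ V y, RelAt ι y (L V y : VF E X) V := fun V y => (hL V y).self_of_nhds
  let T : (Fin k → VF F Z) → Z → ℝ := fun V y => η (fun i => L (V i) y) (ι y)
  have hT : ∀ y W V, (∀ i, RelAt ι y (W i : VF E X) (V i)) → (∀ i, θ (W i) (ι y) = 0) →
      η W (ι y) = T V y := fun y W V h1 h2 =>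
    hwd y W _ V h1 h2 (fun i => hLy _ y) fun i => hL0 _ y y
  have hsm : ∀ V, ContMDiff 𝓘(ℝ, F) 𝓘(ℝ, ℝ) ∞ (T V) := fun V y => by
    have h1 : T V =ᶠ[𝓝 y] (η fun i => L (V i) y).comp ι := by
      filter_upwards [eventually_all.2 fun i => hL (V i) y] with z hz
      exact (hT z (fun i => L (V i) y) V hz fun i => hL0 _ y z).symm
    exact ((η fun i => L (V i) y).comp ι).contMDiff.contMDiffAt.congr_of_eventuallyEq h1
  have hupd : ∀ (y : Z) (V : Fin k → VF F Z) (i : Fin k) (U : logTangent E (Set.range ι))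
      (x : VF F Z), RelAt ι y (U : VF E X) x → θ U (ι y) = 0 →
      T (Function.update V i x) y = η (Function.update (fun i => L (V i) y) i U) (ι y) := by
    intro y V i U x h1 h2
    refine (hT y _ _ (fun j => ?_) fun j => ?_).symm
    · rcases eq_or_ne j i with rfl | hj
      · simpa using h1
      · simpa [hj] using hLy (V j) y
    · rcases eq_or_ne j i with rfl | hj
      · simpa using h2
      · simpa [hj] using hL0 (V j) y y
  refine ⟨{
    toFun := fun V => ⟨T V, hsm V⟩
    map_update_add' := fun {inst} V i x x' => ?_
    map_update_smul' := fun {inst} V i c x => ?_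
    map_eq_zero_of_eq' := fun V i j hij hne => ?_ }, hT⟩
  · obtain rfl := Subsingleton.elim inst (instDecidableEqFin k)
    ext y
    change T _ y = T _ y + T _ y
    rw [hupd y V i (L x y) x (hLy x y) (hL0 x y y), hupd y V i (L x' y) x' (hLy x' y) (hL0 x' y y),
      hupd y V i (L x y + L x' y), η.map_update_add]
    · rfl
    · intro f
      change (L x y : VF E X) f (ι y) + (L x' y : VF E X) f (ι y) = _
      rw [hLy, hLy]; rfl
    · rw [map_add]
      change θ _ (ι y) + θ _ (ι y) = 0
      rw [hL0, hL0, add_zero]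
  · obtain rfl := Subsingleton.elim inst (instDecidableEqFin k)
    ext y
    change T _ y = c y * T _ y
    obtain ⟨c', hc⟩ := h.extend c y
    rw [hupd y V i (L x y) x (hLy x y) (hL0 x y y), hupd y V i (c' • L x y), η.map_update_smul]
    · change c' (ι y) * _ = _
      rw [hc.self_of_nhds]
    · intro f
      change c' (ι y) * (L x y : VF E X) f (ι y) = c y * _
      rw [hLy, hc.self_of_nhds]
      rfl
    · rw [map_smul]
      change c' (ι y) * θ _ (ι y) = 0
      rw [hL0, mul_zero]
  · ext y
    change η _ (ι y) = 0
    rw [η.map_eq_zero_of_eq _ (congrArg (fun V => L V y) hij) hne]; rfl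

/-- All Euler fields agree in the fibres along Z, and after contraction with e the arguments may be
changed by multiples of e, hence moved into the kernel of θ. So the form obtained is the residue,
which makes no reference to θ. -/
theorem isResidue {k : ℕ} {η : Form (Fun E X) (logTangent E (Set.range ι)) (k + 1)}
    {ξ : Form (Fun F Z) (VF F Z) k} (hξ : IsDesc θ (η.curryLeft e) ξ) : IsResidue ι η ξ := by
  intro e' he' W V hWV y
  have h1 : η (Matrix.vecCons e' W) (ι y) = η (Matrix.vecCons e W) (ι y) := by
    refine apply_eq_of_nullAt (p := evalAt (E := E) (ι y)) η fun i => ?_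
    refine Fin.cases ?_ (fun i => ?_) i
    · refine h.log.null _ _ ⟨y, rfl⟩ (fun f => ?_) ?_
      · change (e' : VF E X) f (ι y) - (e : VF E X) f (ι y) = 0
        rw [he'.1 f _ ⟨y, rfl⟩, h.euler.1 f _ ⟨y, rfl⟩, sub_self]
      · change θ (e' - e) (ι y) = 0
        rw [map_sub]
        change θ e' (ι y) - θ e (ι y) = 0
        rw [h.log.euler e' he' _ ⟨y, rfl⟩, h.log.euler e h.euler _ ⟨y, rfl⟩, sub_self]
    · intro l
      change evalAt (ι y) (l (W i - W i)) = 0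
      rw [sub_self, map_zero, map_zero]
  rw [h1]
  have h2 : (η.curryLeft e) W (ι y) = (η.curryLeft e) (fun i => W i - θ (W i) • e) (ι y) := by
    refine apply_eq_of_update (p := evalAt (E := E) (ι y)) (η.curryLeft e) fun i U => ?_
    have h3 : (η.curryLeft e) (Function.update U i e) = 0 := by
      refine η.map_eq_zero_of_eq _ (i := 0) (j := i.succ) ?_ (Fin.succ_ne_zero i).symm
      simp
    rw [sub_sub_cancel, (η.curryLeft e).map_update_smul, h3, smul_zero, map_zero]
  refine h2.trans (hξ y _ V (fun i f => ?_) fun i => ?_)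
  · change (W i : VF E X) f (ι y) - θ (W i) (ι y) * (e : VF E X) f (ι y) = _
    rw [h.euler.1 f _ ⟨y, rfl⟩, mul_zero, sub_zero, hWV]
  · rw [map_sub, map_smul]
    change θ (W i) (ι y) - θ (W i) (ι y) * θ e (ι y) = 0
    rw [h.log.euler e h.euler _ ⟨y, rfl⟩, mul_one, sub_self]

theorem isResidue_unique {k : ℕ} {η : Form (Fun E X) (logTangent E (Set.range ι)) (k + 1)}
    {ξ ξ' : Form (Fun F Z) (VF F Z) k} (hξ : IsResidue ι η ξ) (hξ' : IsResidue ι η ξ') :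
    ξ = ξ' := by
  ext V y
  choose W V' h1 h2 h3 using fun i => h.lift (V i) y
  have h4 : ∀ c : Form (Fun F Z) (VF F Z) k, c V y = c V' y := fun c =>
    apply_eq_of_nullAt (p := evalAt (E := F) y) c fun i =>
      nullAt_of_eq fun f => ((h3 i).self_of_nhds f).symm
  rw [h4 ξ, h4 ξ', ← hξ e h.euler W V' h1 y, ← hξ' e h.euler W V' h1 y]

theorem existsUnique_isResidue {k : ℕ} (η : Form (Fun E X) (logTangent E (Set.range ι)) (k + 1)) :
    ∃! ξ, IsResidue ι η ξ := by
  obtain ⟨ξ, hξ⟩ := h.exists_desc (η.curryLeft e)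
  exact ⟨ξ, h.isResidue hξ, fun ξ' hξ' => h.isResidue_unique hξ' (h.isResidue hξ)⟩

theorem residue_eq {k : ℕ} {η : Form (Fun E X) (logTangent E (Set.range ι)) (k + 1)}
    {ξ : Form (Fun F Z) (VF F Z) k} (hξ : IsDesc θ (η.curryLeft e) ξ) : residue ι η = ξ := by
  have hex : ∃ ξ, IsResidue ι η ξ := ⟨ξ, h.isResidue hξ⟩
  unfold residue
  rw [dif_pos hex]
  exact h.isResidue_unique hex.choose_spec (h.isResidue hξ)

/-- Closedness of θ: the kernel of θ along Z is stable under brackets, since θ vanishing along Z is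
differentiated only in directions tangent to Z. -/
theorem theta_lie {y : Z} {W W' : logTangent E (Set.range ι)} {V V' : VF F Z}
    (hW : RelAt ι y (W : VF E X) V) (hW' : RelAt ι y (W' : VF E X) V')
    (h0 : ∀ᶠ z in 𝓝 y, θ W (ι z) = 0) (h0' : ∀ᶠ z in 𝓝 y, θ W' (ι z) = 0) :
    θ ⁅W, W'⁆ (ι y) = 0 := by
  rw [h.log.closed]
  change (W : VF E X) (θ W') (ι y) - (W' : VF E X) (θ W) (ι y) = 0
  rw [hW, hW', derivation_congr V (g := 0) h0', derivation_congr V' (g := 0) h0, map_zero, map_zero]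
  exact sub_self _

/-- The differential commutes with the restriction of forms. -/
theorem extDer_desc {k : ℕ} {η : Form (Fun E X) (logTangent E (Set.range ι)) k}
    {ξ : Form (Fun F Z) (VF F Z) k} (hξ : IsDesc θ η ξ) {y : Z}
    {W : Fin (k + 1) → logTangent E (Set.range ι)} {V : Fin (k + 1) → VF F Z}
    (hWV : ∀ i, ∀ᶠ z in 𝓝 y, RelAt ι z (W i : VF E X) (V i))
    (h0 : ∀ i, ∀ᶠ z in 𝓝 y, θ (W i) (ι z) = 0) : extDer η W (ι y) = extDer ξ V y := by
  have key : ∀ (w : Fin k → logTangent E (Set.range ι)) (v : Fin k → VF F Z),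
      (∀ i, ∀ᶠ z in 𝓝 y, RelAt ι z (w i : VF E X) (v i)) →
      (∀ i, ∀ᶠ z in 𝓝 y, θ (w i) (ι z) = 0) → ∀ i,
      (W i : VF E X) (η w) (ι y) = V i (ξ v) y := fun w v h1 h2 i => by
    rw [(hWV i).self_of_nhds]
    refine derivation_congr (V i) ?_
    filter_upwards [eventually_all.2 h1, eventually_all.2 h2] with z k1 k2 using hξ z w v k1 k2
  cases k with
  | zero =>
    rw [extDer_zero_apply, extDer_zero_apply]
    exact key ![] ![] (fun i => i.elim0) (fun i => i.elim0) 0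
  | succ k =>
    rw [extDer_succ_apply, extDer_succ_apply]
    have hev : ∀ (a : Fun E X) (b : Fun F Z), evalAt (E := E) (ι y) a = evalAt (E := F) y b →
        a (ι y) = b y := fun _ _ hab => hab
    refine hev _ _ ?_
    rw [map_sub, map_sub, map_sum, map_sum, map_sum, map_sum]
    congr 1
    · refine Finset.sum_congr rfl fun i _ => ?_
      rw [map_mul, map_mul, map_pow, map_pow, map_neg, map_neg, map_one, map_one]
      congr 1
      exact key _ _ (fun j => hWV _) (fun j => h0 _) i
    · refine Finset.sum_congr rfl fun i _ => ?_
      rw [map_sum, map_sum]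
      refine Finset.sum_congr rfl fun j _ => ?_
      rw [map_mul, map_mul, map_pow, map_pow, map_neg, map_neg, map_one, map_one]
      congr 1
      refine hξ y _ _ (fun l => ?_) fun l => ?_
      · refine Fin.cases ?_ (fun l => ?_) l
        · exact RelAt.lie (hWV _) (hWV _)
        · exact (hWV _).self_of_nhds
      · refine Fin.cases ?_ (fun l => ?_) l
        · exact h.theta_lie (hWV _).self_of_nhds (hWV _).self_of_nhds (h0 _) (h0 _)
        · exact (h0 _).self_of_nhds

theorem formClosed_of {k : ℕ} {η : Form (Fun E X) (logTangent E (Set.range ι)) k}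
    {ξ : Form (Fun F Z) (VF F Z) k} (hξ : IsDesc θ η ξ)
    (hη : ∀ W y, extDer η W (ι y) = 0) : FormClosed ξ := by
  intro V
  ext y
  choose W h1 h2 using fun i => h.exists_lift_at (V i) y
  rw [← h.extDer_desc hξ h1 fun i => Eventually.of_forall (h2 i), hη]
  rfl

theorem formClosed_desc {k : ℕ} {η : Form (Fun E X) (logTangent E (Set.range ι)) k}
    (hη : FormClosed η) {ξ : Form (Fun F Z) (VF F Z) k} (hξ : IsDesc θ η ξ) : FormClosed ξ :=
  h.formClosed_of hξ fun W y => by rw [hη W]; rfl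

/-- The canonical section is invariant under log vector fields. As a vector field [e, W] vanishes on
Z because e does and W preserves the ideal of Z; and θ[e, W] = e(θ W) - W(θ e) vanishes there
because θ e - 1 lies in this ideal. -/
theorem nullAt_euler_lie (W : logTangent E (Set.range ι)) (y : Z) :
    NullAt (evalAt (E := E) (ι y)) ⁅e, W⁆ := by
  refine h.log.null _ _ ⟨y, rfl⟩ (fun f => ?_) ?_
  · have e1 : ((⁅e, W⁆ : logTangent E (Set.range ι)) : VF E X) f =
        (e : VF E X) ((W : VF E X) f) - (W : VF E X) ((e : VF E X) f) :=
      Derivation.commutator_apply f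
    rw [e1]
    change (e : VF E X) ((W : VF E X) f) (ι y) - (W : VF E X) ((e : VF E X) f) (ι y) = 0
    rw [h.euler.1 _ _ ⟨y, rfl⟩, W.2 _ (h.euler.1 f) _ ⟨y, rfl⟩, sub_self]
  · rw [h.log.closed]
    change (e : VF E X) (θ W) (ι y) - (W : VF E X) (θ e) (ι y) = 0
    have h1 : θ e - 1 ∈ vanishingIdeal (E := E) (Set.range ι) := fun p hp => by
      change θ e p - 1 = 0
      rw [h.log.euler e h.euler p hp, sub_self]
    have h2 := W.2 _ h1 _ ⟨y, rfl⟩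
    rw [map_sub, Derivation.map_one_eq_zero, sub_zero] at h2
    rw [h.euler.1 _ _ ⟨y, rfl⟩, h2, sub_self]

/-- For closed η Cartan's formula gives d(ι_e η) = L_e η, and L_e η vanishes along Z: e kills
functions there, and the brackets with e are zero in the fibres. -/
theorem formClosed_desc_curryLeft {k : ℕ}
    {η : Form (Fun E X) (logTangent E (Set.range ι)) (k + 1)}
    (hη : FormClosed η) {ξ : Form (Fun F Z) (VF F Z) k} (hξ : IsDesc θ (η.curryLeft e) ξ) :
    FormClosed ξ := by
  refine h.formClosed_of hξ fun W y => ?_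
  have h1 := hη (Matrix.vecCons e W)
  rw [extDer_vecCons, sub_eq_zero] at h1
  rw [← h1, lieForm_apply]
  change (e : VF E X) (η W) (ι y) - evalAt (E := E) (ι y) (∑ i, η (Function.update W i ⁅e, W i⁆)) = 0
  rw [h.euler.1 _ _ ⟨y, rfl⟩, zero_sub, neg_eq_zero, map_sum]
  exact Finset.sum_eq_zero fun i _ =>
    h.nullAt_euler_lie (W i) y (η.toMultilinearMap.toLinearMap W i)

theorem agreeOn {k : ℕ} {η : Form (Fun E X) (logTangent E (Set.range ι)) k}
    {ξ : Form (Fun F Z) (VF F Z) k} (hξ : IsDesc θ η ξ) {y : Z} {J : Type*}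
    {W : J → logTangent E (Set.range ι)} {V : J → VF F Z}
    (hWV : ∀ i, RelAt ι y (W i : VF E X) (V i)) (h0 : ∀ i, θ (W i) (ι y) = 0) :
    AgreeOn (evalAt (E := E) (ι y)) (evalAt (E := F) y) W V η ξ :=
  fun s => hξ y _ _ (fun i => hWV (s i)) fun i => h0 (s i)

/-- Contract e^b with e and compare both sides pointwise on lifts. In degree zero both vanish, since
e^b has no component of degree one. -/
theorem totalResidue_expForm {b : Form (Fun E X) (logTangent E (Set.range ι)) 2}
    {α : Form (Fun F Z) (VF F Z) 1} {β : Form (Fun F Z) (VF F Z) 2}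
    (hα : IsDesc θ (b.curryLeft e) α) (hβ : IsDesc θ b β) :
    totalResidue ι (expForm b) = spinor α β := by
  funext k
  refine h.residue_eq ?_
  cases k with
  | zero =>
    intro y W V _ _
    rw [expForm_odd (by decide)]
    rfl
  | succ k =>
    intro y W V h1 h2
    rw [curryLeft_expForm]
    exact ((h.agreeOn hβ h1 h2).expForm k).wedge (h.agreeOn hα h1 h2) id

end IsSplitting

end Descent

/-! ### Evaluating forms on frames -/

section Multilinear

variable {R M : Type*} [CommRing R] [AddCommGroup M] [Module R M] [Algebra ℝ R]

/-- Reconciles the order e^β ∧ α of the spinor with the order α ∧ β^m of the cosymplectic condition;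
β^m has even degree, so no sign remains. -/
theorem wedge_one_comm {k : ℕ} (c : M [⋀^Fin k]→ₗ[R] R) (ξ : M [⋀^Fin 1]→ₗ[R] R)
    (h : 1 + k = k + 1) : wedgeLin h ξ c = (-1 : ℤ) ^ k • wedgeLin (rfl : k + 1 = k + 1) c ξ := by
  induction k with
  | zero =>
    refine form_ext fun x => ?_
    rw [pow_zero, one_smul, curryLeft_wedgeLin_one_zero, curryLeft_wedgeLin_left h rfl]
    refine form_ext_zero ?_
    rw [wedgeLin_zero_zero]
    rfl
  | succ k ih =>
    refine form_ext fun x => ?_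
    rw [curryLeft_wedgeLin (k := 0) h (Nat.zero_add (k + 1)) (Nat.add_comm 1 k), wedgeLin_zero_left,
      ih, curryLeft_zsmul_apply, curryLeft_wedgeLin_one]
    have : (ξ.curryLeft x) ![] = ξ ![x] := rfl
    rw [this]
    rcases neg_one_pow_eq_or ℤ k with h | h <;> simp only [pow_succ, pow_zero, h] <;> module

/-- The linear combination of sections with real coefficients. -/
def realComb {J : Type*} [Fintype J] (B : J → M) (c : J → ℝ) : M := ∑ j, algebraMap ℝ R (c j) • B j

variable {J : Type*} [Fintype J]

theorem realComb_add (B : J → M) (c c' : J → ℝ) :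
    realComb (R := R) B (c + c') = realComb (R := R) B c + realComb (R := R) B c' := by
  simp only [realComb, Pi.add_apply, map_add, add_smul, Finset.sum_add_distrib]

theorem realComb_smul (B : J → M) (r : ℝ) (c : J → ℝ) :
    realComb (R := R) B (r • c) = algebraMap ℝ R r • realComb (R := R) B c := by
  simp only [realComb, Pi.smul_apply, smul_eq_mul, map_mul, mul_smul, Finset.smul_sum]

theorem realComb_single [DecidableEq J] (B : J → M) (j : J) :
    realComb (R := R) B (Pi.single j 1) = B j := by
  rw [realComb, Finset.sum_eq_single j]
  · simp
  · intro i _ hi; simp [hi]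
  · simp

/-- The value of a form at a point, with respect to a family of sections. -/
def pullForm (p : R →ₐ[ℝ] ℝ) (B : J → M) {k : ℕ} (η : M [⋀^Fin k]→ₗ[R] R) :
    (J → ℝ) [⋀^Fin k]→ₗ[ℝ] ℝ where
  toFun v := p (η fun i => realComb (R := R) B (v i))
  map_update_add' {inst} v i x y := by
    obtain rfl := Subsingleton.elim inst (instDecidableEqFin k)
    have : ∀ z, (fun j => realComb (R := R) B (Function.update v i z j)) =
        Function.update (fun j => realComb (R := R) B (v j)) i (realComb (R := R) B z) := fun z => by
      ext j; rcases eq_or_ne j i with rfl | hj <;> simp [*]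
    rw [this, this, this, realComb_add, η.map_update_add, map_add]
  map_update_smul' {inst} v i c x := by
    obtain rfl := Subsingleton.elim inst (instDecidableEqFin k)
    have : ∀ z, (fun j => realComb (R := R) B (Function.update v i z j)) =
        Function.update (fun j => realComb (R := R) B (v j)) i (realComb (R := R) B z) := fun z => by
      ext j; rcases eq_or_ne j i with rfl | hj <;> simp [*]
    rw [this, this, realComb_smul, η.map_update_smul, smul_eq_mul, map_mul, AlgHom.commutes]
    rfl
  map_eq_zero_of_eq' v i j hij hne := by
    rw [η.map_eq_zero_of_eq _ (congrArg (realComb (R := R) B) hij) hne, map_zero]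

theorem pullForm_apply (p : R →ₐ[ℝ] ℝ) (B : J → M) {k : ℕ} (η : M [⋀^Fin k]→ₗ[R] R)
    (v : Fin k → J → ℝ) : pullForm p B η v = p (η fun i => realComb (R := R) B (v i)) := rfl

theorem agreeOn_pullForm [DecidableEq J] (p : R →ₐ[ℝ] ℝ) (B : J → M) {k : ℕ}
    (η : M [⋀^Fin k]→ₗ[R] R) :
    AgreeOn p (AlgHom.id ℝ ℝ) B (fun j => Pi.single j (1 : ℝ)) η (pullForm p B η) := by
  intro s
  change _ = p (η fun i => realComb (R := R) B (Pi.single (s i) 1))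
  simp only [realComb_single]
  rfl

/-- The top power of a two-form that is nondegenerate at a point does not vanish on a frame. -/
theorem wedgePow_apply_ne_zero [DecidableEq J] {p : R →ₐ[ℝ] ℝ} {B : J → M} (b : M [⋀^Fin 2]→ₗ[R] R)
    (hb : ∀ c : J → ℝ, (∀ j, p (b ![realComb (R := R) B c, B j]) = 0) → c = 0)
    {n : ℕ} (s : Fin (2 * n) ≃ J) : p (wedgePow b n (B ∘ s)) ≠ 0 := by
  have h1 := (agreeOn_pullForm p B b).wedgePow n s
  rw [h1]
  have h2 : Module.finrank ℝ (J → ℝ) = 2 * n := by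
    rw [Module.finrank_fintype_fun_eq_card, Fintype.card_congr s.symm, Fintype.card_fin]
  have h3 := wedgePow_ne_zero (pullForm p B b) (fun v hv => hb v fun j => ?_) n h2.ge
  -- A nonzero alternating form of top degree is nonzero on every basis.
  · have h4 := (AlternatingMap.map_basis_ne_zero_iff ((Pi.basisFun ℝ J).reindex s.symm) _).2 h3
    have h5 : ((fun j => Pi.single j (1 : ℝ)) ∘ s : Fin (2 * n) → J → ℝ) =
        (Pi.basisFun ℝ J).reindex s.symm := by
      ext i : 1; simp
    rw [h5]
    exact h4
  · have := hv (Pi.single j 1)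
    rw [pullForm_apply] at this
    convert this using 3
    ext i
    fin_cases i
    · rfl
    · exact (realComb_single B j).symm

end Multilinear

section Multilinear

variable {R M : Type*} [CommRing R] [AddCommGroup M] [Module R M]

theorem two_form_swap (b : M [⋀^Fin 2]→ₗ[R] R) (x y : M) : b ![x, y] = - b ![y, x] := by
  have h := b.map_swap ![y, x] (i := 0) (j := 1) (by decide)
  rw [← h]
  congr 1
  ext i
  fin_cases i <;> rfl

/-- A two-form as a linear form in its first argument. -/
def slot (b : M [⋀^Fin 2]→ₗ[R] R) (y : M) : M →ₗ[R] R where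
  toFun x := b ![x, y]
  map_add' x x' := b.map_vecCons_add ![y] x x'
  map_smul' c x := b.map_vecCons_smul ![y] c x

theorem slot_apply (b : M [⋀^Fin 2]→ₗ[R] R) (x y : M) : slot b y x = b ![x, y] := rfl

/-- A one-form as a linear form. -/
def oneForm (a : M [⋀^Fin 1]→ₗ[R] R) : M →ₗ[R] R where
  toFun x := a ![x]
  map_add' x x' := a.map_vecCons_add ![] x x'
  map_smul' c x := a.map_vecCons_smul ![] c x

theorem oneForm_apply (a : M [⋀^Fin 1]→ₗ[R] R) (x : M) : oneForm a x = a ![x] := rfl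

end Multilinear

/-- Every linear form is ι_D b for some D, so killing b(w, ·) at p kills all linear forms on w
there: nondegeneracy on sections becomes injectivity on fibres. -/
theorem IsSymplectic.nullAt {R L : Type*} [CommRing R] [LieRing L] [Module R L]
    [LieRingModule L R] [Algebra ℝ R] {b : Form R L 2} (hb : IsSymplectic b) {p : R →ₐ[ℝ] ℝ}
    {w : L} (h : ∀ D, p (b ![w, D]) = 0) : NullAt p w := fun ξ => by
  obtain ⟨D, hD⟩ := hb.nondegenerate.2 (AlternatingMap.ofSubsingleton R L R (0 : Fin 1) ξ)
  have h1 : ξ w = b ![D, w] := congrArg (fun a : Form R L 1 => a ![w]) hD.symm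
  rw [h1, two_form_swap, map_neg, h, neg_zero]

/-! ### Adapted frames along Z -/

section Frames

open scoped Topology
open Filter

attribute [local instance] logModule logSMul

variable {E : Type*} [NormedAddCommGroup E] [NormedSpace ℝ E] [FiniteDimensional ℝ E]
  {X : Type*} [TopologicalSpace X] [ChartedSpace E X] [IsManifold 𝓘(ℝ, E) ∞ X] [T2Space X]
  {F : Type*} [NormedAddCommGroup F] [NormedSpace ℝ F] [FiniteDimensional ℝ F]
  {Z : Type*} [TopologicalSpace Z] [ChartedSpace F Z] [IsManifold 𝓘(ℝ, F) ∞ Z] [T2Space Z]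
  {ι : C^∞⟮𝓘(ℝ, F), Z; 𝓘(ℝ, E), X⟯}
  {θ : logTangent E (Set.range ι) →ₗ[Fun E X] Fun E X}
  {e : logTangent E (Set.range ι)}

/-- The differential of a function, as a linear form on the log vector fields. -/
def logDiff (Y : Set X) (f : Fun E X) : logTangent E Y →ₗ[Fun E X] Fun E X where
  toFun D := (D : VF E X) f
  map_add' _ _ := rfl
  map_smul' _ _ := rfl

theorem logDiff_apply (Y : Set X) (f : Fun E X) (D : logTangent E Y) :
    logDiff Y f D = (D : VF E X) f := rfl

/-- Coordinate vector fields on the hypersurface at a point, with their lifts. -/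
structure FrameAt (θ : logTangent E (Set.range ι) →ₗ[Fun E X] Fun E X) {d : ℕ}
    (V : Fin d → VF F Z) (W : Fin d → logTangent E (Set.range ι)) (t : Fin d → Fun F Z)
    (T : Fin d → Fun E X) (z : Z) : Prop where
  rel : ∀ i, RelAt ι z (W i : VF E X) (V i)
  theta : ∀ i, θ (W i) (ι z) = 0
  dual : ∀ i j, V i (t j) z = if i = j then 1 else 0
  expand : ∀ (D : VF F Z) (f : Fun F Z), D f z = ∑ i, D (t i) z * V i f z
  extend : ∀ (D : logTangent E (Set.range ι)) (U : VF F Z), RelAt ι z (D : VF E X) U →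
    ∀ i, (D : VF E X) (T i) (ι z) = U (t i) z

theorem IsSplitting.exists_frame (h : IsSplitting ι θ e) {d : ℕ} (hd : Module.finrank ℝ F = d)
    (y : Z) : ∃ (V : Fin d → VF F Z) (W : Fin d → logTangent E (Set.range ι))
      (t : Fin d → Fun F Z) (T : Fin d → Fun E X), ∀ᶠ z in 𝓝 y, FrameAt θ V W t T z := by
  obtain ⟨V, t, h1, h2⟩ := exists_local_frame (E := F) hd y
  choose W hW hθ using fun i => h.exists_lift_at (V i) y
  choose T hT using fun i => h.extend (t i) y
  refine ⟨V, W, t, T, ?_⟩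
  filter_upwards [h1, h2, eventually_all.2 hW, eventually_all.2 fun i => (hT i).eventually_nhds]
    with z k1 k2 k3 k4
  refine ⟨k3, fun i => hθ i z, k1, k2, fun D U hU i => ?_⟩
  rw [hU]
  exact derivation_congr U (k4 i)

theorem coe_sum {J : Type*} (Y : Set X) (s : Finset J) (W : J → logTangent E Y) :
    ((∑ j ∈ s, W j : logTangent E Y) : VF E X) = ∑ j ∈ s, (W j : VF E X) :=
  map_sum (SMulMemClass.subtype (logTangent E Y)) _ _

theorem RelAt.realComb {z : Z} {d : ℕ} {W : Fin d → logTangent E (Set.range ι)}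
    {V : Fin d → VF F Z} (h : ∀ i, RelAt ι z (W i : VF E X) (V i)) (c : Fin d → ℝ) :
    RelAt ι z ((LogPoisson.realComb (R := Fun E X) W c : logTangent E (Set.range ι)) : VF E X)
      (LogPoisson.realComb (R := Fun F Z) V c) := fun f => by
  have h1 : ((LogPoisson.realComb (R := Fun E X) W c : logTangent E (Set.range ι)) : VF E X) =
      ∑ j, algebraMap ℝ (Fun E X) (c j) • (W j : VF E X) := coe_sum _ _ _
  rw [h1, LogPoisson.realComb, derivation_sum_smul_apply, derivation_sum_smul_apply]
  exact Finset.sum_congr rfl fun i _ => congrArg (c i * ·) (h i f)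

theorem theta_realComb {z : Z} {d : ℕ} {W : Fin d → logTangent E (Set.range ι)}
    (h : ∀ i, θ (W i) (ι z) = 0) (c : Fin d → ℝ) :
    θ (realComb (R := Fun E X) W c) (ι z) = 0 := by
  rw [realComb, map_sum, sum_apply]
  refine Finset.sum_eq_zero fun i _ => ?_
  rw [map_smul]
  change c i * θ (W i) (ι z) = 0
  rw [h, mul_zero]

namespace FrameAt

variable {d : ℕ} {V : Fin d → VF F Z} {W : Fin d → logTangent E (Set.range ι)}
  {t : Fin d → Fun F Z} {T : Fin d → Fun E X} {z : Z}

theorem nullAt_sub (hf : FrameAt θ V W t T z) (D : VF F Z) :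
    NullAt (evalAt (E := F) z) (D - ∑ i, D (t i) • V i) :=
  nullAt_of_eq fun f => by rw [hf.expand D f, derivation_sum_smul_apply]

theorem apply_eq_sum (hf : FrameAt θ V W t T z) (l : VF F Z →ₗ[Fun F Z] Fun F Z) (D : VF F Z) :
    l D z = ∑ i, D (t i) z * l (V i) z := by
  have h1 := hf.nullAt_sub D l
  rw [map_sub, map_sub, sub_eq_zero] at h1
  refine h1.trans ?_
  rw [map_sum, evalAt_apply, sum_apply]
  refine Finset.sum_congr rfl fun i _ => ?_
  rw [map_smul]
  rfl

/-- The sections e and W i span the fibre of the log-tangent bundle, with coordinates given by θ and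
the differentials of the T i. -/
theorem nullAt_log_sub (hf : FrameAt θ V W t T z) (h : IsSplitting ι θ e)
    (D : logTangent E (Set.range ι)) :
    NullAt (evalAt (E := E) (ι z)) (D - (θ D • e + ∑ i, (D : VF E X) (T i) • W i)) := by
  obtain ⟨U, hU⟩ := h.restrict D z
  have hU := hU.self_of_nhds
  refine h.log.null _ _ ⟨z, rfl⟩ (fun f => ?_) ?_
  · have h1 : ((∑ i, (D : VF E X) (T i) • W i : logTangent E (Set.range ι)) : VF E X) =
        ∑ i, (D : VF E X) (T i) • (W i : VF E X) := coe_sum _ _ _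
    change (D : VF E X) f (ι z) - (θ D (ι z) * (e : VF E X) f (ι z) +
      ((∑ i, (D : VF E X) (T i) • W i : logTangent E (Set.range ι)) : VF E X) f (ι z)) = 0
    rw [h1, derivation_sum_smul_apply, h.euler.1 f _ ⟨z, rfl⟩, mul_zero, zero_add, hU, hf.expand U,
      sub_eq_zero]
    refine Finset.sum_congr rfl fun i _ => ?_
    rw [hf.extend D U hU i, hf.rel]
  · rw [map_sub, map_add, map_smul, map_sum]
    change θ D (ι z) - (θ D (ι z) * θ e (ι z) +
      (∑ i, θ ((D : VF E X) (T i) • W i)) (ι z)) = 0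
    rw [h.log.euler e h.euler _ ⟨z, rfl⟩, mul_one, sum_apply, Finset.sum_eq_zero, add_zero, sub_self]
    intro i _
    rw [map_smul]
    change (D : VF E X) (T i) (ι z) * θ (W i) (ι z) = 0
    rw [hf.theta, mul_zero]

theorem apply_eq_zero (hf : FrameAt θ V W t T z) (h : IsSplitting ι θ e)
    (l : logTangent E (Set.range ι) →ₗ[Fun E X] Fun E X) (he : l e (ι z) = 0)
    (hW : ∀ i, l (W i) (ι z) = 0) (D : logTangent E (Set.range ι)) : l D (ι z) = 0 := by
  have h1 := hf.nullAt_log_sub h D l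
  rw [map_sub, map_sub, sub_eq_zero] at h1
  refine h1.trans ?_
  rw [map_add, map_smul, map_sum, evalAt_apply]
  change θ D (ι z) * l e (ι z) + (∑ i, l ((D : VF E X) (T i) • W i)) (ι z) = 0
  rw [he, mul_zero, zero_add, sum_apply]
  refine Finset.sum_eq_zero fun i _ => ?_
  rw [map_smul]
  change _ * l (W i) (ι z) = 0
  rw [hW, mul_zero]

variable {b : Form (Fun E X) (logTangent E (Set.range ι)) 2}

theorem nullAt_of_symplectic (hf : FrameAt θ V W t T z) (h : IsSplitting ι θ e)
    (hb : IsSymplectic b) {w : logTangent E (Set.range ι)} (he : b ![w, e] (ι z) = 0)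
    (hW : ∀ i, b ![w, W i] (ι z) = 0) : NullAt (evalAt (E := E) (ι z)) w :=
  hb.nullAt fun D => hf.apply_eq_zero h (oneForm (b.curryLeft w)) he hW D

/-- Nondegeneracy makes the combination zero in the fibre; evaluating θ and the differentials of the
T j then reads off its coefficients. -/
theorem nondegenerate (hf : FrameAt θ V W t T z) (h : IsSplitting ι θ e) (hb : IsSymplectic b)
    (c : Fin (d + 1) → ℝ)
    (hc : ∀ j, evalAt (E := E) (ι z) (b ![realComb (R := Fun E X) (Matrix.vecCons e W) c,
      Matrix.vecCons e W j]) = 0) : c = 0 := by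
  have h1 : NullAt (evalAt (E := E) (ι z)) (realComb (R := Fun E X) (Matrix.vecCons e W) c) :=
    hf.nullAt_of_symplectic h hb (hc 0) fun i => hc i.succ
  have h2 : ∀ l : logTangent E (Set.range ι) →ₗ[Fun E X] Fun E X,
      c 0 * l e (ι z) + ∑ i : Fin d, c i.succ * l (W i) (ι z) = 0 := fun l => by
    have h3 := h1 l
    rw [realComb, map_sum, evalAt_apply, sum_apply, Fin.sum_univ_succ, map_smul] at h3
    refine Eq.trans ?_ h3
    congr 1
    refine Finset.sum_congr rfl fun i _ => ?_
    rw [map_smul]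
    rfl
  ext j
  refine Fin.cases ?_ (fun j => ?_) j
  · have h3 := h2 θ
    have h4 : c 0 = 0 := by simpa only [hf.theta, mul_zero, Finset.sum_const_zero, add_zero, h.log.euler e h.euler _ ⟨z, rfl⟩,
      mul_one] using h3
    exact h4
  · have h3 := h2 (logDiff _ (T j))
    simp only [logDiff_apply, h.euler.1 _ _ ⟨z, rfl⟩, mul_zero, zero_add] at h3
    rw [Finset.sum_eq_single j] at h3
    · rw [hf.extend _ _ (hf.rel j), hf.dual, if_pos rfl, mul_one] at h3
      exact h3
    · intro i _ hij
      rw [hf.extend _ _ (hf.rel i), hf.dual, if_neg hij, mul_zero]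
    · simp

end FrameAt

end Frames

/-! ### The cosymplectic tuple -/

section Cosymplectic

open scoped Topology
open Filter

attribute [local instance] logModule logSMul

variable {E : Type*} [NormedAddCommGroup E] [NormedSpace ℝ E] [FiniteDimensional ℝ E]
  {X : Type*} [TopologicalSpace X] [ChartedSpace E X] [IsManifold 𝓘(ℝ, E) ∞ X] [T2Space X]
  {F : Type*} [NormedAddCommGroup F] [NormedSpace ℝ F] [FiniteDimensional ℝ F]
  {Z : Type*} [TopologicalSpace Z] [ChartedSpace F Z] [IsManifold 𝓘(ℝ, F) ∞ Z] [T2Space Z]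
  {ι : C^∞⟮𝓘(ℝ, F), Z; 𝓘(ℝ, E), X⟯}
  {θ : logTangent E (Set.range ι) →ₗ[Fun E X] Fun E X}
  {e : logTangent E (Set.range ι)}
  {b : Form (Fun E X) (logTangent E (Set.range ι)) 2}
  {α : Form (Fun F Z) (VF F Z) 1} {β : Form (Fun F Z) (VF F Z) 2}

theorem IsDesc.apply_one (hα : IsDesc θ (b.curryLeft e) α) {z : Z}
    {W : logTangent E (Set.range ι)} {V : VF F Z} (h : RelAt ι z (W : VF E X) V)
    (h0 : θ W (ι z) = 0) : b ![e, W] (ι z) = α ![V] z :=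
  hα z ![W] ![V] (fun i => by fin_cases i; exact h) (fun i => by fin_cases i; exact h0)

theorem IsDesc.apply_two (hβ : IsDesc θ b β) {z : Z}
    {W W' : logTangent E (Set.range ι)} {V V' : VF F Z} (h : RelAt ι z (W : VF E X) V)
    (h0 : θ W (ι z) = 0) (h' : RelAt ι z (W' : VF E X) V') (h0' : θ W' (ι z) = 0) :
    b ![W, W'] (ι z) = β ![V, V'] z :=
  hβ z ![W, W'] ![V, V'] (fun i => by fin_cases i; exacts [h, h'])
    (fun i => by fin_cases i; exacts [h0, h0'])

variable {d : ℕ} {V : Fin d → VF F Z} {W : Fin d → logTangent E (Set.range ι)}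
  {t : Fin d → Fun F Z} {T : Fin d → Fun E X} {z : Z}

namespace FrameAt

/-- Evaluate b^(m+1), nonzero on the frame (e, W), by contracting with e first: this is m + 1 times
the value of β^m ∧ α on V. -/
theorem spinor_ne_zero (hf : FrameAt θ V W t T z) (h : IsSplitting ι θ e) (hb : IsSymplectic b)
    (hα : IsDesc θ (b.curryLeft e) α) (hβ : IsDesc θ b β) {m : ℕ} (hd : 2 * (m + 1) = d + 1)
    (hd' : 2 * m + 1 = d) : wedge (wedgePow β m) α (V ∘ finCongr hd') z ≠ 0 := by
  have h1 := wedgePow_apply_ne_zero (p := evalAt (E := E) (ι z)) b (hf.nondegenerate h hb)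
    (finCongr hd)
  subst hd'
  have h2 : (Matrix.vecCons e W ∘ finCongr hd : Fin (2 * (m + 1)) → _) = Matrix.vecCons e W := rfl
  have h3 : wedgePow b (m + 1) (Matrix.vecCons e W) =
      (m + 1) • wedge (wedgePow b m) (b.curryLeft e) W :=
    congrArg (fun c : Form _ _ (2 * m + 1) => c W) (curryLeft_wedgePow_succ b e m)
  have h4 : wedge (wedgePow b m) (b.curryLeft e) W (ι z) = wedge (wedgePow β m) α V z :=
    ((h.agreeOn hβ hf.rel hf.theta).wedgePow m).wedge (h.agreeOn hα hf.rel hf.theta) id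
  rw [h2, h3, map_nsmul, evalAt_apply, h4] at h1
  exact fun h0 => h1 (by rw [show wedge (wedgePow β m) α V z = 0 from h0, smul_zero])

/-- The kernel of β at z is a line. On it α is injective, because a common kernel vector of α and β
would lift to a kernel vector of b; and it is nonzero, because the vector dual under b to the
e-coordinate lies in it. -/
theorem rankAt_eq (hf : FrameAt θ V W t T z) (h : IsSplitting ι θ e) (hb : IsSymplectic b)
    (hα : IsDesc θ (b.curryLeft e) α) (hβ : IsDesc θ b β) : rankAt β z + 1 = d := by
  let Φ : (Fin d → ℝ) →ₗ[ℝ] (VF F Z → ℝ) :=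
    { toFun := fun c U => ∑ i, c i * β ![V i, U] z
      map_add' := fun c c' => by
        ext U; simp only [Pi.add_apply, add_mul, Finset.sum_add_distrib]
      map_smul' := fun r c => by
        ext U; simp only [Pi.smul_apply, smul_eq_mul, RingHom.id_apply, Finset.mul_sum, mul_assoc] }
  have hΦ : ∀ c U, Φ c U = β ![realComb (R := Fun F Z) V c, U] z := fun c U => by
    change ∑ i, c i * β ![V i, U] z = slot β U (realComb (R := Fun F Z) V c) z
    rw [realComb, map_sum, sum_apply]
    refine Finset.sum_congr rfl fun i _ => ?_
    rw [map_smul]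
    rfl
  have hspan : Submodule.span ℝ (Set.range fun (D : VF F Z) => fun U : VF F Z => β ![D, U] z) =
      LinearMap.range Φ := by
    refine le_antisymm (Submodule.span_le.2 ?_) ?_
    · rintro _ ⟨D, rfl⟩
      refine ⟨fun i => D (t i) z, ?_⟩
      ext U
      exact (hf.apply_eq_sum (slot β U) D).symm
    · rintro _ ⟨c, rfl⟩
      exact Submodule.subset_span ⟨realComb (R := Fun F Z) V c, funext fun U => (hΦ c U).symm⟩
  have hrel := fun c => RelAt.realComb (W := W) (V := V) (z := z) hf.rel c
  have hth := fun c => theta_realComb (θ := θ) (W := W) (z := z) hf.theta c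
  have hcons : ∀ c : Fin d → ℝ, realComb (R := Fun E X) (Matrix.vecCons e W) (Matrix.vecCons 0 c) =
      realComb (R := Fun E X) W c := fun c => by
    rw [realComb, Fin.sum_univ_succ]
    simp only [Matrix.cons_val_zero, map_zero, zero_smul, zero_add, Matrix.cons_val_succ]
    rfl
  let a : (Fin d → ℝ) → ℝ := fun c => α ![realComb (R := Fun F Z) V c] z
  have hinj : ∀ c ∈ LinearMap.ker Φ, a c = 0 → c = 0 := fun c hc hac => by
    have h1 := hf.nondegenerate h hb (Matrix.vecCons 0 c) fun j => by
      rw [hcons, evalAt_apply]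
      refine Fin.cases ?_ (fun j => ?_) j
      · rw [two_form_swap]
        change - (b ![e, realComb (R := Fun E X) W c]) (ι z) = 0
        rw [hα.apply_one (hrel c) (hth c)]
        exact neg_eq_zero.2 hac
      · change b ![realComb (R := Fun E X) W c, W j] (ι z) = 0
        rw [hβ.apply_two (hrel c) (hth c) (hf.rel j) (hf.theta j), ← hΦ]
        exact congrFun hc _
    ext j
    exact congrFun h1 j.succ
  have hone : Module.finrank ℝ (LinearMap.ker Φ) = 1 := by
    -- Let v represent the e-coordinate, b(v, ·) = e*. Then e*(v) = b(v, v) = 0, so v comes from Z;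
    -- it kills the W j, hence lies in the kernel of β, and α(v) = b(e, v) = -1.
    obtain ⟨v, hv⟩ := exists_curryLeft_eq (pullForm (evalAt (E := E) (ι z)) (Matrix.vecCons e W) b)
      (fun v hv => hf.nondegenerate h hb v fun j => by
        have := hv (Pi.single j 1)
        rw [pullForm_apply] at this
        convert this using 3
        ext i : 1
        fin_cases i
        · rfl
        · exact (realComb_single (Matrix.vecCons e W) j).symm) (LinearMap.proj 0)
    have hv0 : v 0 = 0 := (hv v).symm.trans
      (AlternatingMap.map_eq_zero_of_eq _ ![v, v] (i := 0) (j := 1) rfl (by decide))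
    obtain ⟨c, rfl⟩ : ∃ c, v = Matrix.vecCons 0 c := ⟨Matrix.vecTail v, by
      rw [← hv0]; exact (Matrix.cons_head_tail v).symm⟩
    have hv' : ∀ j, b ![realComb (R := Fun E X) W c, Matrix.vecCons e W j] (ι z) =
        (Pi.single j 1 : Fin (d + 1) → ℝ) 0 := fun j => by
      have h1 := hv (Pi.single j 1)
      rw [pullForm_apply, evalAt_apply] at h1
      rw [← hcons]
      refine Eq.trans ?_ h1
      congr 2
      ext i : 1
      fin_cases i
      · rfl
      · exact (realComb_single (Matrix.vecCons e W) j).symm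
    have hker : c ∈ LinearMap.ker Φ := by
      rw [LinearMap.mem_ker]
      ext U
      rw [hΦ, two_form_swap, ← slot_apply]
      change - (slot β (realComb (R := Fun F Z) V c) U z) = 0
      rw [hf.apply_eq_sum, neg_eq_zero]
      refine Finset.sum_eq_zero fun i _ => ?_
      rw [slot_apply, two_form_swap]
      change _ * - (β ![realComb (R := Fun F Z) V c, V i] z) = 0
      rw [← hβ.apply_two (hrel c) (hth c) (hf.rel i) (hf.theta i)]
      have := hv' i.succ
      rw [Pi.single_eq_of_ne (Fin.succ_ne_zero i).symm] at this
      change b ![realComb (R := Fun E X) W c, W i] (ι z) = 0 at this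
      rw [this, neg_zero, mul_zero]
    have hac : a c = -1 := by
      have h1 := hv' 0
      rw [Pi.single_eq_same, two_form_swap] at h1
      change - (b ![e, realComb (R := Fun E X) W c]) (ι z) = 1 at h1
      rw [hα.apply_one (hrel c) (hth c)] at h1
      change α ![realComb (R := Fun F Z) V c] z = -1
      linarith
    have halin : ∀ (r : ℝ) (c' : Fin d → ℝ), a (c' + r • c) = a c' + r * a c := fun r c' => by
      change oneForm α _ z = oneForm α _ z + r * oneForm α _ z
      rw [realComb_add, realComb_smul, map_add, map_smul]
      rfl
    refine finrank_eq_one (⟨c, hker⟩ : LinearMap.ker Φ) ?_ fun w => ⟨-a w, ?_⟩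
    · intro h0
      have h1 : c = 0 := congrArg Subtype.val h0
      have h2 := halin 1 c
      rw [h1] at h2 hac
      simp only [smul_zero, add_zero, one_mul, hac] at h2
      norm_num at h2
    · apply Subtype.ext
      change -a w • c = (w : Fin d → ℝ)
      have h1 := hinj ((w : Fin d → ℝ) + a w • c) ((LinearMap.ker Φ).add_mem w.2
        ((LinearMap.ker Φ).smul_mem _ hker)) (by rw [halin, hac]; ring)
      rw [neg_smul]
      exact (eq_neg_of_add_eq_zero_left h1).symm
  have h1 := LinearMap.finrank_range_add_finrank_ker Φ
  rw [hone, Module.finrank_fintype_fun_eq_card, Fintype.card_fin] at h1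
  unfold rankAt
  rw [hspan]
  exact h1

end FrameAt

/-- The residues of a log-symplectic form define a cosymplectic structure. -/
theorem IsSplitting.isCosymplecticTuple (h : IsSplitting ι θ e) (hb : IsSymplectic b)
    (hα : IsDesc θ (b.curryLeft e) α) (hβ : IsDesc θ b β) {m : ℕ}
    (hd : Module.finrank ℝ F = 2 * m + 1) : IsCosymplecticTuple m α β where
  closed_one := h.formClosed_desc_curryLeft hb.closed hα
  closed_two := h.formClosed_desc hb.closed hβ
  rank z := by
    obtain ⟨V, W, t, T, hf⟩ := h.exists_frame hd z
    have := hf.self_of_nhds.rankAt_eq h hb hα hβ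
    omega
  nowhereZero z := by
    obtain ⟨V, W, t, T, hf⟩ := h.exists_frame hd z
    have h1 := hf.self_of_nhds.spinor_ne_zero h hb hα hβ (by omega) rfl
    refine ⟨V ∘ Fin.cast (Nat.add_comm 1 (2 * m)), fun h0 => h1 ?_⟩
    have h2 := congrArg (fun c : Form _ _ (2 * m + 1) => c V)
      (wedge_one_comm (wedgePow β m) α (Nat.add_comm 1 (2 * m)))
    change wedge α (wedgePow β m) (V ∘ Fin.cast (Nat.add_comm 1 (2 * m))) =
      (-1 : ℤ) ^ (2 * m) • wedgeLin rfl (wedgePow β m) α V at h2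
    rw [pow_mul, neg_one_sq, one_pow, one_smul, wedgeLin_rfl] at h2
    rw [h2] at h0
    exact h0

theorem IsSplitting.nowhereZero_spinor (h : IsSplitting ι θ e) (hb : IsSymplectic b)
    (hα : IsDesc θ (b.curryLeft e) α) (hβ : IsDesc θ b β) {m : ℕ}
    (hd : Module.finrank ℝ F = 2 * m + 1) : NowhereZero (spinor α β (2 * m + 1)) := fun z => by
  obtain ⟨V, W, t, T, hf⟩ := h.exists_frame hd z
  have h1 := hf.self_of_nhds.spinor_ne_zero h hb hα hβ (by omega) rfl
  refine ⟨V, fun h0 => h1 ?_⟩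
  change wedge (expForm β (2 * m)) α V z = 0 at h0
  rw [expForm_two_mul, wedge_real_smul_left] at h0
  change ((m ! : ℝ)⁻¹) * (wedge (wedgePow β m) α V z) = 0 at h0
  exact (mul_eq_zero.1 h0).resolve_left (by positivity)

/-- If α vanished at z, then e would be in the kernel of b there, hence zero in the fibre, against
θ(e) = 1. -/
theorem IsSplitting.nowhereZero_one (h : IsSplitting ι θ e) (hb : IsSymplectic b)
    (hα : IsDesc θ (b.curryLeft e) α) : NowhereZero α := fun z => by
  obtain ⟨V, W, t, T, hf⟩ := h.exists_frame rfl z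
  by_contra! hcon
  have hf := hf.self_of_nhds
  have h1 := hf.nullAt_of_symplectic h hb (w := e)
    (by rw [b.map_eq_zero_of_eq ![e, e] (i := 0) (j := 1) rfl (by decide)]; rfl)
    (fun i => by rw [hα.apply_one (hf.rel i) (hf.theta i)]; exact hcon _)
  have h2 := h1 θ
  rw [evalAt_apply, h.log.euler e h.euler _ ⟨z, rfl⟩] at h2
  exact one_ne_zero h2

end Cosymplectic

/-! ### The kernel of a closed one-form -/

section Algebroid

variable {R L : Type*} [CommRing R] [LieRing L] [Module R L] [LieRingModule L R]

/-- The kernel of a closed one-form is involutive. -/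
def kernelFoliation (a : Form R L 1) (ha : FormClosed a) : LieRinehartSubalgebra R L where
  carrier := {x | a ![x] = 0}
  add_mem' {x y} hx hy := by
    change oneForm a (x + y) = 0
    rw [map_add, oneForm_apply, oneForm_apply, hx, hy, add_zero]
  zero_mem' := (oneForm a).map_zero
  smul_mem' c x hx := by
    change oneForm a (c • x) = 0
    rw [map_smul, oneForm_apply, hx, smul_zero]
  lie_mem' {x y} hx hy := by
    have h := ha ![x, y]
    rw [extDer_one_apply, show a ![x] = 0 from hx, show a ![y] = 0 from hy, lie_zero, lie_zero,
      sub_zero, zero_sub, neg_eq_zero] at h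
    exact h

theorem mem_kernelFoliation {a : Form R L 1} {ha : FormClosed a} {x : L} :
    x ∈ kernelFoliation a ha ↔ a ![x] = 0 := Iff.rfl

theorem FormClosed.restrict {k : ℕ} {η : Form R L k} (hη : FormClosed η)
    (A : LieRinehartSubalgebra R L) : FormClosed (restrict A η) := fun v => by
  refine Eq.trans ?_ (hη fun i => (v i : L))
  cases k with
  | zero =>
    rw [extDer_zero_apply, extDer_zero_apply]
    have : LogPoisson.restrict A η ![] = η ![] := congrArg η (Subsingleton.elim _ _)
    rw [this]
    rfl
  | succ k =>
    rw [extDer_succ_apply, extDer_succ_apply]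
    congr 1
    refine Finset.sum_congr rfl fun i _ => Finset.sum_congr rfl fun j _ => ?_
    congr 1
    refine congrArg η (funext fun l => ?_)
    refine Fin.cases ?_ (fun l => ?_) l <;> rfl

end Algebroid

/-! ### The symplectic foliation -/

section Foliation

open scoped Topology
open Filter

attribute [local instance] logModule logSMul

variable {E : Type*} [NormedAddCommGroup E] [NormedSpace ℝ E] [FiniteDimensional ℝ E]
  {X : Type*} [TopologicalSpace X] [ChartedSpace E X] [IsManifold 𝓘(ℝ, E) ∞ X] [T2Space X]
  {F : Type*} [NormedAddCommGroup F] [NormedSpace ℝ F] [FiniteDimensional ℝ F]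
  {Z : Type*} [TopologicalSpace Z] [ChartedSpace F Z] [IsManifold 𝓘(ℝ, F) ∞ Z] [T2Space Z]
  {ι : C^∞⟮𝓘(ℝ, F), Z; 𝓘(ℝ, E), X⟯}
  {θ : logTangent E (Set.range ι) →ₗ[Fun E X] Fun E X}
  {e : logTangent E (Set.range ι)}
  {b : Form (Fun E X) (logTangent E (Set.range ι)) 2}
  {α : Form (Fun F Z) (VF F Z) 1} {β : Form (Fun F Z) (VF F Z) 2}

theorem NowhereZero.exists_one (hα : NowhereZero α) (z : Z) : ∃ U : VF F Z, α ![U] z ≠ 0 := by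
  obtain ⟨V, hV⟩ := hα z
  refine ⟨V 0, ?_⟩
  rwa [show V = ![V 0] from by ext i : 1; fin_cases i; rfl] at hV

/-- The projection to the kernel of a one-form along a vector field. -/
def leafProj (α : Form (Fun F Z) (VF F Z) 1) (hα : FormClosed α) (U : VF F Z) :
    VF F Z →ₗ[Fun F Z] kernelFoliation α hα where
  -- The usual projection multiplied by α(U), so that it is defined everywhere, zeros of α(U)
  -- included.
  toFun D := ⟨α ![U] • D - α ![D] • U, by
    rw [mem_kernelFoliation, ← oneForm_apply, map_sub, map_smul, map_smul, oneForm_apply,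
      oneForm_apply, smul_eq_mul, smul_eq_mul, mul_comm, sub_self]⟩
  map_add' D D' := by
    apply Subtype.ext
    change α ![U] • (D + D') - oneForm α (D + D') • U =
      (α ![U] • D - oneForm α D • U) + (α ![U] • D' - oneForm α D' • U)
    rw [map_add]
    module
  map_smul' c D := by
    apply Subtype.ext
    change α ![U] • (c • D) - oneForm α (c • D) • U = c • (α ![U] • D - oneForm α D • U)
    rw [map_smul, smul_eq_mul]
    module

theorem leafProj_coe (hα : FormClosed α) (U D : VF F Z) :
    (leafProj α hα U D : VF F Z) = α ![U] • D - α ![D] • U := rfl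

namespace IsSplitting

variable (h : IsSplitting ι θ e) (hb : IsSymplectic b)
  (hα : IsDesc θ (b.curryLeft e) α) (hβ : IsDesc θ b β)

include h hb hα hβ

/-- If β(D, ·) vanishes on ker α at z, it is a multiple r α there. A lift w of D then satisfies b(w
- r e, ·) = 0 at z, pairing with e giving -α(D) = 0, so w - r e is zero in the fibre and D vanishes
at z. -/
theorem eq_zero_of_leaf (hcl : FormClosed α) {D : VF F Z} {z : Z} (h1 : α ![D] z = 0)
    (h2 : ∀ U : kernelFoliation α hcl, β ![D, (U : VF F Z)] z = 0) (f : Fun F Z) : D f z = 0 := by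
  obtain ⟨V, W, t, T, hf⟩ := h.exists_frame rfl z
  have hf := hf.self_of_nhds
  obtain ⟨U, hU⟩ := (h.nowhereZero_one hb hα).exists_one z
  obtain ⟨w, hw, hw0⟩ := h.exists_lift_at D z
  have hw := hw.self_of_nhds
  have h3 : ∀ i, α ![U] z * β ![D, V i] z - α ![V i] z * β ![D, U] z = 0 := fun i => by
    have h4 := h2 (leafProj α hcl U (V i))
    have h5 : β ![D, (leafProj α hcl U (V i) : VF F Z)] =
        α ![U] * β ![D, V i] - α ![V i] * β ![D, U] := by
      change oneForm (β.curryLeft D) (leafProj α hcl U (V i) : VF F Z) = _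
      rw [leafProj_coe, map_sub, map_smul, map_smul]
      rfl
    rw [h5] at h4
    exact h4
  let r : ℝ := β ![D, U] z / α ![U] z
  have hn : NullAt (evalAt (E := E) (ι z)) (w - algebraMap ℝ (Fun E X) r • e) := by
    refine hf.nullAt_of_symplectic h hb ?_ fun i => ?_
    · rw [← slot_apply, map_sub, map_smul, slot_apply, slot_apply,
        b.map_eq_zero_of_eq ![e, e] (i := 0) (j := 1) rfl (by decide), smul_zero, sub_zero,
        two_form_swap]
      change - (b ![e, w] (ι z)) = 0
      rw [hα.apply_one hw (hw0 z), h1, neg_zero]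
    · rw [← slot_apply, map_sub, map_smul, slot_apply, slot_apply]
      change b ![w, W i] (ι z) - r * b ![e, W i] (ι z) = 0
      rw [hα.apply_one (hf.rel i) (hf.theta i), hβ.apply_two hw (hw0 z) (hf.rel i) (hf.theta i)]
      have h6 : r * α ![U] z = β ![D, U] z := div_mul_cancel₀ _ hU
      refine (mul_eq_zero.1 ?_).resolve_left hU
      linear_combination h3 i - α ![V i] z * h6
  rw [hf.expand D f]
  refine Finset.sum_eq_zero fun i _ => ?_
  have h4 := hn (logDiff _ (T i))
  change (w : VF E X) (T i) (ι z) - r * (e : VF E X) (T i) (ι z) = 0 at h4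
  rw [h.euler.1 _ _ ⟨z, rfl⟩, mul_zero, sub_zero, hf.extend w D hw] at h4
  rw [h4, zero_mul]

/-- Extend ξ near y to a one-form l on Z by the projection along a transverse U₀, and l to a log
one-form that kills e along Z. Solve b(w, ·) for this form and restrict w to Z: pairing with e gives
α(D) = 0, pairing with lifts of leafwise fields gives β(D, ·) = ξ. -/
theorem exists_local_leaf (hcl : FormClosed α) (ξ : Form (Fun F Z) (kernelFoliation α hcl) 1)
    (y : Z) : ∃ D : VF F Z, ∀ᶠ z in 𝓝 y, α ![D] z = 0 ∧
      ∀ U : kernelFoliation α hcl, β ![D, (U : VF F Z)] z = ξ ![U] z := by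
  obtain ⟨V, W, t, T, hf⟩ := h.exists_frame rfl y
  obtain ⟨U₀, hU₀⟩ := (h.nowhereZero_one hb hα).exists_one y
  obtain ⟨q, hq⟩ := exists_quotient_germ (f := (1 : Fun F Z)) hU₀
  -- The factor q, equal to 1/α(U₀) near y, undoes the scaling in `leafProj`.
  let l : VF F Z →ₗ[Fun F Z] Fun F Z := q • (oneForm ξ).comp (leafProj α hcl U₀)
  choose C hC using fun i => h.extend (l (V i)) y
  obtain ⟨w, hw⟩ := hb.nondegenerate.2 (AlternatingMap.ofSubsingleton (Fun E X) _ _ (0 : Fin 1)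
    (∑ i, C i • logDiff (Set.range ι) (T i)))
  have hw' : ∀ D, b ![w, D] = ∑ i, C i * (D : VF E X) (T i) := fun D => by
    have h1 : b ![w, D] = (∑ i, C i • logDiff (Set.range ι) (T i)) D :=
      congrArg (fun a : Form _ _ 1 => a ![D]) hw
    rw [h1, LinearMap.sum_apply]
    rfl
  obtain ⟨D, hD⟩ := h.restrict w y
  refine ⟨D, ?_⟩
  filter_upwards [hf, hD, hq, eventually_all.2 hC,
    (α ![U₀]).contMDiff.continuous.continuousAt.eventually_ne hU₀] with z k1 k2 k3 k4 k5
  have h0 : RelAt ι z ((w - θ w • e : logTangent E (Set.range ι)) : VF E X) D := fun f => by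
    change (w : VF E X) f (ι z) - θ w (ι z) * (e : VF E X) f (ι z) = _
    rw [h.euler.1 f _ ⟨z, rfl⟩, mul_zero, sub_zero, k2]
  have h0' : θ (w - θ w • e) (ι z) = 0 := by
    rw [map_sub, map_smul]
    change θ w (ι z) - θ w (ι z) * θ e (ι z) = 0
    rw [h.log.euler e h.euler _ ⟨z, rfl⟩, mul_one, sub_self]
  have hαz : α ![D] z = 0 := by
    rw [← hα.apply_one h0 h0', two_form_swap, ← slot_apply, map_sub, map_smul, slot_apply,
      slot_apply, b.map_eq_zero_of_eq ![e, e] (i := 0) (j := 1) rfl (by decide), smul_zero,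
      sub_zero, hw']
    change - ((∑ i, C i * (e : VF E X) (T i)) (ι z)) = 0
    rw [sum_apply, neg_eq_zero]
    refine Finset.sum_eq_zero fun i _ => ?_
    change _ * (e : VF E X) (T i) (ι z) = 0
    rw [h.euler.1 _ _ ⟨z, rfl⟩, mul_zero]
  refine ⟨hαz, fun U => ?_⟩
  obtain ⟨u, hu, hu0⟩ := h.exists_lift_at (U : VF F Z) z
  have hu := hu.self_of_nhds
  have hU : α ![(U : VF F Z)] = 0 := U.2
  rw [← hβ.apply_two h0 h0' hu (hu0 z), ← slot_apply, map_sub, map_smul, slot_apply, slot_apply,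
    hw']
  change (∑ i, C i * (u : VF E X) (T i)) (ι z) - θ w (ι z) * b ![e, u] (ι z) = _
  rw [hα.apply_one hu (hu0 z), hU]
  change _ - _ * (0 : ℝ) = _
  rw [mul_zero, sub_zero, sum_apply]
  have h1 : l (U : VF F Z) z = ξ ![U] z := by
    have h2 : leafProj α hcl U₀ (U : VF F Z) = α ![U₀] • U := by
      apply Subtype.ext
      rw [leafProj_coe, hU, zero_smul, sub_zero]
      rfl
    change q z * oneForm ξ (leafProj α hcl U₀ (U : VF F Z)) z = _
    rw [h2, map_smul, k3]
    change (1 : ℝ) / α ![U₀] z * (α ![U₀] z * ξ ![U] z) = _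
    field_simp
  rw [← h1, k1.apply_eq_sum l]
  refine Finset.sum_congr rfl fun i _ => ?_
  change C i (ι z) * (u : VF E X) (T i) (ι z) = _
  rw [k4, k1.extend u _ hu, mul_comm]

theorem isSymplectic_restrict (hcl : FormClosed α) :
    IsSymplectic (LogPoisson.restrict (kernelFoliation α hcl) β) where
  closed := (h.formClosed_desc hb.closed hβ).restrict _
  nondegenerate := by
    constructor
    · intro D D' hDD
      apply Subtype.ext
      rw [← sub_eq_zero]
      ext f z
      refine h.eq_zero_of_leaf hb hα hβ hcl (D := (D : VF F Z) - (D' : VF F Z)) ?_ (fun U => ?_) f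
      · rw [mem_kernelFoliation.1 ((kernelFoliation α hcl).sub_mem D.2 D'.2)]
        rfl
      · rw [← slot_apply, map_sub, slot_apply, slot_apply, sub_eq_zero.2]
        · rfl
        · have h1 := congrArg (fun a : Form _ _ 1 => a ![U]) hDD
          have h2 : ∀ D : kernelFoliation α hcl, ((LogPoisson.restrict (kernelFoliation α hcl)
              β).curryLeft D) ![U] = β ![(D : VF F Z), (U : VF F Z)] := fun D => by
            refine congrArg β (funext fun i => ?_)
            fin_cases i <;> rfl
          exact (h2 D).symm.trans (h1.trans (h2 D'))
    · intro ξ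
      choose D hD using h.exists_local_leaf hb hα hβ hcl ξ
      -- The local solutions agree where they overlap, since β is injective on ker α at each point;
      -- hence they glue without a partition of unity.
      obtain ⟨D', hD'⟩ := exists_glue (fun f z => D z f z) fun y => ⟨D y, by
        filter_upwards [hD y] with z hz f
        have h1 := (hD z).self_of_nhds
        have h2 := h.eq_zero_of_leaf hb hα hβ hcl (D := D z - D y) (z := z) (by
          rw [← oneForm_apply, map_sub]
          change α ![D z] z - α ![D y] z = 0
          rw [h1.1, hz.1, sub_self]) (fun U => by
          rw [← slot_apply, map_sub]
          change β ![D z, (U : VF F Z)] z - β ![D y, (U : VF F Z)] z = 0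
          rw [h1.2, hz.2, sub_self]) f
        exact sub_eq_zero.1 h2⟩
      have hn : ∀ z, NullAt (evalAt (E := F) z) (D' - D z) := fun z =>
        nullAt_of_eq fun f => hD' f z
      have hl : ∀ (l : VF F Z →ₗ[Fun F Z] Fun F Z) z, l D' z = l (D z) z := fun l z => by
        have := hn z l
        rw [map_sub, map_sub] at this
        exact sub_eq_zero.1 this
      refine ⟨⟨D', ?_⟩, ?_⟩
      · rw [mem_kernelFoliation]
        ext z
        exact (hl (oneForm α) z).trans (hD z).self_of_nhds.1
      · ext v z
        obtain ⟨U, rfl⟩ : ∃ U, v = ![U] := ⟨v 0, by ext i : 1; fin_cases i; rfl⟩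
        have h1 := (hl (slot β (U : VF F Z)) z).trans ((hD z).self_of_nhds.2 U)
        refine Eq.trans ?_ h1
        refine congrArg (fun x => β x z) (funext fun i => ?_)
        fin_cases i <;> rfl

theorem isUnimodularSymplecticFoliation (hcl : FormClosed α) :
    IsUnimodularSymplecticFoliation (kernelFoliation α hcl)
      (LogPoisson.restrict (kernelFoliation α hcl) β) where
  unimodular := ⟨α, hcl, h.nowhereZero_one hb hα, fun _ => mem_kernelFoliation⟩
  symplectic := h.isSymplectic_restrict hb hα hβ hcl

end IsSplitting

theorem isClosed_degeneracyLocus (n : ℕ) (p : Bivector (Fun E X) (VF E X)) :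
    IsClosed (degeneracyLocus n p) := by
  simp only [degeneracyLocus, Set.ofPred_forall]
  exact isClosed_iInter fun ξ =>
    isClosed_eq (wedgePow p n ξ).contMDiff.continuous continuous_const

end Foliation
end LogPoisson

end

/-! ### The main theorem -/

theorem mainTheorem7 (n : ℕ)
    {E : Type*} [NormedAddCommGroup E] [NormedSpace ℝ E] [FiniteDimensional ℝ E]
    (hE : Module.finrank ℝ E = 2 * n)
    {X : Type*} [TopologicalSpace X] [ChartedSpace E X] [IsManifold 𝓘(ℝ, E) ∞ X]
    [T2Space X] [SecondCountableTopology X]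
    {F : Type*} [NormedAddCommGroup F] [NormedSpace ℝ F] [FiniteDimensional ℝ F]
    (hF : Module.finrank ℝ F + 1 = 2 * n)
    {Z : Type*} [TopologicalSpace Z] [ChartedSpace F Z] [IsManifold 𝓘(ℝ, F) ∞ Z]
    -- the log-Poisson structure and its degeneracy locus, a smooth hypersurface
    (π : LogPoisson.Bivector (LogPoisson.Fun E X) (LogPoisson.VF E X))
    (hπ : LogPoisson.IsLogPoisson n π)
    (ι : C^∞⟮𝓘(ℝ, F), Z; 𝓘(ℝ, E), X⟯)
    (hι : Manifold.IsSmoothEmbedding 𝓘(ℝ, F) 𝓘(ℝ, E) ∞ ι)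
    (hZ : Set.range ι = LogPoisson.degeneracyLocus n π)
    -- the dual symplectic form on the log-tangent bundle
    (ωA : LogPoisson.Form (LogPoisson.Fun E X) (LogPoisson.logTangent E (Set.range ι)) 2)
    (hωA : LogPoisson.IsSymplectic ωA) (hdual : LogPoisson.IsDual π ωA)
    -- the residues of `e^ωA` and of `ωA`
    (ρ : LogPoisson.InhForm (LogPoisson.Fun F Z) (LogPoisson.VF F Z))
    (hρ : ρ = LogPoisson.totalResidue ι (LogPoisson.expForm ωA))
    (α : LogPoisson.Form (LogPoisson.Fun F Z) (LogPoisson.VF F Z) 1)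
    (hα : α = LogPoisson.residue ι ωA) :
    -- the residue of `e^ωA` is well defined, closed, and nowhere zero in top degree
    (∀ k, ∃! ξ, LogPoisson.IsResidue ι (LogPoisson.expForm ωA (k + 1)) ξ) ∧
    (∀ k, LogPoisson.FormClosed (ρ k)) ∧
    LogPoisson.NowhereZero (ρ (2 * n - 1)) ∧
    -- it spans a cosymplectic structure
    LogPoisson.IsCosymplecticStructure (n - 1) (LogPoisson.spinorLine ρ) ∧
    ∃ β : LogPoisson.Form (LogPoisson.Fun F Z) (LogPoisson.VF F Z) 2,
      -- it is the pure spinor of a cosymplectic tuple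
      LogPoisson.IsCosymplecticTuple (n - 1) α β ∧ ρ = LogPoisson.spinor α β ∧
      -- and it induces a unimodular corank-one symplectic foliation
      ∃ 𝓕 : LieRinehartSubalgebra (LogPoisson.Fun F Z) (LogPoisson.VF F Z),
        (∀ V, V ∈ 𝓕 ↔ α ![V] = 0) ∧
        LogPoisson.IsUnimodularSymplecticFoliation 𝓕 (LogPoisson.restrict 𝓕 β) := by
  have hT2 : T2Space Z := hι.isEmbedding.t2Space
  -- The dimension 2n - 1 of Z forces n to be positive.
  obtain ⟨m, rfl⟩ : ∃ m, n = m + 1 := ⟨n - 1, by omega⟩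
  -- Closedness of Z in X, needed to patch θ and e over X, holds because the degeneracy locus is a
  -- common zero set of smooth functions.
  obtain ⟨θ, e, h⟩ := LogPoisson.exists_isSplitting hι (hF.trans hE.symm)
    (hZ ▸ LogPoisson.isClosed_degeneracyLocus (m + 1) π)
  obtain ⟨a, ha⟩ := h.exists_desc (ωA.curryLeft e)
  obtain ⟨β, hβ⟩ := h.exists_desc ωA
  obtain rfl : α = a := hα.trans (h.residue_eq ha)
  obtain rfl : ρ = LogPoisson.spinor α β := hρ.trans (h.totalResidue_expForm ha hβ)
  have hd : Module.finrank ℝ F = 2 * m + 1 := by omega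
  have ht : LogPoisson.IsCosymplecticTuple m α β := h.isCosymplecticTuple hωA ha hβ hd
  exact ⟨fun k => h.existsUnique_isResidue _, fun k => ht.closed_one.spinor ht.closed_two k,
    h.nowhereZero_spinor hωA ha hβ hd, ⟨α, β, ht, rfl⟩, β, ht, rfl,
    LogPoisson.kernelFoliation α ht.closed_one, fun V => Iff.rfl,
    h.isUnimodularSymplecticFoliation hωA ha hβ ht.closed_one⟩
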